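/- Let $T>0$, and let $A\in L^1((0,T);\mathbb R^{n\times n})$, $B\in L^\infty((0,T);\mathbb R^{n\times m})$, $M\in C^1([0,T]^2;\mathbb R^{m\times m})$ with symmetric positive definite values, $Q\in C^1([0,T]^2;\mathbb R^{n\times n})$ and $G\in C^1([0,T];\mathbb R^{n\times n})$ with symmetric positive semidefinite values, and $S\in C^1([0,T]^2;\mathbb R^{m\times n})$. Subscripts $t$ or $s$ on $M,Q,S$ denote the partial derivative in the first variable. Differential equations are understood in the Carathéodory (integral) sense. *Control problem.* For $(t,x)\in[0,T)\times\mathbb R^n$ and a control $u\in L^2$, the state solves $\dot X=AX+Bu$ on $[t,T]$, $X(t)=x$, and $$J(t,x;u)=\int_t^T\big[\langle Q(t,s)X(s),X(s)\rangle+2\langle S(t,s)X(s),u(s)\rangle+\langle M(t,s)u(s),u(s)\rangle\big]ds+\langle G(t)X(T),X(T)\rangle .$$ For a feedback law $\bar u:[0,T]\times\mathbb R^n\to\mathbb R^m$, $J(t,x;\bar u)$ is this cost along the closed-loop state, with $u(s)=\bar u(s,X(s))$. A measurable $\bar u$ such that $\bar u(\cdot,X(\cdot))\in L^2([0,T];\mathbb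 R^m)$ for every continuous $X$, and whose closed-loop equation is uniquely solvable from every $(t,x)\in[0,T)\times\mathbb R^n$, is an *equilibrium control* if for all $(t,x)\in[0,T)\times\mathbb R^n$ and $v\in\mathbb R^m$ $$\liminf_{\varepsilon\searrow0}\frac{J(t,x;u^{\varepsilon,v})-J(t,x;\bar u)}{\varepsilon}\ge0,$$ where $u^{\varepsilon,v}(s,y)=v$ for $s\in[t,t+\varepsilon]$ and $u^{\varepsilon,v}(s,y)=\bar u(s,y)$ for $s\in(t+\varepsilon,T]$. It is *linear* if $\bar u(t,x)=\tilde u(t)x$ for some $\tilde u:[0,T]\to\mathbb R^{m\times n}$ (the integrability requirement then says $\tilde u\in L^2$, and unique solvability is automatic). *Boundary value problem.* Write $M^{-1}(s,s)=M(s,s)^{-1}$ and $F(s)=A(s)-B(s)M^{-1}(s,s)S(s,s)$. For an integrable function $\hat Q$ on $[0,T]$ with symmetric $n\times n$ values, consider on $[t,T]$ $$\dot{\bar X}=F\bar X-B M^{-1}B^\top\varphi,\qquad \dot\varphi=-F^\top\varphi-[\hat Q-S^\top M^{-1}S]\bar X,\qquad \bar X(t)=x,\quad \varphi(T)=G(T)\bar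 X(T),\tag{1}$$ with $M,S$ evaluated at $(s,s)$, together with the requirement that for all $s\in[t,T]$ $$\begin{aligned}\langle\hat Q(s)\bar X(s),\bar X(s)\rangle={}&\langle Q(s,s)\bar X(s),\bar X(s)\rangle-\langle\dot G(s)\bar X(T),\bar X(T)\rangle-\int_s^T\langle Q_s(s,\tau)\bar X(\tau),\bar X(\tau)\rangle d\tau\\&-\int_s^T\langle M_s(s,\tau)w(\tau)-2S_s(s,\tau)\bar X(\tau),\,w(\tau)\rangle d\tau,\end{aligned}\tag{2}$$ where $w(\tau)=M^{-1}(\tau,\tau)\big(B^\top(\tau)\varphi(\tau)+S(\tau,\tau)\bar X(\tau)\big)$. *Riccati equation.* For continuous $P:[0,T]\to\mathbb R^{n\times n}$ let $\Upsilon(s)=M^{-1}(s,s)(B^\top(s)P(s)+S(s,s))$, let $\Phi$ be the state-transition matrix of $A-B\Upsilon$ (that is, $\partial_t\Phi(t,s)=(A(t)-B(t)\Upsilon(t))\Phi(t,s)$, $\Phi(s,s)=I$), and $$\begin{aligned}\bar Q(t)={}&Q(t,t)-\Phi^\top(T,t)\dot G(t)\Phi(T,t)-\int_t^T\Phi^\top(s,t)Q_t(t,s)\Phi(s,t)ds\\&-\int_t^T\Phi^\top(s,t)\big[\Upsilon^\top(s)M_t(t,s)\Upsilon(s)-\Upsilon^\top(s)S_t(t,s)-S_t^\top(t,s)\Upsilon(s)\big]\Phi(s,t)ds.\end{aligned}$$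 $P$ solves the equilibrium Riccati equation if for all $t\in[0,T]$ $$P(t)=G(T)+\int_t^T\Big(A^\top P+PA+\bar Q-[PB+S^\top]M^{-1}[B^\top P+S]\Big)(s)\,ds ,\tag{3}$$ with $M,S$ evaluated at $(s,s)$. **Theorem.** The following are equivalent. (i) A linear equilibrium control exists. (ii) There is an integrable symmetric-matrix-valued function $\hat Q$ on $[0,T]$ such that for every $(t,x)\in[0,T)\times\mathbb R^n$ the problem (1)–(2) has a solution $(\bar X,\varphi)\in C([t,T];\mathbb R^n)\times C([t,T];\mathbb R^n)$. (iii) The equilibrium Riccati equation (3) has a solution $P\in C([0,T];\mathbb R^{n\times n})$ with symmetric values. Moreover, for every such $P$, the feedback $\bar u(t,x)=-M^{-1}(t,t)\big(B^\top(t)P(t)+S(t,t)\big)x$ is a (linear) equilibrium control. -/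

import Mathlib

open scoped Matrix

noncomputable section

/-- The data of the linear-quadratic problem: horizon `T`, dynamics `A`, `B`, and the
two-parameter weights `M`, `Q`, `S` and terminal weight `G` of the cost. The first argument
of `M`, `Q`, `S` is the time of evaluation, the second one the running time. -/
structure LQProblem (n m : ℕ) where
  T : ℝ
  A : ℝ → Matrix (Fin n) (Fin n) ℝ
  B : ℝ → Matrix (Fin n) (Fin m) ℝ
  M : ℝ → ℝ → Matrix (Fin m) (Fin m) ℝ
  Q : ℝ → ℝ → Matrix (Fin n) (Fin n) ℝ
  S : ℝ → ℝ → Matrix (Fin m) (Fin n) ℝ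
  G : ℝ → Matrix (Fin n) (Fin n) ℝ

/-- Entrywise integral of a matrix-valued function over `a..b`. -/
def matIntegral {k l : ℕ} (F : ℝ → Matrix (Fin k) (Fin l) ℝ) (a b : ℝ) :
    Matrix (Fin k) (Fin l) ℝ :=
  Matrix.of fun i j => ∫ r in a..b, F r i j

namespace LQProblem

variable {n m : ℕ} (D : LQProblem n m)

/-- The matrix-valued function `F` of two variables is `C¹` on the closed square `[0,T]²`. -/
def IsC1Square {k l : ℕ} (F : ℝ → ℝ → Matrix (Fin k) (Fin l) ℝ) : Prop :=
  ∀ i j, ContDiffOn ℝ 1 (fun p : ℝ × ℝ => F p.1 p.2 i j)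
    (Set.Icc 0 D.T ×ˢ Set.Icc 0 D.T)

/-- The standing assumptions. -/
structure Assumptions : Prop where
  T_pos : 0 < D.T
  A_L1 : ∀ i j, MeasureTheory.MemLp (fun t => D.A t i j) 1
    (MeasureTheory.volume.restrict (Set.Icc 0 D.T))
  B_Linfty : ∀ i j, MeasureTheory.MemLp (fun t => D.B t i j) ⊤
    (MeasureTheory.volume.restrict (Set.Icc 0 D.T))
  M_C1 : D.IsC1Square D.M
  M_posDef : ∀ t ∈ Set.Icc 0 D.T, ∀ s ∈ Set.Icc 0 D.T, (D.M t s).PosDef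
  Q_C1 : D.IsC1Square D.Q
  Q_posSemidef : ∀ t ∈ Set.Icc 0 D.T, ∀ s ∈ Set.Icc 0 D.T, (D.Q t s).PosSemidef
  G_C1 : ∀ i j, ContDiffOn ℝ 1 (fun t => D.G t i j) (Set.Icc 0 D.T)
  G_posSemidef : ∀ t ∈ Set.Icc 0 D.T, (D.G t).PosSemidef
  S_C1 : D.IsC1Square D.S

/-! ### The control problem -/

/-- `X` is the state on `[t,T]` driven by the control `u` from `X(t) = x`
(a Carathéodory solution of `X' = A X + B u`). -/
def IsState (t : ℝ) (x : Fin n → ℝ) (u : ℝ → Fin m → ℝ) (X : ℝ → Fin n → ℝ) : Prop :=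
  ContinuousOn X (Set.Icc t D.T) ∧
    ∀ s ∈ Set.Icc t D.T, X s = x + ∫ r in t..s, (D.A r *ᵥ X r + D.B r *ᵥ u r)

/-- The cost, evaluated at time `t`, of a state/control pair on `[t,T]`. -/
def cost (t : ℝ) (X : ℝ → Fin n → ℝ) (u : ℝ → Fin m → ℝ) : ℝ :=
  (∫ s in t..D.T, ((D.Q t s *ᵥ X s) ⬝ᵥ X s + 2 * ((D.S t s *ᵥ X s) ⬝ᵥ u s)))
    + (∫ s in t..D.T, (D.M t s *ᵥ u s) ⬝ᵥ u s)
    + (D.G t *ᵥ X D.T) ⬝ᵥ X D.T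

/-- `X` is the state on `[t,T]` from `X(t) = x` under the feedback law `ub`. -/
def IsClosedLoop (ub : ℝ → (Fin n → ℝ) → Fin m → ℝ) (t : ℝ) (x : Fin n → ℝ)
    (X : ℝ → Fin n → ℝ) : Prop :=
  D.IsState t x (fun s => ub s (X s)) X

/-- The closed-loop state under `ub` from `(t,x)`; it is meaningful, on `[t,T]`, when the
closed-loop equation is uniquely solvable. -/
def closedLoop (ub : ℝ → (Fin n → ℝ) → Fin m → ℝ) (t : ℝ) (x : Fin n → ℝ) :
    ℝ → Fin n → ℝ :=
  Classical.epsilon fun X => D.IsClosedLoop ub t x X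

/-- `J(t,x;ub)` for a feedback law `ub`. -/
def J (t : ℝ) (x : Fin n → ℝ) (ub : ℝ → (Fin n → ℝ) → Fin m → ℝ) : ℝ :=
  D.cost t (D.closedLoop ub t x) (fun s => ub s (D.closedLoop ub t x s))

open Classical in
/-- The perturbed law: the constant `v` on `[t, t + ε]`, and `ub` elsewhere. -/
def perturb (ub : ℝ → (Fin n → ℝ) → Fin m → ℝ) (t ε : ℝ) (v : Fin m → ℝ) :
    ℝ → (Fin n → ℝ) → Fin m → ℝ :=
  fun s y => if s ∈ Set.Icc t (t + ε) then v else ub s y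

/-- Equilibrium controls. The field `measurable` is Lebesgue measurability on
`[0,T] × ℝⁿ`; the limit inferior is taken in the extended reals. -/
structure IsEquilibrium (ub : ℝ → (Fin n → ℝ) → Fin m → ℝ) : Prop where
  measurable : AEMeasurable (Function.uncurry ub)
    (MeasureTheory.volume.restrict (Set.Icc 0 D.T ×ˢ (Set.univ : Set (Fin n → ℝ))))
  squareIntegrable : ∀ X : ℝ → Fin n → ℝ, ContinuousOn X (Set.Icc 0 D.T) →
    MeasureTheory.MemLp (fun s => ub s (X s)) 2
      (MeasureTheory.volume.restrict (Set.Icc 0 D.T))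
  wellPosed : ∀ t ∈ Set.Ico 0 D.T, ∀ x, ∃ X, D.IsClosedLoop ub t x X ∧
    ∀ Y, D.IsClosedLoop ub t x Y → Set.EqOn Y X (Set.Icc t D.T)
  equilibrium : ∀ t ∈ Set.Ico 0 D.T, ∀ (x : Fin n → ℝ) (v : Fin m → ℝ),
    (0 : EReal) ≤ Filter.liminf
      (fun ε : ℝ => (((D.J t x (perturb ub t ε v) - D.J t x ub) / ε : ℝ) : EReal))
      (nhdsWithin 0 (Set.Ioi 0))

/-- Linear equilibrium controls. -/
def IsLinearEquilibrium (ub : ℝ → (Fin n → ℝ) → Fin m → ℝ) : Prop :=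
  D.IsEquilibrium ub ∧
    ∃ ut : ℝ → Matrix (Fin m) (Fin n) ℝ, ∀ t ∈ Set.Icc 0 D.T, ∀ x, ub t x = ut t *ᵥ x

/-! ### Derivatives of the weights in the time of evaluation -/

/-- Partial derivative in the first variable, within `[0,T]`. -/
def d1 {k l : ℕ} (F : ℝ → ℝ → Matrix (Fin k) (Fin l) ℝ) (t s : ℝ) :
    Matrix (Fin k) (Fin l) ℝ :=
  Matrix.of fun i j => derivWithin (fun r => F r s i j) (Set.Icc 0 D.T) t

/-- The derivative of `G`, within `[0,T]`. -/
def dG (t : ℝ) : Matrix (Fin n) (Fin n) ℝ :=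
  Matrix.of fun i j => derivWithin (fun r => D.G r i j) (Set.Icc 0 D.T) t

/-- `M(s,s)⁻¹`. -/
def Minv (s : ℝ) : Matrix (Fin m) (Fin m) ℝ := (D.M s s)⁻¹

/-! ### The two-point boundary value problem -/

/-- The drift `A(s) - B(s) M(s,s)⁻¹ S(s,s)`. -/
def drift (s : ℝ) : Matrix (Fin n) (Fin n) ℝ :=
  D.A s - D.B s * D.Minv s * D.S s s

/-- `M(τ,τ)⁻¹ (B(τ)ᵀ φ(τ) + S(τ,τ) X(τ))`. -/
def gain (X φ : ℝ → Fin n → ℝ) (τ : ℝ) : Fin m → ℝ :=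
  D.Minv τ *ᵥ ((D.B τ)ᵀ *ᵥ φ τ + D.S τ τ *ᵥ X τ)

/-- The nonlocal quadratic form along `(X, φ)` at time `s`. -/
def nonlocalForm (X φ : ℝ → Fin n → ℝ) (s : ℝ) : ℝ :=
  (D.Q s s *ᵥ X s) ⬝ᵥ X s - (D.dG s *ᵥ X D.T) ⬝ᵥ X D.T
    - (∫ τ in s..D.T, (D.d1 D.Q s τ *ᵥ X τ) ⬝ᵥ X τ)
    - ∫ τ in s..D.T,
        (D.d1 D.M s τ *ᵥ D.gain X φ τ - (2 : ℝ) • (D.d1 D.S s τ *ᵥ X τ)) ⬝ᵥ D.gain X φ τ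

/-- `(X, φ)` is a continuous (Carathéodory) solution on `[t,T]` of the two-point boundary value
problem from `(t,x)`, where `Qh` is the coefficient written `Q̂(s,s)`; the last clause
is the relation that ties `Qh` to the solution. -/
structure IsBVPSolution (Qh : ℝ → Matrix (Fin n) (Fin n) ℝ) (t : ℝ) (x : Fin n → ℝ)
    (X φ : ℝ → Fin n → ℝ) : Prop where
  continuousOn_X : ContinuousOn X (Set.Icc t D.T)
  continuousOn_φ : ContinuousOn φ (Set.Icc t D.T)
  eq_X : ∀ s ∈ Set.Icc t D.T, X s = x + ∫ r in t..s,
    (D.drift r *ᵥ X r - (D.B r * D.Minv r * (D.B r)ᵀ) *ᵥ φ r)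
  eq_φ : ∀ s ∈ Set.Icc t D.T, φ s = D.G D.T *ᵥ X D.T + ∫ r in s..D.T,
    ((D.drift r)ᵀ *ᵥ φ r + (Qh r - (D.S r r)ᵀ * D.Minv r * D.S r r) *ᵥ X r)
  eq_Qh : ∀ s ∈ Set.Icc t D.T, (Qh s *ᵥ X s) ⬝ᵥ X s = D.nonlocalForm X φ s

/-- The two-point boundary value problem is solvable for all `(t,x) ∈ [0,T) × ℝⁿ`. The
coefficient `Q̂(s,s)` is one symmetric, integrable matrix function of `s`, which serves all
initial data. -/
def BVPSolvable : Prop :=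
  ∃ Qh : ℝ → Matrix (Fin n) (Fin n) ℝ,
    (∀ s ∈ Set.Icc 0 D.T, (Qh s).IsSymm) ∧
    (∀ i j, MeasureTheory.IntegrableOn (fun s => Qh s i j) (Set.Icc 0 D.T)) ∧
    ∀ t ∈ Set.Ico 0 D.T, ∀ x : Fin n → ℝ, ∃ X φ, D.IsBVPSolution Qh t x X φ

/-! ### The equilibrium Riccati equation -/

/-- `Υ(s) = M(s,s)⁻¹ (B(s)ᵀ P(s) + S(s,s))`. -/
def Upsilon (P : ℝ → Matrix (Fin n) (Fin n) ℝ) (s : ℝ) : Matrix (Fin m) (Fin n) ℝ :=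
  D.Minv s * ((D.B s)ᵀ * P s + D.S s s)

/-- `Φ(t,s)` is the state-transition matrix on `[0,T]` of `X' = F X`:
`∂ₜ Φ(t,s) = F(t) Φ(t,s)`, `Φ(s,s) = 1`. -/
def IsTransition (F : ℝ → Matrix (Fin n) (Fin n) ℝ)
    (Φ : ℝ → ℝ → Matrix (Fin n) (Fin n) ℝ) : Prop :=
  ∀ s ∈ Set.Icc 0 D.T, ContinuousOn (fun t => Φ t s) (Set.Icc 0 D.T) ∧
    ∀ t ∈ Set.Icc 0 D.T, Φ t s = 1 + matIntegral (fun r => F r * Φ r s) s t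

/-- The nonlocal term `Q̄(t,t)` built from `P` and the transition matrix `Φ`. -/
def Qbar (P : ℝ → Matrix (Fin n) (Fin n) ℝ) (Φ : ℝ → ℝ → Matrix (Fin n) (Fin n) ℝ)
    (t : ℝ) : Matrix (Fin n) (Fin n) ℝ :=
  D.Q t t - (Φ D.T t)ᵀ * D.dG t * Φ D.T t
    - matIntegral (fun s => (Φ s t)ᵀ * D.d1 D.Q t s * Φ s t) t D.T
    - matIntegral (fun s => (Φ s t)ᵀ *
        ((D.Upsilon P s)ᵀ * D.d1 D.M t s * D.Upsilon P s
          - (D.Upsilon P s)ᵀ * D.d1 D.S t s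
          - (D.d1 D.S t s)ᵀ * D.Upsilon P s) * Φ s t) t D.T

/-- `P` is a continuous symmetric solution of the equilibrium Riccati equation, in integral
form, with `Φ` the transition matrix of the closed-loop matrix `A - B Υ`. -/
def IsRiccatiSolution (P : ℝ → Matrix (Fin n) (Fin n) ℝ) : Prop :=
  ContinuousOn P (Set.Icc 0 D.T) ∧
  (∀ t ∈ Set.Icc 0 D.T, (P t).IsSymm) ∧
  ∃ Φ : ℝ → ℝ → Matrix (Fin n) (Fin n) ℝ,
    D.IsTransition (fun r => D.A r - D.B r * D.Upsilon P r) Φ ∧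
    ∀ t ∈ Set.Icc 0 D.T, P t = D.G D.T + matIntegral (fun s =>
      (D.A s)ᵀ * P s + P s * D.A s + D.Qbar P Φ s
        - (P s * D.B s + (D.S s s)ᵀ) * D.Minv s * ((D.B s)ᵀ * P s + D.S s s)) t D.T

/-- The feedback law `(t,x) ↦ -M(t,t)⁻¹ (B(t)ᵀ P(t) + S(t,t)) x`. -/
def riccatiFeedback (P : ℝ → Matrix (Fin n) (Fin n) ℝ) : ℝ → (Fin n → ℝ) → Fin m → ℝ :=
  fun t x => -((D.Minv t * ((D.B t)ᵀ * P t + D.S t t)) *ᵥ x)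

end LQProblem

end

/-!
Fix a linear feedback `-Υ`. The cost it generates from time `s` on, with the weights of time
`t`, is the quadratic form `⟨V(t,s) X(s), X(s)⟩` of a matrix solving a Lyapunov equation backwards
in `s`.
Completing the square along an arbitrary state gives the cost of a control `u` from `(t,x)` as
`⟨V(t,t) x, x⟩` plus the integral of `⟨M (u + ΥX), u + ΥX⟩ + 2 ⟨(Bᵀ V + S - M Υ) X, u + ΥX⟩`, all
weights taken at `(t,s)`. Under a spike perturbation at a Lebesgue point the excess per unit of time
converges to this integrand at `s = t`, which is nonnegative for all `x` and `v` if and only if its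
linear part vanishes, that is `Υ(t) = M(t,t)⁻¹ (B(t)ᵀ V(t,t) + S(t,t))`. If this holds at almost
every `t`, the chain rule on the diagonal turns the Lyapunov equation for `V(t,s)` into the
equilibrium Riccati equation for `P(t) = V(t,t)`, whose nonlocal term `Q̄` comes from the derivative
of the weights in the time of evaluation. Conversely, for the feedback of a solution `P` the linear
part tends to zero as `s → t`, so that the limit inferior is nonnegative at every `t`.

For the boundary value problem, a solution `P` of the Riccati equation decouples the system by
`φ = P X`. Conversely, let `(Ξ, Λ)` be the matrix solution of the system with terminal value
`(1, G(T))`. Every solution is `(Ξ y, Λ y)` with `y = X(T)`, so solvability from every `(t,x)` makes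
`Ξ` invertible. Then `P = Λ Ξ⁻¹` solves the Lyapunov equation with the weight `Q̂`, and the relation
tying `Q̂` to the solutions says that `Q̂ = Q̄`.
-/

noncomputable section

open scoped Matrix.Norms.Elementwise ENNReal
open MeasureTheory Set Filter Topology

/-- The topology of the entrywise norm, given precedence so that `IntegrableOn` and `MemLp` of
matrix functions find the norm; it is definitionally the usual topology. -/
local instance normTopologyMatrix (κ l : Type*) [Fintype κ] [Fintype l] :
    TopologicalSpace (Matrix κ l ℝ) :=
  (inferInstance : PseudoMetricSpace (Matrix κ l ℝ)).toUniformSpace.toTopologicalSpace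

/-! ### Carathéodory derivatives -/

section IntegralDerivative

variable {E F G : Type*} [NormedAddCommGroup E]

theorem intervalIntegrable_of_integrableOn_Icc {a b c d : ℝ} {f : ℝ → E}
    (hf : IntegrableOn f (Icc a b)) (hc : c ∈ Icc a b) (hd : d ∈ Icc a b) :
    IntervalIntegrable f volume c d :=
  intervalIntegrable_iff.2 (hf.mono_set (uIoc_subset_uIcc.trans (uIcc_subset_Icc hc hd)))

theorem ae_restrict_Icc_of_eqOn {X : Type*} {a b : ℝ} {f g : ℝ → X} (h : EqOn f g (Icc a b)) :
    f =ᵐ[volume.restrict (Icc a b)] g :=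
  (ae_restrict_iff' measurableSet_Icc).2 (ae_of_all _ h)

theorem integrable_triangle_indicator {μ ν : Measure ℝ} [SFinite μ] [SFinite ν] {ρ : ℝ → ℝ → E}
    (hρ : Integrable (Function.uncurry ρ) (μ.prod ν)) :
    Integrable (fun p : ℝ × ℝ => (Ici p.1).indicator (ρ p.1) p.2) (μ.prod ν) := by
  have := hρ.indicator (measurableSet_le measurable_fst measurable_snd)
  refine this.congr (ae_of_all _ fun p => ?_)
  by_cases hp : p.1 ≤ p.2 <;> simp [indicator, hp, Function.uncurry]

theorem memLp_top_of_continuousOn_isCompact {X : Type*} [TopologicalSpace X] [MeasurableSpace X]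
    [OpensMeasurableSpace X] {μ : Measure X} {K : Set X} {f : X → E} (hf : ContinuousOn f K)
    (hK : IsCompact K) (hKm : MeasurableSet K) : MemLp f ⊤ (μ.restrict K) := by
  obtain ⟨C, hC⟩ := hK.exists_bound_of_continuousOn hf
  exact memLp_top_of_bound (hf.aestronglyMeasurable_of_isCompact hK hKm) C
    ((ae_restrict_iff' hKm).2 (ae_of_all _ hC))

theorem memLp_top_of_continuousOn_Icc {a b : ℝ} {f : ℝ → E} (hf : ContinuousOn f (Icc a b)) :
    MemLp f ⊤ (volume.restrict (Icc a b)) :=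
  memLp_top_of_continuousOn_isCompact hf isCompact_Icc measurableSet_Icc

variable [NormedSpace ℝ E] [NormedAddCommGroup F] [NormedSpace ℝ F]
  [NormedAddCommGroup G] [NormedSpace ℝ G]

/-- `f` is absolutely continuous on `[a,b]` with almost everywhere derivative `f'`, expressed by
the fundamental theorem of calculus. Carathéodory solutions of differential equations are
functions with a prescribed derivative in this sense. -/
def HasIntegralDerivOn (a b : ℝ) (f f' : ℝ → E) : Prop :=
  IntegrableOn f' (Icc a b) ∧ ∀ s ∈ Icc a b, f s = f a + ∫ r in a..s, f' r

theorem intervalIntegral_congr_ae_restrict_Icc {a b c d : ℝ} {f g : ℝ → E}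
    (h : f =ᵐ[volume.restrict (Icc a b)] g) (hc : c ∈ Icc a b) (hd : d ∈ Icc a b) :
    ∫ r in c..d, f r = ∫ r in c..d, g r := by
  refine intervalIntegral.integral_congr_ae ?_
  filter_upwards [(ae_restrict_iff' measurableSet_Icc).1 h] with r hr hr'
  exact hr (uIoc_subset_uIcc.trans (uIcc_subset_Icc hc hd) hr')

theorem intervalIntegral_congr_Icc {a b c d : ℝ} {f g : ℝ → E} (h : EqOn f g (Icc a b))
    (hc : c ∈ Icc a b) (hd : d ∈ Icc a b) : ∫ r in c..d, f r = ∫ r in c..d, g r :=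
  intervalIntegral.integral_congr fun _ hr => h (uIcc_subset_Icc hc hd hr)

theorem intervalIntegral_triangle_swap {t T : ℝ} (htT : t ≤ T) {ρ : ℝ → ℝ → E}
    (hρ : Integrable (fun p : ℝ × ℝ => (Ici p.1).indicator (ρ p.1) p.2)
      ((volume.restrict (Ioc t T)).prod (volume.restrict (Ioc t T)))) :
    ∫ τ in t..T, ∫ s in t..τ, ρ s τ = ∫ s in t..T, ∫ τ in s..T, ρ s τ := by
  have inner_left : ∀ τ ∈ Ioc t T,
      ∫ s in t..τ, ρ s τ = ∫ s in Ioc t T, (Ici s).indicator (ρ s) τ := by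
    intro τ hτ
    have swap_indicator : (fun s => (Ici s).indicator (ρ s) τ) =
        (Iic τ).indicator fun s => ρ s τ := by
      ext s
      by_cases hs : s ≤ τ <;> simp [hs]
    rw [swap_indicator, setIntegral_indicator measurableSet_Iic, Ioc_inter_Iic,
      min_eq_right hτ.2, intervalIntegral.integral_of_le hτ.1.le]
  have inner_right : ∀ s ∈ Ioc t T,
      ∫ τ in s..T, ρ s τ = ∫ τ in Ioc t T, (Ici s).indicator (ρ s) τ := by
    intro s hs
    have inter_eq : Ioc t T ∩ Ici s = Icc s T := by
      ext τ
      exact ⟨fun h => ⟨h.2, h.1.2⟩, fun h => ⟨⟨hs.1.trans_le h.1, h.2⟩, h.1⟩⟩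
    rw [setIntegral_indicator measurableSet_Ici, inter_eq, integral_Icc_eq_integral_Ioc,
      intervalIntegral.integral_of_le hs.2]
  rw [intervalIntegral.integral_of_le htT, intervalIntegral.integral_of_le htT,
    setIntegral_congr_fun measurableSet_Ioc inner_left,
    setIntegral_congr_fun measurableSet_Ioc inner_right]
  exact (integral_integral_swap hρ).symm

theorem integrableOn_bilin_continuousOn (L : E →L[ℝ] F →L[ℝ] G) {a b : ℝ} {f : ℝ → E}
    {g : ℝ → F} (hf : IntegrableOn f (Icc a b)) (hg : ContinuousOn g (Icc a b)) :
    IntegrableOn (fun s => L (f s) (g s)) (Icc a b) :=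
  memLp_one_iff_integrable.1 (L.memLp_of_bilin 1 (memLp_one_iff_integrable.2 hf)
    (memLp_top_of_continuousOn_Icc hg))

theorem continuousOn_bilin_integrableOn (L : E →L[ℝ] F →L[ℝ] G) {a b : ℝ} {f : ℝ → E}
    {g : ℝ → F} (hf : ContinuousOn f (Icc a b)) (hg : IntegrableOn g (Icc a b)) :
    IntegrableOn (fun s => L (f s) (g s)) (Icc a b) :=
  integrableOn_bilin_continuousOn L.flip hg hf

theorem intervalIntegral_bilin_swap [CompleteSpace E] [CompleteSpace F] [CompleteSpace G]
    (L : E →L[ℝ] F →L[ℝ] G) {a b : ℝ} (hab : a ≤ b)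
    {f : ℝ → E} {g : ℝ → F} (hf : IntegrableOn f (Icc a b)) (hg : IntegrableOn g (Icc a b)) :
    ∫ r in a..b, L (∫ q in a..r, f q) (g r) = ∫ q in a..b, L (f q) (∫ r in q..b, g r) := by
  have ha := left_mem_Icc.2 hab
  have hb := right_mem_Icc.2 hab
  have prod_integrable : Integrable (Function.uncurry fun q r => L (f q) (g r))
      ((volume.restrict (Ioc a b)).prod (volume.restrict (Ioc a b))) :=
    (hf.mono_set Ioc_subset_Icc_self).op_fst_snd (op := fun x y => L x y)
      L.continuous₂ ⟨‖L‖, fun x y => L.le_opNorm₂ x y⟩ (hg.mono_set Ioc_subset_Icc_self)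
  rw [intervalIntegral_congr_Icc (fun r hr => ?_) ha hb,
    intervalIntegral_triangle_swap hab (integrable_triangle_indicator prod_integrable)]
  · refine intervalIntegral_congr_Icc (fun q hq => ?_) ha hb
    exact (L (f q)).intervalIntegral_comp_comm (intervalIntegrable_of_integrableOn_Icc hg hq hb)
  · exact ((L.flip (g r)).intervalIntegral_comp_comm
      (intervalIntegrable_of_integrableOn_Icc hf ha hr)).symm

namespace HasIntegralDerivOn

variable {a b : ℝ} {f f' f₁ f₁' : ℝ → E} {g g' : ℝ → F}

theorem sub_eq (h : HasIntegralDerivOn a b f f') {c d : ℝ} (hc : c ∈ Icc a b)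
    (hd : d ∈ Icc a b) : f d - f c = ∫ r in c..d, f' r := by
  have ha : a ∈ Icc a b := left_mem_Icc.2 (hc.1.trans hc.2)
  rw [h.2 c hc, h.2 d hd, add_sub_add_left_eq_sub, intervalIntegral.integral_interval_sub_left
    (intervalIntegrable_of_integrableOn_Icc h.1 ha hd)
    (intervalIntegrable_of_integrableOn_Icc h.1 ha hc)]

theorem continuousOn (h : HasIntegralDerivOn a b f f') : ContinuousOn f (Icc a b) :=
  ((intervalIntegral.continuousOn_primitive_Icc h.1).const_add (f a)).congr fun s hs => by
    rw [h.2 s hs, intervalIntegral.integral_of_le hs.1, ← integral_Icc_eq_integral_Ioc]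

theorem mono (h : HasIntegralDerivOn a b f f') {c d : ℝ} (hc : a ≤ c) (hd : d ≤ b) :
    HasIntegralDerivOn c d f f' := by
  refine ⟨h.1.mono_set (Icc_subset_Icc hc hd), fun s hs => ?_⟩
  rw [← h.sub_eq ⟨hc, hs.1.trans (hs.2.trans hd)⟩ ⟨hc.trans hs.1, hs.2.trans hd⟩,
    add_sub_cancel]

theorem congr (h : HasIntegralDerivOn a b f f') (hf : EqOn f₁ f (Icc a b))
    (hf' : f₁' =ᵐ[volume.restrict (Icc a b)] f') : HasIntegralDerivOn a b f₁ f₁' := by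
  refine ⟨h.1.congr_fun_ae hf'.symm, fun s hs => ?_⟩
  have ha : a ∈ Icc a b := left_mem_Icc.2 (hs.1.trans hs.2)
  rw [hf hs, hf ha, h.2 s hs, intervalIntegral_congr_ae_restrict_Icc hf' ha hs]

theorem congr_on (h : HasIntegralDerivOn a b f f') (hf : EqOn f₁ f (Icc a b))
    (hf' : EqOn f₁' f' (Icc a b)) : HasIntegralDerivOn a b f₁ f₁' :=
  h.congr hf (ae_restrict_Icc_of_eqOn hf')

theorem of_base {c : E} {r : ℝ} (hf' : IntegrableOn f' (Icc a b)) (hr : r ∈ Icc a b)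
    (h : ∀ s ∈ Icc a b, f s = c + ∫ q in r..s, f' q) : HasIntegralDerivOn a b f f' := by
  refine ⟨hf', fun s hs => ?_⟩
  have ha : a ∈ Icc a b := left_mem_Icc.2 (hs.1.trans hs.2)
  rw [h s hs, h a ha, add_assoc, intervalIntegral.integral_add_adjacent_intervals
    (intervalIntegrable_of_integrableOn_Icc hf' hr ha)
    (intervalIntegrable_of_integrableOn_Icc hf' ha hs)]

theorem of_initial {c : E} (hf' : IntegrableOn f' (Icc a b))
    (h : ∀ s ∈ Icc a b, f s = c + ∫ r in a..s, f' r) : HasIntegralDerivOn a b f f' :=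
  ⟨hf', fun s hs => (of_base hf' (left_mem_Icc.2 (hs.1.trans hs.2)) h).2 s hs⟩

theorem const (c : E) : HasIntegralDerivOn a b (fun _ => c) fun _ => 0 :=
  ⟨integrableOn_zero, by simp⟩

theorem add (h : HasIntegralDerivOn a b f f') (h₁ : HasIntegralDerivOn a b f₁ f₁') :
    HasIntegralDerivOn a b (fun s => f s + f₁ s) fun s => f' s + f₁' s := by
  refine of_initial (c := f a + f₁ a) (h.1.add h₁.1) fun s hs => ?_
  have ha : a ∈ Icc a b := left_mem_Icc.2 (hs.1.trans hs.2)
  rw [intervalIntegral.integral_add (intervalIntegrable_of_integrableOn_Icc h.1 ha hs)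
    (intervalIntegrable_of_integrableOn_Icc h₁.1 ha hs), h.2 s hs, h₁.2 s hs]
  abel

theorem neg (h : HasIntegralDerivOn a b f f') :
    HasIntegralDerivOn a b (fun s => -f s) fun s => -f' s := by
  refine of_initial (c := -f a) h.1.neg fun s hs => ?_
  rw [intervalIntegral.integral_neg, h.2 s hs, neg_add]

theorem sub (h : HasIntegralDerivOn a b f f') (h₁ : HasIntegralDerivOn a b f₁ f₁') :
    HasIntegralDerivOn a b (fun s => f s - f₁ s) fun s => f' s - f₁' s := by
  simpa only [sub_eq_add_neg] using h.add h₁.neg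

theorem of_terminal {c : E} (hf' : IntegrableOn f' (Icc a b))
    (h : ∀ s ∈ Icc a b, f s = c + ∫ r in s..b, f' r) :
    HasIntegralDerivOn a b f fun s => -f' s := by
  refine ⟨hf'.neg, fun s hs => (of_base (c := c) hf'.neg
    (right_mem_Icc.2 (hs.1.trans hs.2)) fun r hr => ?_).2 s hs⟩
  rw [h r hr, intervalIntegral.integral_symm, ← intervalIntegral.integral_neg]
  rfl

theorem eq_terminal (h : HasIntegralDerivOn a b f fun s => -f' s) {s : ℝ} (hs : s ∈ Icc a b) :
    f s = f b + ∫ r in s..b, f' r := by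
  have := h.sub_eq hs (right_mem_Icc.2 (hs.1.trans hs.2))
  rw [intervalIntegral.integral_neg] at this
  rw [← neg_eq_iff_eq_neg.2 this, neg_sub, add_sub_cancel]

theorem eq_of_deriv_eq_zero (h : HasIntegralDerivOn a b f f') (hf' : EqOn f' 0 (Icc a b))
    {s r : ℝ} (hs : s ∈ Icc a b) (hr : r ∈ Icc a b) : f s = f r := by
  rw [← sub_eq_zero, h.sub_eq hr hs, intervalIntegral_congr_Icc hf' hr hs]
  exact intervalIntegral.integral_zero

theorem of_hasDerivWithinAt [CompleteSpace E]
    (hf : ∀ s ∈ Icc a b, HasDerivWithinAt f (f' s) (Icc a b) s)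
    (hf' : ContinuousOn f' (Icc a b)) : HasIntegralDerivOn a b f f' := by
  refine ⟨hf'.integrableOn_Icc, fun s hs => ?_⟩
  have hsub : Icc a s ⊆ Icc a b := Icc_subset_Icc le_rfl hs.2
  rw [intervalIntegral.integral_eq_sub_of_hasDeriv_right_of_le hs.1
    (fun r hr => (hf r (hsub hr)).continuousWithinAt.mono hsub)
    (fun r hr => ((hf r (hsub (Ioo_subset_Icc_self hr))).mono_of_mem_nhdsWithin
      (Icc_mem_nhdsGT_of_mem ⟨hr.1.le, hr.2.trans_le hs.2⟩)))
    ((hf'.mono hsub).intervalIntegrable_of_Icc hs.1), add_sub_cancel]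

section Complete

variable [CompleteSpace E] [CompleteSpace F]

theorem clm_comp (h : HasIntegralDerivOn a b f f') (L : E →L[ℝ] F) :
    HasIntegralDerivOn a b (fun s => L (f s)) fun s => L (f' s) := by
  refine of_initial (c := L (f a)) (L.integrable_comp h.1) fun s hs => ?_
  rw [L.intervalIntegral_comp_comm (intervalIntegrable_of_integrableOn_Icc h.1
    (left_mem_Icc.2 (hs.1.trans hs.2)) hs), h.2 s hs, map_add]

/-- Both factors are expanded by the fundamental theorem of calculus, and the
two double integrals that appear cancel by Fubini's theorem on the triangle. -/
theorem bilin [CompleteSpace G] (L : E →L[ℝ] F →L[ℝ] G) (h : HasIntegralDerivOn a b f f')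
    (k : HasIntegralDerivOn a b g g') :
    HasIntegralDerivOn a b (fun s => L (f s) (g s))
      fun s => L (f' s) (g s) + L (f s) (g' s) := by
  refine ⟨(integrableOn_bilin_continuousOn L h.1 k.continuousOn).add
    (continuousOn_bilin_integrableOn L h.continuousOn k.1), fun s hs => ?_⟩
  have ha : a ∈ Icc a s := left_mem_Icc.2 hs.1
  have hs' : s ∈ Icc a s := right_mem_Icc.2 hs.1
  replace h := h.mono le_rfl hs.2
  replace k := k.mono le_rfl hs.2
  have hfg := intervalIntegrable_of_integrableOn_Icc
    (integrableOn_bilin_continuousOn L h.1 k.continuousOn) ha hs'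
  have hgf := intervalIntegrable_of_integrableOn_Icc
    (continuousOn_bilin_integrableOn L h.continuousOn k.1) ha hs'
  have left : ∫ r in a..s, L (f' r) (g s - g r) =
      L (f s) (g s) - L (f a) (g s) - ∫ r in a..s, L (f' r) (g r) := by
    have hfs : HasIntegralDerivOn a s (fun r => L (f r) (g s)) fun r => L (f' r) (g s) :=
      h.clm_comp (L.flip (g s))
    rw [hfs.sub_eq ha hs', ← intervalIntegral.integral_sub
        (intervalIntegrable_of_integrableOn_Icc hfs.1 ha hs') hfg]
    simp only [map_sub]
  have right : ∫ r in a..s, L (f r - f a) (g' r) =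
      (∫ r in a..s, L (f r) (g' r)) - (L (f a) (g s) - L (f a) (g a)) := by
    have hga := k.clm_comp (L (f a))
    rw [hga.sub_eq ha hs', ← intervalIntegral.integral_sub hgf
      (intervalIntegrable_of_integrableOn_Icc hga.1 ha hs')]
    simp only [map_sub, sub_apply]
  have swap : ∫ r in a..s, L (f r - f a) (g' r) = ∫ r in a..s, L (f' r) (g s - g r) := by
    rw [intervalIntegral_congr_Icc (fun r hr => by rw [h.sub_eq ha hr]) ha hs',
      intervalIntegral_bilin_swap L hs.1 h.1 k.1]
    exact intervalIntegral_congr_Icc (fun r hr => by rw [← k.sub_eq hr hs']) ha hs'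
  rw [left, right, sub_eq_sub_iff_add_eq_add] at swap
  rw [intervalIntegral.integral_add hfg hgf]
  linear_combination (norm := module) -swap

theorem integral_mul_pow_div_factorial {φ φ' : ℝ → ℝ} (h : HasIntegralDerivOn a b φ φ')
    (h0 : φ a = 0) (k : ℕ) {s : ℝ} (hs : s ∈ Icc a b) :
    ∫ r in a..s, φ' r * (φ r ^ k / k.factorial) = φ s ^ (k + 1) / (k + 1).factorial := by
  have power_deriv : HasIntegralDerivOn a b (fun s => φ s ^ (k + 1) / (k + 1).factorial)
      fun s => φ' s * (φ s ^ k / k.factorial) := by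
    induction k with
    | zero => simpa using h
    | succ k ih =>
      refine ((ih.bilin (ContinuousLinearMap.mul ℝ ℝ) h).clm_comp
        ((1 / ((k : ℝ) + 2)) • ContinuousLinearMap.id ℝ ℝ)).congr_on
          (fun x _ => ?_) (fun x _ => ?_)
      · simp only [Nat.factorial_succ (k + 1), ContinuousLinearMap.mul_apply', smul_apply,
          ContinuousLinearMap.id_apply, smul_eq_mul]
        push_cast
        field_simp
        ring
      · simp only [Nat.factorial_succ k, ContinuousLinearMap.mul_apply', smul_apply,
          ContinuousLinearMap.id_apply, smul_eq_mul]
        push_cast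
        field_simp
        ring
  simpa [h0] using (power_deriv.2 s hs).symm

end Complete
end HasIntegralDerivOn
end IntegralDerivative

/-! ### Linear Carathéodory equations -/

section LinearODE

variable {E : Type*} [NormedAddCommGroup E] [NormedSpace ℝ E] {a b : ℝ} {F : ℝ → E →L[ℝ] E}

/-! ### The boundary value problem -/

theorem hasIntegralDerivOn_picard (hab : a ≤ b) (hF : IntegrableOn F (Icc a b)) (x : E)
    (Z : C(Icc a b, E)) :
    HasIntegralDerivOn a b (fun t => x + ∫ s in a..t, F s (IccExtend hab Z s))
      fun s => F s (IccExtend hab Z s) :=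
  .of_initial (integrableOn_bilin_continuousOn (.id ℝ (E →L[ℝ] E)) hF
    (continuous_IccExtend_iff.2 Z.continuous).continuousOn) fun _ _ => rfl

/-- The Picard operator of the linear equation `X' = F X`, `X a = x`; its fixed points are the
solutions. -/
def picardMap (hab : a ≤ b) (hF : IntegrableOn F (Icc a b)) (x : E) (Z : C(Icc a b, E)) :
    C(Icc a b, E) where
  toFun t := x + ∫ s in a..t, F s (IccExtend hab Z s)
  continuous_toFun :=
    continuousOn_iff_continuous_domRestrict.1 (hasIntegralDerivOn_picard hab hF x Z).continuousOn

theorem norm_picardMap_sub_le (hab : a ≤ b) (hF : IntegrableOn F (Icc a b)) (x : E)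
    {Z W : C(Icc a b, E)} {β : ℝ → ℝ} (hβ : ContinuousOn β (Icc a b))
    (hZW : ∀ s : Icc a b, ‖Z s - W s‖ ≤ β s) (t : Icc a b) :
    ‖picardMap hab hF x Z t - picardMap hab hF x W t‖ ≤ ∫ s in a..t, ‖F s‖ * β s := by
  have ha : a ∈ Icc a b := left_mem_Icc.2 hab
  have integrable (Z : C(Icc a b, E)) :
      IntervalIntegrable (fun s => F s (IccExtend hab Z s)) volume a t :=
    intervalIntegrable_of_integrableOn_Icc (hasIntegralDerivOn_picard hab hF x Z).1 ha t.2
  have sub_eq : picardMap hab hF x Z t - picardMap hab hF x W t =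
      ∫ s in a..t, F s (IccExtend hab Z s - IccExtend hab W s) := by
    simp only [map_sub]
    rw [intervalIntegral.integral_sub (integrable Z) (integrable W)]
    exact add_sub_add_left_eq_sub _ _ _
  rw [sub_eq]
  refine intervalIntegral.norm_integral_le_of_norm_le t.2.1 (ae_of_all _ fun s hs => ?_)
    (intervalIntegrable_of_integrableOn_Icc
      (IntegrableOn.mul_continuousOn hF.norm hβ isCompact_Icc) ha t.2)
  have hs' : s ∈ Icc a b := ⟨hs.1.le, hs.2.trans t.2.2⟩
  rw [IccExtend_of_mem _ _ hs', IccExtend_of_mem _ _ hs']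
  exact (F s).le_opNorm_of_le (hZW ⟨s, hs'⟩)

theorem norm_picardMap_iterate_sub_le (hab : a ≤ b) (hF : IntegrableOn F (Icc a b)) (x : E)
    (Z W : C(Icc a b, E)) (k : ℕ) (t : Icc a b) :
    ‖(picardMap hab hF x)^[k] Z t - (picardMap hab hF x)^[k] W t‖ ≤
      (∫ s in a..t, ‖F s‖) ^ k / k.factorial * dist Z W := by
  have hα : HasIntegralDerivOn a b (fun t => ∫ s in a..t, ‖F s‖) fun s => ‖F s‖ :=
    .of_initial (c := 0) hF.norm fun _ _ => (zero_add _).symm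
  induction k generalizing t with
  | zero => simpa [dist_eq_norm] using ContinuousMap.dist_apply_le_dist (f := Z) (g := W) t
  | succ k ih =>
    rw [Function.iterate_succ_apply', Function.iterate_succ_apply',
      ← hα.integral_mul_pow_div_factorial intervalIntegral.integral_same k t.2,
      ← intervalIntegral.integral_mul_const]
    simp only [mul_assoc]
    exact norm_picardMap_sub_le hab hF x
      (((hα.continuousOn.pow k).div_const _).mul continuousOn_const) ih t

theorem exists_contractingWith_picardMap_iterate (hab : a ≤ b) (hF : IntegrableOn F (Icc a b))
    (x : E) : ∃ (k : ℕ) (c : NNReal), ContractingWith c (picardMap hab hF x)^[k] := by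
  set α : ℝ → ℝ := fun t => ∫ s in a..t, ‖F s‖
  have hα0 : ∀ t ∈ Icc a b, 0 ≤ α t := fun t ht =>
    intervalIntegral.integral_nonneg ht.1 fun _ _ => norm_nonneg _
  have hαb : ∀ t ∈ Icc a b, α t ≤ α b := fun t ht =>
    intervalIntegral.integral_mono_interval le_rfl ht.1 ht.2 (ae_of_all _ fun _ => norm_nonneg _)
      (intervalIntegrable_of_integrableOn_Icc hF.norm (left_mem_Icc.2 hab) (right_mem_Icc.2 hab))
  have hb : 0 ≤ α b := hα0 b (right_mem_Icc.2 hab)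
  obtain ⟨k, hk⟩ := ((FloorSemiring.tendsto_pow_div_factorial_atTop (α b)).eventually
    (gt_mem_nhds one_pos)).exists
  refine ⟨k, ⟨α b ^ k / k.factorial, by positivity⟩, by exact_mod_cast hk,
    LipschitzWith.of_dist_le_mul fun Z W => (ContinuousMap.dist_le
      (mul_nonneg (NNReal.coe_nonneg _) dist_nonneg)).2 fun t => ?_⟩
  rw [dist_eq_norm]
  refine (norm_picardMap_iterate_sub_le hab hF x Z W k t).trans ?_
  change α t ^ k / k.factorial * dist Z W ≤ α b ^ k / k.factorial * dist Z W
  gcongr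
  · exact hα0 t t.2
  · exact hαb t t.2

theorem exists_hasIntegralDerivOn_linear [CompleteSpace E] (hab : a ≤ b)
    (hF : IntegrableOn F (Icc a b)) (x : E) :
    ∃ X : ℝ → E, HasIntegralDerivOn a b X (fun s => F s (X s)) ∧ X a = x := by
  obtain ⟨k, c, hc⟩ := exists_contractingWith_picardMap_iterate hab hF x
  have : Nonempty C(Icc a b, E) := ⟨0⟩
  set Z := hc.fixedPoint
  have hZ : picardMap hab hF x Z = Z := hc.isFixedPt_fixedPoint_iterate
  refine ⟨_, (hasIntegralDerivOn_picard hab hF x Z).congr_on (fun _ _ => rfl) fun s hs => ?_,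
    by simp⟩
  beta_reduce
  rw [IccExtend_of_mem hab Z hs]
  exact congrArg (fun W : C(Icc a b, E) => F s (W ⟨s, hs⟩)) hZ

end LinearODE

/-! ### Matrix-valued functions -/

section MatrixCalculus

variable {ι κ l o : Type*} [Fintype ι] [Fintype κ] [Fintype l] [Fintype o]

/-- Matrix multiplication as a continuous bilinear map. -/
def matrixMulCLM (κ l o : Type*) [Fintype κ] [Fintype l] [Fintype o] :
    Matrix κ l ℝ →L[ℝ] Matrix l o ℝ →L[ℝ] Matrix κ o ℝ :=
  LinearMap.toContinuousBilinearMap (LinearMap.mk₂ ℝ (· * ·) Matrix.add_mul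
    (fun c X Y => Matrix.smul_mul c X Y) Matrix.mul_add fun c X Y => Matrix.mul_smul X c Y)

/-- The action of matrices on vectors as a continuous bilinear map. -/
def matrixMulVecCLM (κ l : Type*) [Fintype κ] [Fintype l] :
    Matrix κ l ℝ →L[ℝ] (l → ℝ) →L[ℝ] (κ → ℝ) :=
  LinearMap.toContinuousBilinearMap (Matrix.mulVecBilin ℝ ℝ)

/-- The dot product as a continuous bilinear map. -/
def dotProductCLM (κ : Type*) [Fintype κ] : (κ → ℝ) →L[ℝ] (κ → ℝ) →L[ℝ] ℝ :=
  LinearMap.toContinuousBilinearMap (dotProductBilin ℝ ℝ)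

/-- Transposition as a continuous linear map. -/
def matrixTransposeCLM (κ l : Type*) [Fintype κ] [Fintype l] : Matrix κ l ℝ →L[ℝ] Matrix l κ ℝ :=
  LinearMap.toContinuousLinearMap (Matrix.transposeLinearEquiv κ l ℝ ℝ).toLinearMap

variable {α : Type*} [TopologicalSpace α] {s : Set α} {X : α → Matrix κ l ℝ}

theorem continuousOn_matrix_mul {Y : α → Matrix l o ℝ} (hX : ContinuousOn X s)
    (hY : ContinuousOn Y s) : ContinuousOn (fun r => X r * Y r) s :=
  ((matrixMulCLM κ l o).continuous.comp_continuousOn hX).clm_apply hY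

theorem continuousOn_matrix_mulVec {y : α → l → ℝ} (hX : ContinuousOn X s)
    (hy : ContinuousOn y s) : ContinuousOn (fun r => X r *ᵥ y r) s :=
  ((matrixMulVecCLM κ l).continuous.comp_continuousOn hX).clm_apply hy

theorem continuousOn_matrix_transpose (hX : ContinuousOn X s) :
    ContinuousOn (fun r => (X r)ᵀ) s :=
  (matrixTransposeCLM κ l).continuous.comp_continuousOn hX

theorem continuousOn_matrix_inv [DecidableEq κ] {α : Type*} [TopologicalSpace α] {s : Set α}
    {X : α → Matrix κ κ ℝ} (hX : ContinuousOn X s) (h : ∀ r ∈ s, IsUnit (X r).det) :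
    ContinuousOn (fun r => (X r)⁻¹) s := by
  have hdet : ContinuousOn (fun r => (X r).det) s := continuous_id.matrix_det.comp_continuousOn hX
  have hadj : ContinuousOn (fun r => (X r).adjugate) s :=
    continuous_id.matrix_adjugate.comp_continuousOn hX
  simp only [Matrix.inv_def, Ring.inverse_eq_inv']
  exact (hdet.inv₀ fun r hr => (h r hr).ne_zero).smul hadj

variable {a b : ℝ} {X X' : ℝ → Matrix κ l ℝ}

theorem HasIntegralDerivOn.matrix_mul {Y Y' : ℝ → Matrix l o ℝ} (h : HasIntegralDerivOn a b X X')
    (k : HasIntegralDerivOn a b Y Y') :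
    HasIntegralDerivOn a b (fun s => X s * Y s) fun s => X' s * Y s + X s * Y' s :=
  h.bilin (matrixMulCLM κ l o) k

theorem HasIntegralDerivOn.matrix_mulVec {y y' : ℝ → l → ℝ} (h : HasIntegralDerivOn a b X X')
    (k : HasIntegralDerivOn a b y y') :
    HasIntegralDerivOn a b (fun s => X s *ᵥ y s) fun s => X' s *ᵥ y s + X s *ᵥ y' s :=
  h.bilin (matrixMulVecCLM κ l) k

theorem HasIntegralDerivOn.dotProduct {x x' y y' : ℝ → l → ℝ} (h : HasIntegralDerivOn a b x x')
    (k : HasIntegralDerivOn a b y y') :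
    HasIntegralDerivOn a b (fun s => x s ⬝ᵥ y s) fun s => x' s ⬝ᵥ y s + x s ⬝ᵥ y' s :=
  h.bilin (dotProductCLM l) k

theorem HasIntegralDerivOn.transpose (h : HasIntegralDerivOn a b X X') :
    HasIntegralDerivOn a b (fun s => (X s)ᵀ) fun s => (X' s)ᵀ :=
  h.clm_comp (matrixTransposeCLM κ l)

section MemLp

variable {Ω : Type*} {p q r : ℝ≥0∞} [MeasurableSpace Ω] {μ : Measure Ω}

theorem memLp_matrix_iff {X : Ω → Matrix κ l ℝ} :
    MemLp X p μ ↔ ∀ i j, MemLp (fun s => X s i j) p μ :=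
  memLp_pi_iff.trans (forall_congr' fun _ => memLp_pi_iff)

theorem memLp_matrix_mul [p.HolderTriple q r] {X : Ω → Matrix κ l ℝ} {Y : Ω → Matrix l o ℝ}
    (hX : MemLp X p μ) (hY : MemLp Y q μ) : MemLp (fun s => X s * Y s) r μ :=
  (matrixMulCLM κ l o).memLp_of_bilin r hX hY

theorem memLp_matrix_mulVec [p.HolderTriple q r] {X : Ω → Matrix κ l ℝ} {y : Ω → l → ℝ}
    (hX : MemLp X p μ) (hy : MemLp y q μ) : MemLp (fun s => X s *ᵥ y s) r μ :=
  (matrixMulVecCLM κ l).memLp_of_bilin r hX hy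

theorem memLp_dotProduct [p.HolderTriple q r] {x y : Ω → l → ℝ}
    (hx : MemLp x p μ) (hy : MemLp y q μ) : MemLp (fun s => x s ⬝ᵥ y s) r μ :=
  (dotProductCLM l).memLp_of_bilin r hx hy

theorem memLp_matrix_transpose {X : Ω → Matrix κ l ℝ} (hX : MemLp X p μ) :
    MemLp (fun s => (X s)ᵀ) p μ :=
  (matrixTransposeCLM κ l).comp_memLp' hX

theorem memLp_matrix_conj [q.HolderTriple p r] {L : Ω → Matrix κ ι ℝ} {N : Ω → Matrix l o ℝ}
    (hL : MemLp L p μ) (hN : MemLp N q μ) :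
    MemLp (fun s => (matrixMulCLM ι l o).flip (N s) ∘L matrixMulCLM ι κ l (L s)ᵀ) r μ :=
  (ContinuousLinearMap.compL ℝ _ _ _).memLp_of_bilin r ((matrixMulCLM ι l o).flip.comp_memLp' hN)
    ((matrixMulCLM ι κ l).comp_memLp' (memLp_matrix_transpose hL))

end MemLp

end MatrixCalculus

/-! ### Fundamental matrices -/

section Fundamental

variable {ι κ : Type*} [Fintype ι] [Fintype κ] {a b : ℝ} {F Ψ Y : ℝ → Matrix ι ι ℝ}

theorem integrableOn_matrix_mulVec {X : ℝ → Matrix κ ι ℝ} {y : ℝ → ι → ℝ}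
    (hX : IntegrableOn X (Icc a b)) (hy : ContinuousOn y (Icc a b)) :
    IntegrableOn (fun s => X s *ᵥ y s) (Icc a b) :=
  integrableOn_bilin_continuousOn (matrixMulVecCLM κ ι) hX hy

variable [DecidableEq ι]

/-- `Ψ` is a fundamental matrix on `[a,b]` of the Carathéodory equation `X' = F X`, and `Y` is its
inverse. Carrying the inverse along, with its own differential equation, avoids determinants. -/
structure IsFundamental (a b : ℝ) (F Ψ Y : ℝ → Matrix ι ι ℝ) : Prop where
  prim : HasIntegralDerivOn a b Ψ fun s => F s * Ψ s
  prim_inv : HasIntegralDerivOn a b Y fun s => -(Y s * F s)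
  inv_mul : ∀ s ∈ Icc a b, Y s * Ψ s = 1
  mul_inv : ∀ s ∈ Icc a b, Ψ s * Y s = 1

theorem exists_isFundamental (hab : a ≤ b) (hF : IntegrableOn F (Icc a b)) :
    ∃ Ψ Y : ℝ → Matrix ι ι ℝ, IsFundamental a b F Ψ Y ∧ Ψ a = 1 ∧ Y a = 1 := by
  obtain ⟨Ψ, hΨ, hΨa⟩ := exists_hasIntegralDerivOn_linear hab
    ((matrixMulCLM ι ι ι).integrable_comp hF) (1 : Matrix ι ι ℝ)
  obtain ⟨Y, hY, hYa⟩ := exists_hasIntegralDerivOn_linear hab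
    ((matrixMulCLM ι ι ι).flip.integrable_comp hF).neg (1 : Matrix ι ι ℝ)
  replace hΨ : HasIntegralDerivOn a b Ψ fun s => F s * Ψ s := hΨ
  replace hY : HasIntegralDerivOn a b Y fun s => -(Y s * F s) := hY
  have inv_mul : ∀ s ∈ Icc a b, Y s * Ψ s = 1 := fun s hs => by
    have := (hY.matrix_mul hΨ).eq_of_deriv_eq_zero
      (fun r _ => by simp [Matrix.mul_assoc]) hs (left_mem_Icc.2 hab)
    rwa [hΨa, hYa, Matrix.one_mul] at this
  exact ⟨Ψ, Y, ⟨hΨ, hY, inv_mul, fun s hs => mul_eq_one_comm.1 (inv_mul s hs)⟩, hΨa, hYa⟩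

namespace IsFundamental

variable (h : IsFundamental a b F Ψ Y)
include h

theorem mono {c d : ℝ} (hc : a ≤ c) (hd : d ≤ b) : IsFundamental c d F Ψ Y where
  prim := h.prim.mono hc hd
  prim_inv := h.prim_inv.mono hc hd
  inv_mul s hs := h.inv_mul s (Icc_subset_Icc hc hd hs)
  mul_inv s hs := h.mul_inv s (Icc_subset_Icc hc hd hs)

theorem congr_ae {F₁ : ℝ → Matrix ι ι ℝ} (hF : F₁ =ᵐ[volume.restrict (Icc a b)] F) :
    IsFundamental a b F₁ Ψ Y where
  prim := h.prim.congr (fun _ _ => rfl) (hF.mono fun s hs => by simp only [hs])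
  prim_inv := h.prim_inv.congr (fun _ _ => rfl) (hF.mono fun s hs => by simp only [hs])
  inv_mul := h.inv_mul
  mul_inv := h.mul_inv

theorem matrix_eq {X : ℝ → Matrix ι κ ℝ} (hX : HasIntegralDerivOn a b X fun s => F s * X s)
    {r s : ℝ} (hr : r ∈ Icc a b) (hs : s ∈ Icc a b) : X s = Ψ s * (Y r * X r) := by
  have const := (h.prim_inv.matrix_mul hX).eq_of_deriv_eq_zero
    (fun r _ => by simp [Matrix.mul_assoc]) hr hs
  rw [const, ← Matrix.mul_assoc, h.mul_inv s hs, Matrix.one_mul]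

theorem vec_eq {X : ℝ → ι → ℝ} (hX : HasIntegralDerivOn a b X fun s => F s *ᵥ X s)
    {r s : ℝ} (hr : r ∈ Icc a b) (hs : s ∈ Icc a b) : X s = Ψ s *ᵥ (Y r *ᵥ X r) := by
  have const := (h.prim_inv.matrix_mulVec hX).eq_of_deriv_eq_zero
    (fun r _ => by simp [Matrix.neg_mulVec]) hr hs
  rw [const, Matrix.mulVec_mulVec, h.mul_inv s hs, Matrix.one_mulVec]

theorem vec_unique {X Z β : ℝ → ι → ℝ} (hX : HasIntegralDerivOn a b X fun s => F s *ᵥ X s + β s)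
    (hZ : HasIntegralDerivOn a b Z fun s => F s *ᵥ Z s + β s) (ha : X a = Z a) :
    EqOn X Z (Icc a b) := by
  intro s hs
  have hd := h.vec_eq (X := fun r => X r - Z r) ((hX.sub hZ).congr_on (fun _ _ => rfl)
    fun r _ => by simp [Matrix.mulVec_sub]) (left_mem_Icc.2 (hs.1.trans hs.2)) hs
  rw [ha, sub_self, Matrix.mulVec_zero, Matrix.mulVec_zero] at hd
  exact sub_eq_zero.1 hd

theorem exists_vec (hab : a ≤ b) {β : ℝ → ι → ℝ} (hβ : IntegrableOn β (Icc a b)) (x : ι → ℝ) :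
    ∃ X, HasIntegralDerivOn a b X (fun s => F s *ᵥ X s + β s) ∧ X a = x := by
  have hYβ : IntegrableOn (fun s => Y s *ᵥ β s) (Icc a b) :=
    continuousOn_bilin_integrableOn (matrixMulVecCLM ι ι) h.prim_inv.continuousOn hβ
  have hZ : HasIntegralDerivOn a b (fun t => Y a *ᵥ x + ∫ s in a..t, Y s *ᵥ β s)
      fun s => Y s *ᵥ β s := .of_initial hYβ fun _ _ => rfl
  refine ⟨_, (h.prim.matrix_mulVec hZ).congr_on (fun _ _ => rfl) fun s hs => ?_, ?_⟩
  · simp only [Matrix.mulVec_mulVec, h.mul_inv s hs, Matrix.one_mulVec]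
  · rw [intervalIntegral.integral_same, add_zero, Matrix.mulVec_mulVec,
      h.mul_inv a (left_mem_Icc.2 hab), Matrix.one_mulVec]

theorem conj_hasIntegralDerivOn {H W : ℝ → Matrix ι ι ℝ}
    (hH : HasIntegralDerivOn a b H fun s => -W s) :
    HasIntegralDerivOn a b (fun s => (Y s)ᵀ * H s * Y s)
      fun s => -((F s)ᵀ * ((Y s)ᵀ * H s * Y s) + ((Y s)ᵀ * H s * Y s) * F s
        + (Y s)ᵀ * W s * Y s) := by
  refine ((h.prim_inv.transpose.matrix_mul hH).matrix_mul h.prim_inv).congr_on (fun _ _ => rfl)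
    fun s _ => ?_
  simp only [Matrix.transpose_neg, Matrix.transpose_mul, Matrix.add_mul, Matrix.neg_mul,
    Matrix.mul_neg, Matrix.mul_assoc]
  abel

theorem conj_conj_inv {s : ℝ} (hs : s ∈ Icc a b) (W : Matrix ι ι ℝ) :
    (Y s)ᵀ * ((Ψ s)ᵀ * W * Ψ s) * Y s = W := by
  have transpose_mul : (Y s)ᵀ * (Ψ s)ᵀ = 1 := by
    rw [← Matrix.transpose_mul, h.mul_inv s hs, Matrix.transpose_one]
  calc _ = ((Y s)ᵀ * (Ψ s)ᵀ) * W * (Ψ s * Y s) := by simp only [Matrix.mul_assoc]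
    _ = W := by rw [transpose_mul, h.mul_inv s hs, Matrix.one_mul, Matrix.mul_one]

/-- Conjugating the difference of two solutions by the flow makes it constant. -/
theorem lyapunov_unique {P P₁ W : ℝ → Matrix ι ι ℝ}
    (hP : HasIntegralDerivOn a b P fun s => -((F s)ᵀ * P s + P s * F s + W s))
    (hP₁ : HasIntegralDerivOn a b P₁ fun s => -((F s)ᵀ * P₁ s + P₁ s * F s + W s))
    (hb : P b = P₁ b) : EqOn P P₁ (Icc a b) := by
  intro s hs
  have const := ((h.prim.transpose.matrix_mul (hP.sub hP₁)).matrix_mul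
    h.prim).eq_of_deriv_eq_zero (fun s _ => by
      simp only [Matrix.transpose_mul, Matrix.add_mul, Matrix.mul_sub, Matrix.sub_mul,
        Matrix.mul_neg, Matrix.neg_mul, Matrix.mul_assoc, Matrix.mul_add, Pi.zero_apply]
      abel) hs (right_mem_Icc.2 (hs.1.trans hs.2))
  simp only [hb, sub_self, Matrix.mul_zero, Matrix.zero_mul] at const
  rw [← sub_eq_zero, ← h.conj_conj_inv hs (P s - P₁ s), const, Matrix.mul_zero, Matrix.zero_mul]

end IsFundamental
end Fundamental

/-! ### Integral kernels -/

section Kernel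

variable {E H : Type*} [NormedAddCommGroup E] [NormedSpace ℝ E]
  [NormedAddCommGroup H] [NormedSpace ℝ H] {a b : ℝ}

/-- `F` is continuous on the square `[a,b]²` and continuously differentiable in its first variable
there, with partial derivative `F'`. -/
structure IsC1Fst (a b : ℝ) (F F' : ℝ → ℝ → E) : Prop where
  continuousOn : ContinuousOn (Function.uncurry F) (Icc a b ×ˢ Icc a b)
  continuousOn_deriv : ContinuousOn (Function.uncurry F') (Icc a b ×ˢ Icc a b)
  hasDerivWithinAt : ∀ t ∈ Icc a b, ∀ s ∈ Icc a b,
    HasDerivWithinAt (fun r => F r s) (F' t s) (Icc a b) t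

/-- `r` is a kernel whose dependence on the first variable is absolutely continuous with derivative
`ρ`, with the integrability needed to differentiate `t ↦ ∫_t^b r(t,τ) dτ`. -/
structure IsKernel (a b : ℝ) (r ρ : ℝ → ℝ → E) : Prop where
  prim : ∀ τ ∈ Icc a b, HasIntegralDerivOn a b (fun t => r t τ) fun t => ρ t τ
  integrable : Integrable (Function.uncurry ρ)
    ((volume.restrict (Icc a b)).prod (volume.restrict (Icc a b)))
  diag : IntegrableOn (fun s => r s s) (Icc a b)
  slice : ∀ t ∈ Icc a b, IntegrableOn (r t) (Icc a b)
  slice_deriv : ∀ t ∈ Icc a b, IntegrableOn (ρ t) (Icc a b)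

namespace IsC1Fst

variable {F F' : ℝ → ℝ → E} (h : IsC1Fst a b F F')
include h

theorem continuousOn_slice {t : ℝ} (ht : t ∈ Icc a b) : ContinuousOn (F t) (Icc a b) :=
  h.continuousOn.comp (by fun_prop : Continuous fun s : ℝ => (t, s)).continuousOn
    fun _ hs => ⟨ht, hs⟩

theorem continuousOn_slice_deriv {t : ℝ} (ht : t ∈ Icc a b) : ContinuousOn (F' t) (Icc a b) :=
  h.continuousOn_deriv.comp (by fun_prop : Continuous fun s : ℝ => (t, s)).continuousOn
    fun _ hs => ⟨ht, hs⟩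

theorem continuousOn_diag : ContinuousOn (fun s => F s s) (Icc a b) :=
  h.continuousOn.comp (by fun_prop : Continuous fun s : ℝ => (s, s)).continuousOn
    fun _ hs => ⟨hs, hs⟩

theorem hasIntegralDerivOn [CompleteSpace E] {s : ℝ} (hs : s ∈ Icc a b) :
    HasIntegralDerivOn a b (fun t => F t s) fun t => F' t s :=
  .of_hasDerivWithinAt (fun t ht => h.hasDerivWithinAt t ht s hs)
    (h.continuousOn_deriv.comp (by fun_prop : Continuous fun t : ℝ => (t, s)).continuousOn
      fun _ ht => ⟨ht, hs⟩)

theorem isKernel_clm_apply [CompleteSpace E] [CompleteSpace H] {g : ℝ → E →L[ℝ] H}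
    (hg : IntegrableOn g (Icc a b)) :
    IsKernel a b (fun t τ => g τ (F t τ)) fun t τ => g τ (F' t τ) where
  prim τ hτ := (h.hasIntegralDerivOn hτ).clm_comp (g τ)
  integrable := by
    have hF' := memLp_top_of_continuousOn_isCompact (μ := volume.prod volume)
      h.continuousOn_deriv (isCompact_Icc.prod isCompact_Icc)
      (measurableSet_Icc.prod measurableSet_Icc)
    rw [← Measure.prod_restrict] at hF'
    exact memLp_one_iff_integrable.1 ((ContinuousLinearMap.id ℝ (E →L[ℝ] H)).memLp_of_bilin 1
      (memLp_one_iff_integrable.2 (Integrable.comp_snd hg _)) hF')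
  diag := integrableOn_bilin_continuousOn (.id ℝ (E →L[ℝ] H)) hg h.continuousOn_diag
  slice _ ht := integrableOn_bilin_continuousOn (.id ℝ (E →L[ℝ] H)) hg (h.continuousOn_slice ht)
  slice_deriv _ ht :=
    integrableOn_bilin_continuousOn (.id ℝ (E →L[ℝ] H)) hg (h.continuousOn_slice_deriv ht)

end IsC1Fst

theorem IsC1Fst.transpose {k l : Type*} [Fintype k] [Fintype l] {F F' : ℝ → ℝ → Matrix k l ℝ}
    (h : IsC1Fst a b F F') : IsC1Fst a b (fun t s => (F t s)ᵀ) fun t s => (F' t s)ᵀ where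
  continuousOn := continuousOn_matrix_transpose h.continuousOn
  continuousOn_deriv := continuousOn_matrix_transpose h.continuousOn_deriv
  hasDerivWithinAt t ht s hs :=
    (matrixTransposeCLM k l).hasFDerivAt.comp_hasDerivWithinAt t (h.hasDerivWithinAt t ht s hs)

theorem IsC1Fst.isKernel_conj {κ k l o : Type*} [Fintype κ] [Fintype k] [Fintype l] [Fintype o]
    {F F' : ℝ → ℝ → Matrix k l ℝ} (h : IsC1Fst a b F F') {L : ℝ → Matrix k κ ℝ}
    {N : ℝ → Matrix l o ℝ} (hL : MemLp L 2 (volume.restrict (Icc a b)))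
    (hN : MemLp N 2 (volume.restrict (Icc a b))) :
    IsKernel a b (fun t τ => (L τ)ᵀ * F t τ * N τ) fun t τ => (L τ)ᵀ * F' t τ * N τ :=
  h.isKernel_clm_apply (memLp_one_iff_integrable.1 (memLp_matrix_conj hL hN))

namespace IsKernel

variable {r ρ r₁ ρ₁ : ℝ → ℝ → E} (h : IsKernel a b r ρ)
include h

theorem add (h₁ : IsKernel a b r₁ ρ₁) :
    IsKernel a b (fun t τ => r t τ + r₁ t τ) fun t τ => ρ t τ + ρ₁ t τ where
  prim τ hτ := (h.prim τ hτ).add (h₁.prim τ hτ)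
  integrable := h.integrable.add h₁.integrable
  diag := h.diag.add h₁.diag
  slice t ht := (h.slice t ht).add (h₁.slice t ht)
  slice_deriv t ht := (h.slice_deriv t ht).add (h₁.slice_deriv t ht)

theorem sub (h₁ : IsKernel a b r₁ ρ₁) :
    IsKernel a b (fun t τ => r t τ - r₁ t τ) fun t τ => ρ t τ - ρ₁ t τ where
  prim τ hτ := (h.prim τ hτ).sub (h₁.prim τ hτ)
  integrable := h.integrable.sub h₁.integrable
  diag := h.diag.sub h₁.diag
  slice t ht := (h.slice t ht).sub (h₁.slice t ht)
  slice_deriv t ht := (h.slice_deriv t ht).sub (h₁.slice_deriv t ht)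

theorem integrableOn_integral_deriv :
    IntegrableOn (fun s => ∫ τ in s..b, ρ s τ) (Icc a b) := by
  refine (integrable_triangle_indicator h.integrable).integral_prod_left.congr
    (ae_restrict_Icc_of_eqOn fun s hs => ?_)
  have inter_eq : Icc a b ∩ Ici s = Icc s b := by
    ext τ
    exact ⟨fun h => ⟨h.2, h.1.2⟩, fun h => ⟨⟨hs.1.trans h.1, h.2⟩, h.1⟩⟩
  simp only
  rw [setIntegral_indicator measurableSet_Ici, inter_eq, integral_Icc_eq_integral_Ioc,
    intervalIntegral.integral_of_le hs.2]

/-- The order of integration is exchanged in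
`∫_t^b (r(τ,τ) - r(t,τ)) dτ = ∫_t^b ∫_t^τ ρ(s,τ) ds dτ`. -/
theorem hasIntegralDerivOn_integral :
    HasIntegralDerivOn a b (fun t => ∫ τ in t..b, r t τ)
      fun s => -(r s s - ∫ τ in s..b, ρ s τ) := by
  have hd := h.integrableOn_integral_deriv
  refine .of_terminal (c := 0) (h.diag.sub hd) fun t ht => ?_
  have hb : b ∈ Icc a b := right_mem_Icc.2 (ht.1.trans ht.2)
  have hsub : Ioc t b ⊆ Icc a b := Ioc_subset_Icc_self.trans (Icc_subset_Icc ht.1 le_rfl)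
  have inner : EqOn (fun τ => ∫ s in t..τ, ρ s τ) (fun τ => r τ τ - r t τ) (Icc t b) :=
    fun τ hτ => ((h.prim τ ⟨ht.1.trans hτ.1, hτ.2⟩).sub_eq ht ⟨ht.1.trans hτ.1, hτ.2⟩).symm
  have swap : ∫ τ in t..b, ∫ s in t..τ, ρ s τ = ∫ s in t..b, ∫ τ in s..b, ρ s τ :=
    intervalIntegral_triangle_swap ht.2 ((integrable_triangle_indicator h.integrable).mono_measure
      (Measure.prod_mono (Measure.restrict_mono hsub le_rfl) (Measure.restrict_mono hsub le_rfl)))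
  rw [intervalIntegral.integral_sub (intervalIntegrable_of_integrableOn_Icc h.diag ht hb)
    (intervalIntegrable_of_integrableOn_Icc hd ht hb), ← swap,
    intervalIntegral_congr_Icc inner (left_mem_Icc.2 ht.2) (right_mem_Icc.2 ht.2),
    intervalIntegral.integral_sub (intervalIntegrable_of_integrableOn_Icc h.diag ht hb)
      (intervalIntegrable_of_integrableOn_Icc (h.slice t ht) ht hb)]
  abel

end IsKernel
end Kernel

section SymmetricIntegral

variable {κ l o : Type*} [Fintype κ] {a b c d : ℝ}

theorem isSymm_transpose_mul_mul {W : Matrix κ κ ℝ} (hW : W.IsSymm) (C : Matrix κ l ℝ) :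
    (Cᵀ * W * C).IsSymm := by
  simp only [Matrix.IsSymm, Matrix.transpose_mul, Matrix.transpose_transpose, hW.eq,
    Matrix.mul_assoc]

theorem isSymm_intervalIntegral {W : ℝ → Matrix κ κ ℝ} (hW : IntegrableOn W (Icc a b))
    (hsymm : ∀ s ∈ Icc a b, (W s).IsSymm) (hc : c ∈ Icc a b) (hd : d ∈ Icc a b) :
    (∫ s in c..d, W s).IsSymm := by
  have comm := (matrixTransposeCLM κ κ).intervalIntegral_comp_comm
    (intervalIntegrable_of_integrableOn_Icc hW hc hd)
  exact comm.symm.trans (intervalIntegral_congr_Icc (fun s hs => hsymm s hs) hc hd)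

variable [Fintype l] [Fintype o] in
theorem intervalIntegral_mul_mul {W : ℝ → Matrix κ l ℝ} (hW : IntervalIntegrable W volume c d)
    (L : Matrix o κ ℝ) (N : Matrix l o ℝ) :
    ∫ s in c..d, L * W s * N = L * (∫ s in c..d, W s) * N :=
  ((matrixMulCLM o l o).flip N ∘L matrixMulCLM o κ l L).intervalIntegral_comp_comm hW

theorem matIntegral_eq_intervalIntegral {k l : ℕ} {W : ℝ → Matrix (Fin k) (Fin l) ℝ}
    (hW : IntervalIntegrable W volume c d) : matIntegral W c d = ∫ s in c..d, W s := by
  ext i j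
  exact (Matrix.entryLinearMap ℝ ℝ i j).toContinuousLinearMap.intervalIntegral_comp_comm hW

end SymmetricIntegral

/-! ### The value matrix of a linear feedback -/

namespace LQProblem

variable {n m : ℕ}

section WeakAssumptions

variable (D : LQProblem n m)

/-- A weaker form of the standing assumptions: `M` is positive definite on the diagonal only, the
other weights are merely symmetric, and `M`, `Q`, `S` are continuously differentiable in the first
variable only. -/
structure WeakAssumptions : Prop where
  T_pos : 0 < D.T
  A_integrableOn : IntegrableOn D.A (Icc 0 D.T)
  B_memLp : MemLp D.B ⊤ (volume.restrict (Icc 0 D.T))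
  M_C1 : IsC1Fst 0 D.T D.M (D.d1 D.M)
  M_symm : ∀ t ∈ Icc 0 D.T, ∀ s ∈ Icc 0 D.T, (D.M t s).IsSymm
  M_posDef : ∀ s ∈ Icc 0 D.T, (D.M s s).PosDef
  Q_C1 : IsC1Fst 0 D.T D.Q (D.d1 D.Q)
  Q_symm : ∀ t ∈ Icc 0 D.T, ∀ s ∈ Icc 0 D.T, (D.Q t s).IsSymm
  G_hasDeriv : ∀ t ∈ Icc 0 D.T, HasDerivWithinAt D.G (D.dG t) (Icc 0 D.T) t
  G_deriv_continuousOn : ContinuousOn D.dG (Icc 0 D.T)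
  G_symm : ∀ t ∈ Icc 0 D.T, (D.G t).IsSymm
  S_C1 : IsC1Fst 0 D.T D.S (D.d1 D.S)

variable {D}

theorem IsC1Square.hasDerivWithinAt {k l : ℕ} {F : ℝ → ℝ → Matrix (Fin k) (Fin l) ℝ}
    (hF : D.IsC1Square F) {t s : ℝ} (ht : t ∈ Icc 0 D.T) (hs : s ∈ Icc 0 D.T) (i : Fin k)
    (j : Fin l) : HasDerivWithinAt (fun r => F r s i j)
      (fderivWithin ℝ (fun p : ℝ × ℝ => F p.1 p.2 i j) (Icc 0 D.T ×ˢ Icc 0 D.T) (t, s) (1, 0))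
      (Icc 0 D.T) t :=
  ((hF i j).differentiableOn one_ne_zero (t, s) ⟨ht, hs⟩).hasFDerivWithinAt.comp_hasDerivWithinAt
    (f := fun r : ℝ => (r, s)) t
    ((hasDerivWithinAt_id t _).prodMk (hasDerivWithinAt_const t _ s)) fun _ hr => ⟨hr, hs⟩

theorem IsC1Square.isC1Fst {k l : ℕ} {F : ℝ → ℝ → Matrix (Fin k) (Fin l) ℝ} (hT : 0 < D.T)
    (hF : D.IsC1Square F) : IsC1Fst 0 D.T F (D.d1 F) where
  continuousOn := continuousOn_pi.2 fun i => continuousOn_pi.2 fun j => (hF i j).continuousOn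
  continuousOn_deriv := continuousOn_pi.2 fun i => continuousOn_pi.2 fun j =>
    (((hF i j).continuousOn_fderivWithin ((uniqueDiffOn_Icc hT).prod (uniqueDiffOn_Icc hT))
      le_rfl).clm_apply (continuousOn_const (c := ((1 : ℝ), (0 : ℝ))))).congr fun p hp =>
        (hF.hasDerivWithinAt hp.1 hp.2 i j).derivWithin (uniqueDiffOn_Icc hT p.1 hp.1)
  hasDerivWithinAt _ ht _ hs := hasDerivWithinAt_pi.2 fun i => hasDerivWithinAt_pi.2 fun j =>
    (hF.hasDerivWithinAt ht hs i j).differentiableWithinAt.hasDerivWithinAt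

theorem Assumptions.weak (hD : D.Assumptions) : D.WeakAssumptions where
  T_pos := hD.T_pos
  A_integrableOn := memLp_one_iff_integrable.1 (memLp_matrix_iff.2 hD.A_L1)
  B_memLp := memLp_matrix_iff.2 hD.B_Linfty
  M_C1 := hD.M_C1.isC1Fst hD.T_pos
  M_symm _ ht _ hs := (hD.M_posDef _ ht _ hs).isHermitian
  M_posDef _ hs := hD.M_posDef _ hs _ hs
  Q_C1 := hD.Q_C1.isC1Fst hD.T_pos
  Q_symm _ ht _ hs := (hD.Q_posSemidef _ ht _ hs).isHermitian
  G_hasDeriv t ht := hasDerivWithinAt_pi.2 fun i => hasDerivWithinAt_pi.2 fun j =>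
    ((hD.G_C1 i j).differentiableOn one_ne_zero t ht).hasDerivWithinAt
  G_deriv_continuousOn := continuousOn_pi.2 fun i => continuousOn_pi.2 fun j =>
    (hD.G_C1 i j).continuousOn_derivWithin (uniqueDiffOn_Icc hD.T_pos) le_rfl
  G_symm _ ht := (hD.G_posSemidef _ ht).isHermitian
  S_C1 := hD.S_C1.isC1Fst hD.T_pos

theorem d1_symm {k : ℕ} {F : ℝ → ℝ → Matrix (Fin k) (Fin k) ℝ}
    (hF : ∀ t ∈ Icc 0 D.T, ∀ s ∈ Icc 0 D.T, (F t s).IsSymm) {t s : ℝ} (ht : t ∈ Icc 0 D.T)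
    (hs : s ∈ Icc 0 D.T) : (D.d1 F t s).IsSymm :=
  .ext fun i j => derivWithin_congr (fun r hr => (hF r hr s hs).apply i j)
    ((hF t ht s hs).apply i j)

namespace WeakAssumptions

variable (hD : D.WeakAssumptions)
include hD

theorem T_mem : D.T ∈ Icc 0 D.T := right_mem_Icc.2 hD.T_pos.le

theorem dG_symm {t : ℝ} (ht : t ∈ Icc 0 D.T) : (D.dG t).IsSymm :=
  .ext fun i j => derivWithin_congr (fun r hr => (hD.G_symm r hr).apply i j)
    ((hD.G_symm t ht).apply i j)

theorem isUnit_det_M {s : ℝ} (hs : s ∈ Icc 0 D.T) : IsUnit (D.M s s).det :=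
  (hD.M_posDef s hs).det_pos.ne'.isUnit

theorem M_mul_Minv {s : ℝ} (hs : s ∈ Icc 0 D.T) : D.M s s * D.Minv s = 1 :=
  Matrix.mul_nonsing_inv _ (hD.isUnit_det_M hs)

theorem Minv_mul_M {s : ℝ} (hs : s ∈ Icc 0 D.T) : D.Minv s * D.M s s = 1 :=
  Matrix.nonsing_inv_mul _ (hD.isUnit_det_M hs)

theorem Minv_symm {s : ℝ} (hs : s ∈ Icc 0 D.T) : (D.Minv s).IsSymm := by
  rw [Matrix.IsSymm, Minv, Matrix.transpose_nonsing_inv, (hD.M_symm s hs s hs).eq]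

theorem continuousOn_Minv : ContinuousOn D.Minv (Icc 0 D.T) :=
  continuousOn_matrix_inv hD.M_C1.continuousOn_diag fun _ hs => hD.isUnit_det_M hs

end WeakAssumptions
end WeakAssumptions

section Value

/-- The weight `Q + Υᵀ M Υ - Υᵀ S - Sᵀ Υ` of the running cost under the feedback `-Υ`. -/
def runWeight (Q : ℝ → ℝ → Matrix (Fin n) (Fin n) ℝ) (M : ℝ → ℝ → Matrix (Fin m) (Fin m) ℝ)
    (S : ℝ → ℝ → Matrix (Fin m) (Fin n) ℝ) (Υ : ℝ → Matrix (Fin m) (Fin n) ℝ) (t τ : ℝ) :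
    Matrix (Fin n) (Fin n) ℝ :=
  Q t τ + ((Υ τ)ᵀ * M t τ * Υ τ - (Υ τ)ᵀ * S t τ - (S t τ)ᵀ * Υ τ)

theorem runWeight_symm {Q : ℝ → ℝ → Matrix (Fin n) (Fin n) ℝ}
    {M : ℝ → ℝ → Matrix (Fin m) (Fin m) ℝ} {t τ : ℝ} (hQ : (Q t τ).IsSymm) (hM : (M t τ).IsSymm)
    (S : ℝ → ℝ → Matrix (Fin m) (Fin n) ℝ) (Υ : ℝ → Matrix (Fin m) (Fin n) ℝ) :
    (runWeight Q M S Υ t τ).IsSymm := by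
  simp only [Matrix.IsSymm, runWeight, Matrix.transpose_add, Matrix.transpose_sub,
    Matrix.transpose_mul, Matrix.transpose_transpose, hQ.eq, hM.eq, Matrix.mul_assoc]
  abel

variable (D : LQProblem n m) (Υ : ℝ → Matrix (Fin m) (Fin n) ℝ)
  (Ψ Y : ℝ → Matrix (Fin n) (Fin n) ℝ)

/-- The running weight of `D` under the feedback `-Υ`. -/
abbrev weight := runWeight D.Q D.M D.S Υ

/-- The derivative of the running weight in the time of evaluation. -/
abbrev weightDeriv := runWeight (D.d1 D.Q) (D.d1 D.M) (D.d1 D.S) Υ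

/-- The matrix of the cost on `[s,T]`, with the weights of time `t`, of the feedback `-Υ`, as a
quadratic form in `Ψ(s)⁻¹ X(s)`, where `Ψ` is a fundamental matrix of `A - B Υ`. -/
def pulledValue (t s : ℝ) : Matrix (Fin n) (Fin n) ℝ :=
  (Ψ D.T)ᵀ * D.G t * Ψ D.T + ∫ τ in s..D.T, (Ψ τ)ᵀ * D.weight Υ t τ * Ψ τ

/-- The derivative of `pulledValue` in the time of evaluation `t`, at `s = t`. -/
def pulledValueDeriv (t : ℝ) : Matrix (Fin n) (Fin n) ℝ :=
  (Ψ D.T)ᵀ * D.dG t * Ψ D.T + ∫ τ in t..D.T, (Ψ τ)ᵀ * D.weightDeriv Υ t τ * Ψ τ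

/-- The matrix of the cost on `[s,T]`, with the weights of time `t`, of the feedback `-Υ`, as a
quadratic form in the state `X(s)`. Here `Ψ` is a fundamental matrix of `A - B Υ`, and `Y` its
inverse. -/
def value (t s : ℝ) : Matrix (Fin n) (Fin n) ℝ :=
  (Y s)ᵀ * D.pulledValue Υ Ψ t s * Y s

/-- The term `Q̄` of the equilibrium Riccati equation for an arbitrary feedback `-Υ`, with
transition matrix `Φ(r,s) = Ψ(r) Y(s)`. -/
def nonlocalWeight (t : ℝ) : Matrix (Fin n) (Fin n) ℝ :=
  D.Q t t - (Y t)ᵀ * D.pulledValueDeriv Υ Ψ t * Y t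

variable {D Υ Ψ Y}

namespace WeakAssumptions

variable (hD : D.WeakAssumptions)
include hD

theorem isKernel_Q (hΨ : ContinuousOn Ψ (Icc 0 D.T)) :
    IsKernel 0 D.T (fun t τ => (Ψ τ)ᵀ * D.Q t τ * Ψ τ)
      fun t τ => (Ψ τ)ᵀ * D.d1 D.Q t τ * Ψ τ :=
  have hΨ2 := (memLp_top_of_continuousOn_Icc hΨ).mono_exponent le_top
  hD.Q_C1.isKernel_conj hΨ2 hΨ2

variable (hΥ : MemLp Υ 2 (volume.restrict (Icc 0 D.T)))
include hΥ

theorem integrableOn_closedLoop : IntegrableOn (fun s => D.A s - D.B s * Υ s) (Icc 0 D.T) :=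
  hD.A_integrableOn.sub (memLp_one_iff_integrable.1
    ((memLp_matrix_mul (r := 2) hD.B_memLp hΥ).mono_exponent one_le_two))

theorem isKernel_feedback (hΨ : ContinuousOn Ψ (Icc 0 D.T)) :
    IsKernel 0 D.T
      (fun t τ => (Ψ τ)ᵀ * ((Υ τ)ᵀ * D.M t τ * Υ τ - (Υ τ)ᵀ * D.S t τ - (D.S t τ)ᵀ * Υ τ) * Ψ τ)
      fun t τ => (Ψ τ)ᵀ * ((Υ τ)ᵀ * D.d1 D.M t τ * Υ τ - (Υ τ)ᵀ * D.d1 D.S t τ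
        - (D.d1 D.S t τ)ᵀ * Υ τ) * Ψ τ := by
  have hΨ' := memLp_top_of_continuousOn_Icc hΨ
  have hΨ2 := hΨ'.mono_exponent (p := 2) le_top
  have hΥΨ : MemLp (fun s => Υ s * Ψ s) 2 (volume.restrict (Icc 0 D.T)) := memLp_matrix_mul hΥ hΨ'
  have kernel := ((hD.M_C1.isKernel_conj hΥΨ hΥΨ).sub (hD.S_C1.isKernel_conj hΥΨ hΨ2)).sub
    (hD.S_C1.transpose.isKernel_conj hΨ2 hΥΨ)
  simpa only [Matrix.transpose_mul, Matrix.mul_sub, Matrix.sub_mul, Matrix.mul_assoc] using kernel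

theorem isKernel_weight (hΨ : ContinuousOn Ψ (Icc 0 D.T)) :
    IsKernel 0 D.T (fun t τ => (Ψ τ)ᵀ * D.weight Υ t τ * Ψ τ)
      fun t τ => (Ψ τ)ᵀ * D.weightDeriv Υ t τ * Ψ τ := by
  simpa only [runWeight, Matrix.mul_add, Matrix.add_mul] using
    (hD.isKernel_Q hΨ).add (hD.isKernel_feedback hΥ hΨ)

theorem pulledValue_hasIntegralDerivOn (hΨ : ContinuousOn Ψ (Icc 0 D.T)) {t : ℝ}
    (ht : t ∈ Icc 0 D.T) : HasIntegralDerivOn 0 D.T (D.pulledValue Υ Ψ t)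
      fun s => -((Ψ s)ᵀ * D.weight Υ t s * Ψ s) :=
  .of_terminal ((hD.isKernel_weight hΥ hΨ).slice t ht) fun _ _ => rfl

theorem pulledValue_diag_hasIntegralDerivOn (hΨ : ContinuousOn Ψ (Icc 0 D.T)) :
    HasIntegralDerivOn 0 D.T (fun s => D.pulledValue Υ Ψ s s)
      fun s => -((Ψ s)ᵀ * D.weight Υ s s * Ψ s - D.pulledValueDeriv Υ Ψ s) := by
  have hG := HasIntegralDerivOn.of_hasDerivWithinAt hD.G_hasDeriv hD.G_deriv_continuousOn
  refine ((((HasIntegralDerivOn.const (Ψ D.T)ᵀ).matrix_mul hG).matrix_mul (.const (Ψ D.T))).add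
    (hD.isKernel_weight hΥ hΨ).hasIntegralDerivOn_integral).congr_on (fun _ _ => rfl)
    fun s _ => ?_
  simp only [Matrix.zero_mul, zero_add, Matrix.mul_zero, add_zero, pulledValueDeriv]
  abel

theorem nonlocalWeight_integrableOn (hΨ : ContinuousOn Ψ (Icc 0 D.T))
    (hY : ContinuousOn Y (Icc 0 D.T)) : IntegrableOn (D.nonlocalWeight Υ Ψ Y) (Icc 0 D.T) := by
  have hG : ContinuousOn (fun t => (Ψ D.T)ᵀ * D.dG t * Ψ D.T) (Icc 0 D.T) :=
    continuousOn_matrix_mul (continuousOn_matrix_mul continuousOn_const hD.G_deriv_continuousOn)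
      continuousOn_const
  have pulled : IntegrableOn (D.pulledValueDeriv Υ Ψ) (Icc 0 D.T) :=
    hG.integrableOn_Icc.add (hD.isKernel_weight hΥ hΨ).integrableOn_integral_deriv
  exact hD.Q_C1.continuousOn_diag.integrableOn_Icc.sub
    (integrableOn_bilin_continuousOn (matrixMulCLM _ _ _) (continuousOn_bilin_integrableOn
      (matrixMulCLM _ _ _) (continuousOn_matrix_transpose hY) pulled) hY)

theorem nonlocalWeight_symm (hΨ : ContinuousOn Ψ (Icc 0 D.T)) {t : ℝ} (ht : t ∈ Icc 0 D.T) :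
    (D.nonlocalWeight Υ Ψ Y t).IsSymm :=
  (hD.Q_symm t ht t ht).sub (isSymm_transpose_mul_mul
    ((isSymm_transpose_mul_mul (hD.dG_symm ht) _).add
      (isSymm_intervalIntegral ((hD.isKernel_weight hΥ hΨ).slice_deriv t ht)
        (fun _ hτ => isSymm_transpose_mul_mul
          (runWeight_symm (d1_symm hD.Q_symm ht hτ) (d1_symm hD.M_symm ht hτ) _ _) _)
        ht hD.T_mem)) _)

theorem value_symm (hΨ : ContinuousOn Ψ (Icc 0 D.T)) {t s : ℝ} (ht : t ∈ Icc 0 D.T)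
    (hs : s ∈ Icc 0 D.T) : (D.value Υ Ψ Y t s).IsSymm :=
  isSymm_transpose_mul_mul
    ((isSymm_transpose_mul_mul (hD.G_symm t ht) _).add
      (isSymm_intervalIntegral ((hD.isKernel_weight hΥ hΨ).slice t ht)
        (fun τ hτ => isSymm_transpose_mul_mul
          (runWeight_symm (hD.Q_symm t ht τ hτ) (hD.M_symm t ht τ hτ) _ _) _)
        hs hD.T_mem)) _

end WeakAssumptions

section Lyapunov

variable (hD : D.WeakAssumptions) (hΥ : MemLp Υ 2 (volume.restrict (Icc 0 D.T)))
  (hf : IsFundamental 0 D.T (fun s => D.A s - D.B s * Υ s) Ψ Y)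
include hD hf

theorem WeakAssumptions.value_terminal (t : ℝ) : D.value Υ Ψ Y t D.T = D.G t := by
  rw [value, pulledValue, intervalIntegral.integral_same, add_zero, hf.conj_conj_inv hD.T_mem]

include hΥ

theorem WeakAssumptions.value_hasIntegralDerivOn {t : ℝ} (ht : t ∈ Icc 0 D.T) :
    HasIntegralDerivOn 0 D.T (D.value Υ Ψ Y t)
      fun s => -((D.A s - D.B s * Υ s)ᵀ * D.value Υ Ψ Y t s
        + D.value Υ Ψ Y t s * (D.A s - D.B s * Υ s) + D.weight Υ t s) := by
  refine (hf.conj_hasIntegralDerivOn (hD.pulledValue_hasIntegralDerivOn hΥ hf.prim.continuousOn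
    ht)).congr_on (fun _ _ => rfl) fun s hs => ?_
  simp only [hf.conj_conj_inv hs, value]

theorem WeakAssumptions.value_diag_hasIntegralDerivOn :
    HasIntegralDerivOn 0 D.T (fun s => D.value Υ Ψ Y s s)
      fun s => -((D.A s - D.B s * Υ s)ᵀ * D.value Υ Ψ Y s s
        + D.value Υ Ψ Y s s * (D.A s - D.B s * Υ s)
        + (D.weight Υ s s - D.Q s s + D.nonlocalWeight Υ Ψ Y s)) := by
  refine (hf.conj_hasIntegralDerivOn (hD.pulledValue_diag_hasIntegralDerivOn hΥ
    hf.prim.continuousOn)).congr_on (fun _ _ => rfl) fun s hs => ?_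
  simp only [Matrix.mul_sub, Matrix.sub_mul (_ * _), hf.conj_conj_inv hs, nonlocalWeight, value]
  abel

end Lyapunov
end Value
end LQProblem

/-! ### Completion of squares -/

theorem memLp_Icc_mono {E : Type*} [NormedAddCommGroup E] {p : ℝ≥0∞} {f : ℝ → E} {a b c d : ℝ}
    (hf : MemLp f p (volume.restrict (Icc a b))) (hc : a ≤ c) (hd : d ≤ b) :
    MemLp f p (volume.restrict (Icc c d)) :=
  hf.mono_measure (Measure.restrict_mono (Icc_subset_Icc hc hd) le_rfl)

theorem transpose_mulVec_dotProduct {κ l : Type*} [Fintype κ] [Fintype l] (C : Matrix κ l ℝ)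
    (x : κ → ℝ) (y : l → ℝ) : (Cᵀ *ᵥ x) ⬝ᵥ y = x ⬝ᵥ (C *ᵥ y) := by
  rw [Matrix.mulVec_transpose, Matrix.dotProduct_mulVec]

theorem mulVec_dotProduct_swap {κ : Type*} [Fintype κ] {C : Matrix κ κ ℝ} (hC : C.IsSymm)
    (x y : κ → ℝ) : (C *ᵥ x) ⬝ᵥ y = (C *ᵥ y) ⬝ᵥ x := by
  rw [dotProduct_comm, ← transpose_mulVec_dotProduct, hC.eq]

section AffineFeedback

variable {κ l : Type*} [Fintype κ] [Fintype l] {a b : ℝ} {ub : ℝ → (l → ℝ) → κ → ℝ}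
  {K : ℝ → Matrix κ l ℝ} {c : ℝ → κ → ℝ}

/-- The feedback law `ub` is on `[a,b]` the affine map `y ↦ K(s) y + c(s)` with square integrable
coefficients; spike perturbations of a linear feedback law are of this form. -/
structure IsAffineFeedback (a b : ℝ) (ub : ℝ → (l → ℝ) → κ → ℝ) (K : ℝ → Matrix κ l ℝ)
    (c : ℝ → κ → ℝ) : Prop where
  memLp_gain : MemLp K 2 (volume.restrict (Icc a b))
  memLp_offset : MemLp c 2 (volume.restrict (Icc a b))
  eq_affine : ∀ s ∈ Icc a b, ∀ y, ub s y = K s *ᵥ y + c s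

theorem IsAffineFeedback.memLp (h : IsAffineFeedback a b ub K c) {X : ℝ → l → ℝ}
    (hX : ContinuousOn X (Icc a b)) : MemLp (fun s => ub s (X s)) 2 (volume.restrict (Icc a b)) :=
  ((memLp_matrix_mulVec (r := 2) h.memLp_gain (memLp_top_of_continuousOn_Icc hX)).add
    h.memLp_offset).ae_eq (ae_restrict_Icc_of_eqOn fun s hs => (h.eq_affine s hs (X s)).symm)

theorem isAffineFeedback_const (a b : ℝ) (v : κ → ℝ) :
    IsAffineFeedback a b (fun _ (_ : l → ℝ) => v) 0 fun _ => v where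
  memLp_gain := MemLp.zero
  memLp_offset := memLp_const v
  eq_affine s _ y := by simp

end AffineFeedback

theorem IsAffineFeedback.perturb {n m : ℕ} {a b : ℝ} {ub : ℝ → (Fin n → ℝ) → Fin m → ℝ}
    {K : ℝ → Matrix (Fin m) (Fin n) ℝ} {c : ℝ → Fin m → ℝ} (h : IsAffineFeedback a b ub K c)
    (t ε : ℝ) (v : Fin m → ℝ) :
    IsAffineFeedback a b (LQProblem.perturb ub t ε v) ((Icc t (t + ε))ᶜ.indicator K)
      ((Icc t (t + ε))ᶜ.indicator c + (Icc t (t + ε)).indicator fun _ => v) where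
  memLp_gain := h.memLp_gain.indicator measurableSet_Icc.compl
  memLp_offset := (h.memLp_offset.indicator measurableSet_Icc.compl).add
    ((memLp_const v).indicator measurableSet_Icc)
  eq_affine s hs y := by
    by_cases hmem : s ∈ Icc t (t + ε) <;>
      simp only [LQProblem.perturb, hmem, if_true, if_false, indicator, Pi.add_apply, mem_compl_iff,
        not_true, not_false_eq_true, Matrix.zero_mulVec, zero_add, add_zero, h.eq_affine s hs]

namespace LQProblem

variable {n m : ℕ}

section State

variable {D : LQProblem n m} (hD : D.WeakAssumptions) {t : ℝ} (ht : t ∈ Icc 0 D.T)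
  {x : Fin n → ℝ}

theorem IsState.initial {u : ℝ → Fin m → ℝ} {X : ℝ → Fin n → ℝ} (htT : t ≤ D.T)
    (hX : D.IsState t x u X) : X t = x := by
  simpa using hX.2 t (left_mem_Icc.2 htT)

theorem isState_of_hasIntegralDerivOn {u : ℝ → Fin m → ℝ} {X : ℝ → Fin n → ℝ}
    (hX : HasIntegralDerivOn t D.T X fun s => D.A s *ᵥ X s + D.B s *ᵥ u s) (h0 : X t = x) :
    D.IsState t x u X :=
  ⟨hX.continuousOn, fun s hs => h0 ▸ hX.2 s hs⟩

include hD ht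

theorem IsState.hasIntegralDerivOn {u : ℝ → Fin m → ℝ} {X : ℝ → Fin n → ℝ}
    (hu : MemLp u 2 (volume.restrict (Icc t D.T))) (hX : D.IsState t x u X) :
    HasIntegralDerivOn t D.T X fun s => D.A s *ᵥ X s + D.B s *ᵥ u s := by
  have hAX := integrableOn_matrix_mulVec
    (hD.A_integrableOn.mono_set (Icc_subset_Icc ht.1 le_rfl)) hX.1
  have hBu := memLp_matrix_mulVec (r := 2) (memLp_Icc_mono hD.B_memLp ht.1 le_rfl) hu
  exact .of_initial (hAX.add (memLp_one_iff_integrable.1 (hBu.mono_exponent one_le_two))) hX.2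

variable {ub : ℝ → (Fin n → ℝ) → Fin m → ℝ} {K : ℝ → Matrix (Fin m) (Fin n) ℝ}
  {c : ℝ → Fin m → ℝ}

theorem exists_isClosedLoop (hub : IsAffineFeedback t D.T ub K c) (x : Fin n → ℝ) :
    ∃ X, D.IsClosedLoop ub t x X ∧ ∀ Z, D.IsClosedLoop ub t x Z → EqOn Z X (Icc t D.T) := by
  have hB := memLp_Icc_mono hD.B_memLp ht.1 le_rfl
  have hBK : IntegrableOn (fun s => D.B s * K s) (Icc t D.T) := memLp_one_iff_integrable.1
    ((memLp_matrix_mul (r := 2) hB hub.memLp_gain).mono_exponent one_le_two)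
  have hBc : IntegrableOn (fun s => D.B s *ᵥ c s) (Icc t D.T) := memLp_one_iff_integrable.1
    ((memLp_matrix_mulVec (r := 2) hB hub.memLp_offset).mono_exponent one_le_two)
  obtain ⟨Ψ, Y, hf, -⟩ := exists_isFundamental ht.2
    ((hD.A_integrableOn.mono_set (Icc_subset_Icc ht.1 le_rfl)).add hBK)
  obtain ⟨X, hX, hX0⟩ := hf.exists_vec ht.2 hBc x
  have velocity (Z : ℝ → Fin n → ℝ) : EqOn (fun s => D.A s *ᵥ Z s + D.B s *ᵥ ub s (Z s))
      (fun s => (D.A s + D.B s * K s) *ᵥ Z s + D.B s *ᵥ c s) (Icc t D.T) := fun s hs => by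
    simp only [hub.eq_affine s hs, Matrix.add_mulVec, Matrix.mulVec_add, ← Matrix.mulVec_mulVec,
      add_assoc]
  refine ⟨X, isState_of_hasIntegralDerivOn (hX.congr_on (fun _ _ => rfl) (velocity X)) hX0,
    fun Z hZ => ?_⟩
  have hZ' := hZ.hasIntegralDerivOn hD ht (hub.memLp hZ.1)
  exact hf.vec_unique (hZ'.congr_on (fun _ _ => rfl) (velocity Z).symm) hX
    ((hZ.initial ht.2).trans hX0.symm)

theorem closedLoop_isClosedLoop (hub : IsAffineFeedback t D.T ub K c) (x : Fin n → ℝ) :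
    D.IsClosedLoop ub t x (D.closedLoop ub t x) :=
  have ⟨X, hX, _⟩ := exists_isClosedLoop hD ht hub x
  Classical.epsilon_spec (p := fun X => D.IsClosedLoop ub t x X) ⟨X, hX⟩

theorem closedLoop_hasIntegralDerivOn (hub : IsAffineFeedback t D.T ub K c) (x : Fin n → ℝ) :
    HasIntegralDerivOn t D.T (D.closedLoop ub t x) fun s =>
      D.A s *ᵥ D.closedLoop ub t x s + D.B s *ᵥ ub s (D.closedLoop ub t x s) :=
  have hX := closedLoop_isClosedLoop hD ht hub x
  hX.hasIntegralDerivOn hD ht (hub.memLp hX.1)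

theorem exists_state_const (x : Fin n → ℝ) (v : Fin m → ℝ) : ∃ X : ℝ → Fin n → ℝ,
    HasIntegralDerivOn t D.T X (fun s => D.A s *ᵥ X s + D.B s *ᵥ v) ∧ X t = x :=
  have hub := isAffineFeedback_const (l := Fin n) t D.T v
  ⟨_, closedLoop_hasIntegralDerivOn hD ht hub x,
    (closedLoop_isClosedLoop hD ht hub x).initial ht.2⟩

end State

section Excess

variable (D : LQProblem n m)

/-- The density of the excess cost, evaluated at time `t`, of the control value `u` at `(s,x)`
over the feedback `-Υ`, where `W` is the value matrix of that feedback at `s`. -/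
def excess (Υ : ℝ → Matrix (Fin m) (Fin n) ℝ) (W : Matrix (Fin n) (Fin n) ℝ) (t s : ℝ)
    (x : Fin n → ℝ) (u : Fin m → ℝ) : ℝ :=
  (D.M t s *ᵥ (u + Υ s *ᵥ x)) ⬝ᵥ (u + Υ s *ᵥ x) +
    2 * (((D.S t s + (D.B s)ᵀ * W - D.M t s * Υ s) *ᵥ x) ⬝ᵥ (u + Υ s *ᵥ x))

variable {D} {Υ : ℝ → Matrix (Fin m) (Fin n) ℝ} {Ψ Y : ℝ → Matrix (Fin n) (Fin n) ℝ}

theorem excess_feedback (W : Matrix (Fin n) (Fin n) ℝ) (t s : ℝ) (x : Fin n → ℝ) :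
    D.excess Υ W t s x (-(Υ s *ᵥ x)) = 0 := by
  simp [excess]

/-- Completion of squares: the running cost plus the derivative along the state of the quadratic
form `V`, when `V` solves the Lyapunov equation of the feedback `-Υ`. -/
theorem running_cost_add_deriv_eq_excess {V : Matrix (Fin n) (Fin n) ℝ} {t s : ℝ} (hV : V.IsSymm)
    (hM : (D.M t s).IsSymm) (x : Fin n → ℝ) (u : Fin m → ℝ) :
    ((D.Q t s *ᵥ x) ⬝ᵥ x + 2 * ((D.S t s *ᵥ x) ⬝ᵥ u)) + (D.M t s *ᵥ u) ⬝ᵥ u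
      + (((-((D.A s - D.B s * Υ s)ᵀ * V + V * (D.A s - D.B s * Υ s) + D.weight Υ t s)) *ᵥ x
          + V *ᵥ (D.A s *ᵥ x + D.B s *ᵥ u)) ⬝ᵥ x
        + (V *ᵥ x) ⬝ᵥ (D.A s *ᵥ x + D.B s *ᵥ u)) = D.excess Υ V t s x u := by
  simp only [excess, weight, runWeight, Matrix.neg_mulVec, Matrix.add_mulVec, Matrix.sub_mulVec,
    Matrix.transpose_sub, Matrix.transpose_mul, Matrix.sub_mul, Matrix.mul_sub,
    ← Matrix.mulVec_mulVec, Matrix.mulVec_add, add_dotProduct, sub_dotProduct, neg_dotProduct,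
    dotProduct_add, transpose_mulVec_dotProduct]
  generalize Υ s *ᵥ x = w
  rw [mulVec_dotProduct_swap hV (D.A s *ᵥ x) x, mulVec_dotProduct_swap hV (D.B s *ᵥ w) x,
    mulVec_dotProduct_swap hV (D.B s *ᵥ u) x, mulVec_dotProduct_swap hM u w,
    dotProduct_comm w (D.S t s *ᵥ x)]
  ring

variable (hD : D.WeakAssumptions) {t : ℝ} (ht : t ∈ Icc 0 D.T)
include hD ht

theorem integrableOn_state_cost {u : ℝ → Fin m → ℝ} {X : ℝ → Fin n → ℝ}
    (hX : ContinuousOn X (Icc t D.T)) (hu : MemLp u 2 (volume.restrict (Icc t D.T))) :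
    IntegrableOn (fun s => (D.Q t s *ᵥ X s) ⬝ᵥ X s + 2 * ((D.S t s *ᵥ X s) ⬝ᵥ u s))
      (Icc t D.T) := by
  have hsub : Icc t D.T ⊆ Icc 0 D.T := Icc_subset_Icc ht.1 le_rfl
  have hXp := memLp_top_of_continuousOn_Icc hX
  have hQX := memLp_top_of_continuousOn_Icc
    (continuousOn_matrix_mulVec ((hD.Q_C1.continuousOn_slice ht).mono hsub) hX)
  have hSX := memLp_top_of_continuousOn_Icc
    (continuousOn_matrix_mulVec ((hD.S_C1.continuousOn_slice ht).mono hsub) hX)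
  exact ((memLp_dotProduct (r := ⊤) hQX hXp).integrable le_top).add
    (((memLp_dotProduct (r := 2) hSX hu).integrable one_le_two).const_mul 2)

theorem integrableOn_control_cost {u : ℝ → Fin m → ℝ}
    (hu : MemLp u 2 (volume.restrict (Icc t D.T))) :
    IntegrableOn (fun s => (D.M t s *ᵥ u s) ⬝ᵥ u s) (Icc t D.T) := by
  have hM := memLp_top_of_continuousOn_Icc
    ((hD.M_C1.continuousOn_slice ht).mono (Icc_subset_Icc ht.1 le_rfl))
  exact (memLp_dotProduct (r := 1) (memLp_matrix_mulVec (r := 2) hM hu) hu).integrable le_rfl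

variable (hΥ : MemLp Υ 2 (volume.restrict (Icc 0 D.T)))
  (hf : IsFundamental 0 D.T (fun s => D.A s - D.B s * Υ s) Ψ Y)
include hΥ hf

theorem integrableOn_excess_and_cost_eq {u : ℝ → Fin m → ℝ} {X : ℝ → Fin n → ℝ}
    (hu : MemLp u 2 (volume.restrict (Icc t D.T)))
    (hX : HasIntegralDerivOn t D.T X fun s => D.A s *ᵥ X s + D.B s *ᵥ u s) :
    IntegrableOn (fun s => D.excess Υ (D.value Υ Ψ Y t s) t s (X s) (u s)) (Icc t D.T) ∧
    D.cost t X u = (D.value Υ Ψ Y t t *ᵥ X t) ⬝ᵥ X t +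
      ∫ s in t..D.T, D.excess Υ (D.value Υ Ψ Y t s) t s (X s) (u s) := by
  have htt : t ∈ Icc t D.T := left_mem_Icc.2 ht.2
  have hTT : D.T ∈ Icc t D.T := right_mem_Icc.2 ht.2
  have form_deriv := (((hD.value_hasIntegralDerivOn hΥ hf ht).mono ht.1
    le_rfl).matrix_mulVec hX).dotProduct hX
  have state_int := integrableOn_state_cost hD ht hX.continuousOn hu
  have control_int := integrableOn_control_cost hD ht hu
  have running_int : IntegrableOn (fun s => ((D.Q t s *ᵥ X s) ⬝ᵥ X s +
      2 * ((D.S t s *ᵥ X s) ⬝ᵥ u s)) + (D.M t s *ᵥ u s) ⬝ᵥ u s) (Icc t D.T) :=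
    state_int.add control_int
  have excess_eq : EqOn _ (fun s => D.excess Υ (D.value Υ Ψ Y t s) t s (X s) (u s)) (Icc t D.T) :=
    fun s hs => running_cost_add_deriv_eq_excess
      (hD.value_symm hΥ hf.prim.continuousOn ht (Icc_subset_Icc ht.1 le_rfl hs))
      (hD.M_symm t ht s (Icc_subset_Icc ht.1 le_rfl hs)) (X s) (u s)
  refine ⟨(running_int.add form_deriv.1).congr_fun excess_eq measurableSet_Icc, ?_⟩
  have form_sub := form_deriv.sub_eq htt hTT
  rw [hD.value_terminal hf] at form_sub
  have interval {f : ℝ → ℝ} (hf : IntegrableOn f (Icc t D.T)) : IntervalIntegrable f volume t D.T :=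
    intervalIntegrable_of_integrableOn_Icc hf htt hTT
  rw [← intervalIntegral_congr_Icc excess_eq htt hTT, intervalIntegral.integral_add
    (interval running_int) (interval form_deriv.1), ← form_sub,
    intervalIntegral.integral_add (interval state_int) (interval control_int), cost]
  ring

variable {ub : ℝ → (Fin n → ℝ) → Fin m → ℝ} (hub : ∀ s ∈ Icc 0 D.T, ∀ y, ub s y = -(Υ s *ᵥ y))
include hub

omit hD hf in
theorem isAffineFeedback_linear : IsAffineFeedback t D.T ub (-Υ) 0 where
  memLp_gain := (memLp_Icc_mono hΥ ht.1 le_rfl).neg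
  memLp_offset := MemLp.zero
  eq_affine s hs y := by
    rw [hub s (Icc_subset_Icc ht.1 le_rfl hs), Pi.neg_apply, Matrix.neg_mulVec, Pi.zero_apply,
      add_zero]

theorem J_feedback (x : Fin n → ℝ) : D.J t x ub = (D.value Υ Ψ Y t t *ᵥ x) ⬝ᵥ x := by
  have affine := isAffineFeedback_linear ht hΥ hub
  have hX := closedLoop_isClosedLoop hD ht affine x
  have excess_zero : EqOn (fun s => D.excess Υ (D.value Υ Ψ Y t s) t s (D.closedLoop ub t x s)
      (ub s (D.closedLoop ub t x s))) 0 (Icc t D.T) := fun s hs => by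
    simp only [hub s (Icc_subset_Icc ht.1 le_rfl hs), excess_feedback, Pi.zero_apply]
  rw [J, (integrableOn_excess_and_cost_eq hD ht hΥ hf (affine.memLp hX.1)
    (closedLoop_hasIntegralDerivOn hD ht affine x)).2, hX.initial ht.2,
    intervalIntegral_congr_Icc excess_zero (left_mem_Icc.2 ht.2) (right_mem_Icc.2 ht.2)]
  simp only [Pi.zero_apply, intervalIntegral.integral_zero, add_zero]

omit hf in
theorem closedLoop_perturb_eqOn {ε : ℝ} (htε : t + ε ≤ D.T) {v : Fin m → ℝ} {X : ℝ → Fin n → ℝ}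
    (hX : HasIntegralDerivOn t D.T X fun s => D.A s *ᵥ X s + D.B s *ᵥ v) :
    EqOn (D.closedLoop (perturb ub t ε v) t (X t)) X (Icc t (t + ε)) := by
  intro s hs
  have affine := (isAffineFeedback_linear ht hΥ hub).perturb t ε v
  obtain ⟨Ψ, Y, hf, -⟩ := exists_isFundamental (hs.1.trans hs.2)
    (hD.A_integrableOn.mono_set (Icc_subset_Icc ht.1 htε))
  refine hf.vec_unique (((closedLoop_hasIntegralDerivOn hD ht affine _).mono le_rfl htε).congr_on
    (fun _ _ => rfl) fun r hr => ?_) (hX.mono le_rfl htε)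
    ((closedLoop_isClosedLoop hD ht affine _).initial ht.2) hs
  simp only [perturb, if_pos hr]

/-- The excess density vanishes once the control has returned to the feedback. -/
theorem J_perturb_sub {ε : ℝ} (hε : 0 ≤ ε) (htε : t + ε ≤ D.T) {v : Fin m → ℝ}
    {X : ℝ → Fin n → ℝ} (hX : HasIntegralDerivOn t D.T X fun s => D.A s *ᵥ X s + D.B s *ᵥ v) :
    D.J t (X t) (perturb ub t ε v) - D.J t (X t) ub =
      ∫ s in t..t + ε, D.excess Υ (D.value Υ Ψ Y t s) t s (X s) v := by
  have affine := (isAffineFeedback_linear ht hΥ hub).perturb t ε v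
  have hZ := closedLoop_isClosedLoop hD ht affine (X t)
  have hmem : t + ε ∈ Icc t D.T := ⟨by linarith, htε⟩
  obtain ⟨excess_int, cost_eq⟩ := integrableOn_excess_and_cost_eq hD ht hΥ hf (affine.memLp hZ.1)
    (closedLoop_hasIntegralDerivOn hD ht affine (X t))
  rw [J_feedback hD ht hΥ hf hub, J, cost_eq, hZ.initial ht.2, add_sub_cancel_left,
    ← intervalIntegral.integral_add_adjacent_intervals
      (intervalIntegrable_of_integrableOn_Icc excess_int (left_mem_Icc.2 ht.2) hmem)
      (intervalIntegrable_of_integrableOn_Icc excess_int hmem (right_mem_Icc.2 ht.2)),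
    intervalIntegral.integral_zero_ae (a := t + ε), add_zero]
  · refine intervalIntegral_congr_Icc (fun s hs => ?_) (left_mem_Icc.2 hmem.1)
      (right_mem_Icc.2 hmem.1)
    simp only [closedLoop_perturb_eqOn hD ht hΥ hub htε hX hs, perturb, if_pos hs]
  · refine ae_of_all _ fun s hs => ?_
    rw [uIoc_of_le htε] at hs
    simp only [perturb, if_neg fun h : s ∈ Icc t (t + ε) => h.2.not_gt hs.1,
      hub s ⟨by linarith [ht.1, hs.1], hs.2⟩, excess_feedback]

end Excess
end LQProblem

/-! ### Lebesgue points from the right -/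

section RightLebesguePoint

variable {E : Type*} [NormedAddCommGroup E] {t T : ℝ}

theorem eventually_add_mem_Icc (htT : t < T) :
    ∀ᶠ ε in 𝓝[>] (0 : ℝ), 0 < ε ∧ t + ε ∈ Icc t T := by
  filter_upwards [Ioo_mem_nhdsGT (sub_pos.2 htT)] with ε hε
  exact ⟨hε.1, by linarith [hε.1], by linarith [hε.2]⟩

theorem tendsto_add_nhdsGT (t : ℝ) : Tendsto (t + ·) (𝓝[>] 0) (𝓝[>] t) :=
  tendsto_nhdsWithin_iff.2 ⟨((continuous_const_add t).tendsto' 0 t (add_zero t)).mono_left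
    nhdsWithin_le_nhds, eventually_nhdsWithin_of_forall fun _ => lt_add_of_pos_right t⟩

/-- The point `t` is a Lebesgue point of `f : [t,T] → E` from the right. -/
structure IsRightLebesguePoint (t T : ℝ) (f : ℝ → E) : Prop where
  integrableOn : IntegrableOn f (Icc t T)
  tendsto_mean_norm_sub :
    Tendsto (fun ε => ε⁻¹ * ∫ s in t..t + ε, ‖f s - f t‖) (𝓝[>] 0) (𝓝 0)

theorem mean_le_mean {g h : ℝ → ℝ} {ε : ℝ} (hg : IntegrableOn g (Icc t T))
    (hh : IntegrableOn h (Icc t T)) (hgh : ∀ᵐ s ∂volume.restrict (Icc t T), g s ≤ h s)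
    (hε : 0 < ε ∧ t + ε ∈ Icc t T) :
    ε⁻¹ * ∫ s in t..t + ε, g s ≤ ε⁻¹ * ∫ s in t..t + ε, h s := by
  have ht : t ∈ Icc t T := left_mem_Icc.2 (hε.2.1.trans hε.2.2)
  refine mul_le_mul_of_nonneg_left (intervalIntegral.integral_mono_ae_restrict hε.2.1
    (intervalIntegrable_of_integrableOn_Icc hg ht hε.2)
    (intervalIntegrable_of_integrableOn_Icc hh ht hε.2) ?_) (inv_nonneg.2 hε.1.le)
  exact ae_restrict_of_ae_restrict_of_subset (Icc_subset_Icc le_rfl hε.2.2) hgh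

theorem tendsto_mean_mul_of_zero (htT : t < T) {c g : ℝ → ℝ} (hc : ContinuousOn c (Icc t T))
    (hc0 : c t = 0) (hg : IntegrableOn g (Icc t T)) (hg0 : ∀ s, 0 ≤ g s) {C : ℝ}
    (hC : ∀ᶠ ε in 𝓝[>] 0, ε⁻¹ * ∫ s in t..t + ε, g s ≤ C) :
    Tendsto (fun ε => ε⁻¹ * ∫ s in t..t + ε, c s * g s) (𝓝[>] 0) (𝓝 0) := by
  refine Metric.tendsto_nhds.2 fun δ hδ => ?_
  have hC0 : 0 < |C| + 1 := by positivity
  have htt : t ∈ Icc t T := left_mem_Icc.2 htT.le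
  have small : ∀ᶠ s in 𝓝[Icc t T] t, |c s| < δ / (|C| + 1) := by
    have h := Metric.tendsto_nhds.1 (hc t htt) (δ / (|C| + 1)) (by positivity)
    simpa only [hc0, Real.dist_eq, sub_zero] using h
  obtain ⟨η, hη, hη_small⟩ := Metric.eventually_nhds_iff.1 (eventually_nhdsWithin_iff.1 small)
  filter_upwards [hC, eventually_add_mem_Icc htT, Ioo_mem_nhdsGT hη] with ε hεC hε hεη
  have norm_le : ‖∫ s in t..t + ε, c s * g s‖ ≤ δ / (|C| + 1) * ∫ s in t..t + ε, g s := by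
    rw [← intervalIntegral.integral_const_mul]
    refine intervalIntegral.norm_integral_le_of_norm_le hε.2.1 (ae_of_all _ fun s hs => ?_)
      ((intervalIntegrable_of_integrableOn_Icc hg htt hε.2).const_mul _)
    have hs_dist : dist s t < η := by
      rw [Real.dist_eq, abs_of_pos (sub_pos.2 hs.1)]
      linarith [hs.2, hεη.2]
    rw [norm_mul, Real.norm_of_nonneg (hg0 s)]
    exact mul_le_mul_of_nonneg_right (hη_small hs_dist ⟨hs.1.le, hs.2.trans hε.2.2⟩).le (hg0 s)
  rw [dist_zero_right, norm_mul, Real.norm_of_nonneg (inv_nonneg.2 hε.1.le)]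
  calc ε⁻¹ * ‖∫ s in t..t + ε, c s * g s‖
      ≤ ε⁻¹ * (δ / (|C| + 1) * ∫ s in t..t + ε, g s) :=
        mul_le_mul_of_nonneg_left norm_le (inv_nonneg.2 hε.1.le)
    _ = δ / (|C| + 1) * (ε⁻¹ * ∫ s in t..t + ε, g s) := by ring
    _ ≤ δ / (|C| + 1) * |C| := by gcongr; exact hεC.trans (le_abs_self C)
    _ < δ := by rw [div_mul_eq_mul_div, div_lt_iff₀ hC0]; nlinarith

theorem eventually_mean_norm_le_of_memLp_top (htT : t < T) {g : ℝ → E}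
    (hg : MemLp g ⊤ (volume.restrict (Icc t T))) :
    ∀ᶠ ε in 𝓝[>] 0, ε⁻¹ * ∫ s in t..t + ε, ‖g s‖ ≤
      (eLpNorm g ⊤ (volume.restrict (Icc t T))).toReal := by
  have bound : ∀ᵐ s ∂volume.restrict (Icc t T),
      ‖g s‖ ≤ (eLpNorm g ⊤ (volume.restrict (Icc t T))).toReal := by
    filter_upwards [enorm_ae_le_eLpNormEssSup g (volume.restrict (Icc t T))] with s hs
    rw [← eLpNorm_exponent_top] at hs
    exact toReal_enorm (g s) ▸ ENNReal.toReal_mono hg.2.ne hs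
  filter_upwards [eventually_add_mem_Icc htT] with ε hε
  refine (mean_le_mean (hg.integrable le_top).norm (integrable_const _) bound hε).trans_eq ?_
  simp [hε.1.ne']

namespace IsRightLebesguePoint

variable {f g : ℝ → E}

theorem of_norm_sub_le (htT : t < T) {h : ℝ → ℝ} (hf : IntegrableOn f (Icc t T))
    (hh : IntegrableOn h (Icc t T)) (hfh : ∀ s, ‖f s - f t‖ ≤ h s)
    (hmean : Tendsto (fun ε => ε⁻¹ * ∫ s in t..t + ε, h s) (𝓝[>] 0) (𝓝 0)) :
    IsRightLebesguePoint t T f := by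
  refine ⟨hf, squeeze_zero' ?_ ?_ hmean⟩ <;> filter_upwards [eventually_add_mem_Icc htT] with ε hε
  · exact mul_nonneg (inv_nonneg.2 hε.1.le)
      (intervalIntegral.integral_nonneg hε.2.1 fun _ _ => norm_nonneg _)
  · exact mean_le_mean (hf.sub (integrable_const _)).norm hh (ae_of_all _ hfh) hε

theorem const (htT : t < T) (c : E) : IsRightLebesguePoint t T fun _ => c :=
  of_norm_sub_le htT (integrable_const c) (integrable_const 0) (fun _ => by simp) (by simp)

theorem eventually_mean_norm_le (h : IsRightLebesguePoint t T f) (htT : t < T) :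
    ∀ᶠ ε in 𝓝[>] 0, ε⁻¹ * ∫ s in t..t + ε, ‖f s‖ ≤ 1 + ‖f t‖ := by
  filter_upwards [eventually_add_mem_Icc htT,
    h.tendsto_mean_norm_sub.eventually (gt_mem_nhds one_pos)] with ε hε h_lt
  have int_sub : IntegrableOn (fun s => ‖f s - f t‖) (Icc t T) :=
    (h.integrableOn.sub (integrable_const _)).norm
  calc ε⁻¹ * ∫ s in t..t + ε, ‖f s‖
      ≤ ε⁻¹ * ∫ s in t..t + ε, (‖f s - f t‖ + ‖f t‖) :=
        mean_le_mean h.integrableOn.norm (int_sub.add (integrable_const _))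
          (ae_of_all _ fun s => norm_le_norm_sub_add (f s) (f t)) hε
    _ = ε⁻¹ * (∫ s in t..t + ε, ‖f s - f t‖) + ‖f t‖ := by
        rw [intervalIntegral.integral_add (intervalIntegrable_of_integrableOn_Icc int_sub
          (left_mem_Icc.2 htT.le) hε.2) intervalIntegrable_const, intervalIntegral.integral_const,
          add_sub_cancel_left, mul_add, smul_eq_mul, inv_mul_cancel_left₀ hε.1.ne']
    _ ≤ 1 + ‖f t‖ := by gcongr

theorem add (h : IsRightLebesguePoint t T f) (k : IsRightLebesguePoint t T g) (htT : t < T) :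
    IsRightLebesguePoint t T fun s => f s + g s := by
  have hf : IntegrableOn (fun s => ‖f s - f t‖) (Icc t T) := (h.1.sub (integrable_const _)).norm
  have hg : IntegrableOn (fun s => ‖g s - g t‖) (Icc t T) := (k.1.sub (integrable_const _)).norm
  refine of_norm_sub_le htT (h.1.add k.1) (hf.add hg)
    (fun s => by rw [add_sub_add_comm]; exact norm_add_le _ _) ?_
  have mean_add := h.2.add k.2
  rw [add_zero] at mean_add
  refine mean_add.congr' ?_
  filter_upwards [eventually_add_mem_Icc htT] with ε hε
  have ht : t ∈ Icc t T := left_mem_Icc.2 htT.le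
  rw [← mul_add, ← intervalIntegral.integral_add (intervalIntegrable_of_integrableOn_Icc hf ht hε.2)
    (intervalIntegrable_of_integrableOn_Icc hg ht hε.2)]
  rfl

theorem congr_on (h : IsRightLebesguePoint t T f) (htT : t < T) (hfg : EqOn f g (Icc t T)) :
    IsRightLebesguePoint t T g := by
  refine ⟨h.1.congr_fun hfg measurableSet_Icc, h.2.congr' ?_⟩
  filter_upwards [eventually_add_mem_Icc htT] with ε hε
  have ht : t ∈ Icc t T := left_mem_Icc.2 htT.le
  exact congrArg _ (intervalIntegral_congr_Icc (fun s hs => by simp only [hfg hs, hfg ht]) ht hε.2)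

end IsRightLebesguePoint

theorem ae_isRightLebesguePoint {a : ℝ} {f : ℝ → E} (hf : IntegrableOn f (Icc a T)) :
    ∀ᵐ t, t ∈ Ico a T → IsRightLebesguePoint t T f := by
  filter_upwards [(IsUnifLocDoublingMeasure.vitaliFamily volume 1).ae_tendsto_average_norm_sub
    (hf.integrable_indicator measurableSet_Icc).locallyIntegrable] with t ht htmem
  refine ⟨hf.mono_set (Icc_subset_Icc htmem.1 le_rfl), (ht.comp
    ((Real.tendsto_Icc_vitaliFamily_right t).comp (tendsto_add_nhdsGT t))).congr' ?_⟩
  filter_upwards [eventually_add_mem_Icc htmem.2] with ε hε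
  have hsub : Icc t (t + ε) ⊆ Icc a T := Icc_subset_Icc htmem.1 hε.2.2
  rw [Function.comp_apply, Function.comp_apply, setAverage_eq, measureReal_def, Real.volume_Icc,
    add_sub_cancel_left, ENNReal.toReal_ofReal hε.1.le, integral_Icc_eq_integral_Ioc,
    ← intervalIntegral.integral_of_le hε.2.1, smul_eq_mul]
  refine congrArg _ (intervalIntegral_congr_Icc (fun s hs => ?_) (left_mem_Icc.2 hε.2.1)
    (right_mem_Icc.2 hε.2.1))
  simp only [indicator_of_mem (hsub hs), indicator_of_mem (hsub (left_mem_Icc.2 hε.2.1))]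

namespace IsRightLebesguePoint

variable {F G : Type*} [NormedSpace ℝ E] [NormedAddCommGroup F] [NormedSpace ℝ F]
  [NormedAddCommGroup G] [NormedSpace ℝ G] {f g : ℝ → E}

theorem tendsto_mean (h : IsRightLebesguePoint t T f) (htT : t < T) [CompleteSpace E] :
    Tendsto (fun ε => ε⁻¹ • ∫ s in t..t + ε, f s) (𝓝[>] 0) (𝓝 (f t)) := by
  refine tendsto_iff_norm_sub_tendsto_zero.2
    (squeeze_zero' (Eventually.of_forall fun _ => norm_nonneg _) ?_ h.tendsto_mean_norm_sub)
  filter_upwards [eventually_add_mem_Icc htT] with ε hε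
  have mean_sub : ε⁻¹ • (∫ s in t..t + ε, f s) - f t = ε⁻¹ • ∫ s in t..t + ε, (f s - f t) := by
    rw [intervalIntegral.integral_sub (intervalIntegrable_of_integrableOn_Icc h.1
      (left_mem_Icc.2 htT.le) hε.2) intervalIntegrable_const, intervalIntegral.integral_const,
      add_sub_cancel_left, smul_sub, inv_smul_smul₀ hε.1.ne']
  rw [mean_sub, norm_smul, norm_inv, Real.norm_of_nonneg hε.1.le]
  exact mul_le_mul_of_nonneg_left (intervalIntegral.norm_integral_le_integral_norm hε.2.1)
    (inv_nonneg.2 hε.1.le)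

theorem clm_comp (h : IsRightLebesguePoint t T f) (htT : t < T) (L : E →L[ℝ] F) :
    IsRightLebesguePoint t T fun s => L (f s) := by
  refine of_norm_sub_le htT (L.integrable_comp h.1)
    (h := fun s => ‖L‖ * ‖f s - f t‖) ((h.1.sub (integrable_const _)).norm.const_mul ‖L‖)
    (fun s => by simpa only [map_sub] using L.le_opNorm (f s - f t)) ?_
  simpa [mul_left_comm] using h.2.const_mul ‖L‖

theorem const_smul (h : IsRightLebesguePoint t T f) (htT : t < T) (c : ℝ) :
    IsRightLebesguePoint t T fun s => c • f s :=
  h.clm_comp htT (c • ContinuousLinearMap.id ℝ E)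

theorem sub (h : IsRightLebesguePoint t T f) (k : IsRightLebesguePoint t T g) (htT : t < T) :
    IsRightLebesguePoint t T fun s => f s - g s := by
  simpa only [neg_one_smul, ← sub_eq_add_neg] using h.add (k.const_smul htT (-1)) htT

theorem bilin_of_zero (htT : t < T) (L : E →L[ℝ] F →L[ℝ] G) (hf : ContinuousOn f (Icc t T))
    (hf0 : f t = 0) {g : ℝ → F} (hg : IntegrableOn g (Icc t T)) {C : ℝ}
    (hC : ∀ᶠ ε in 𝓝[>] 0, ε⁻¹ * ∫ s in t..t + ε, ‖g s‖ ≤ C) :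
    IsRightLebesguePoint t T fun s => L (f s) (g s) := by
  have hc : ContinuousOn (fun s => ‖L‖ * ‖f s‖) (Icc t T) := continuousOn_const.mul hf.norm
  refine of_norm_sub_le htT (continuousOn_bilin_integrableOn L hf hg)
    (IntegrableOn.continuousOn_mul hc hg.norm isCompact_Icc) (fun s => ?_)
    (tendsto_mean_mul_of_zero htT hc (by simp [hf0]) hg.norm (fun _ => norm_nonneg _) hC)
  simpa [hf0] using L.le_opNorm₂ (f s) (g s)

theorem bilin {g : ℝ → F} (hg : IsRightLebesguePoint t T g) (htT : t < T)
    (L : E →L[ℝ] F →L[ℝ] G) (hf : ContinuousOn f (Icc t T)) :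
    IsRightLebesguePoint t T fun s => L (f s) (g s) := by
  have vanishing := bilin_of_zero htT L (hf.sub continuousOn_const) (sub_self (f t))
    hg.integrableOn (hg.eventually_mean_norm_le htT)
  simpa using vanishing.add (hg.clm_comp htT (L (f t))) htT

theorem of_continuousOn (htT : t < T) (hf : ContinuousOn f (Icc t T)) :
    IsRightLebesguePoint t T f := by
  simpa using (const htT (1 : ℝ)).bilin htT (ContinuousLinearMap.lsmul ℝ ℝ).flip hf

end IsRightLebesguePoint

end RightLebesguePoint

theorem liminf_coe_ereal_of_tendsto {α : Type*} {l : Filter α} [l.NeBot] {g : α → ℝ} {c : ℝ}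
    (h : Tendsto g l (𝓝 c)) : liminf (fun a => (g a : EReal)) l = c :=
  ((continuous_coe_real_ereal.tendsto c).comp h).liminf_eq

theorem eq_zero_of_forall_quadratic_nonneg {κ l : Type*} [Fintype κ] [Fintype l]
    {C : Matrix κ κ ℝ} {E : Matrix κ l ℝ}
    (h : ∀ (x : l → ℝ) (w : κ → ℝ), 0 ≤ (C *ᵥ w) ⬝ᵥ w + 2 * ((E *ᵥ x) ⬝ᵥ w)) : E = 0 := by
  refine Matrix.ext_iff_mulVec.2 fun x => ?_
  have discrim_nonpos := discrim_le_zero (a := (C *ᵥ (E *ᵥ x)) ⬝ᵥ (E *ᵥ x))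
    (b := 2 * ((E *ᵥ x) ⬝ᵥ (E *ᵥ x))) (c := 0) fun r => by
      have := h x (r • (E *ᵥ x))
      simp only [Matrix.mulVec_smul, smul_dotProduct, dotProduct_smul, smul_eq_mul] at this
      linarith
  rw [Matrix.zero_mulVec]
  rw [discrim, mul_zero, sub_zero] at discrim_nonpos
  refine dotProduct_self_eq_zero.1 ?_
  linarith [pow_eq_zero_iff two_ne_zero |>.1 (discrim_nonpos.antisymm (sq_nonneg _))]

namespace IsRightLebesguePoint

variable {k l : Type*} [Fintype k] [Fintype l] {t T : ℝ}

theorem mulVec_dotProduct_of_zero (htT : t < T) {N : ℝ → Matrix k l ℝ}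
    {a : ℝ → l → ℝ} {b : ℝ → k → ℝ}
    (hN : ContinuousOn N (Icc t T)) (hN0 : N t = 0)
    (ha : MemLp a ⊤ (volume.restrict (Icc t T))) (hb : MemLp b ⊤ (volume.restrict (Icc t T))) :
    IsRightLebesguePoint t T fun s => (N s *ᵥ a s) ⬝ᵥ b s := by
  have form : MemLp (fun s => (dotProductCLM k).flip (b s) ∘L (matrixMulVecCLM k l).flip (a s)) ⊤
      (volume.restrict (Icc t T)) :=
    (ContinuousLinearMap.compL ℝ _ _ _).memLp_of_bilin ⊤
      ((dotProductCLM k).flip.comp_memLp' hb) ((matrixMulVecCLM k l).flip.comp_memLp' ha)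
  exact .bilin_of_zero htT (ContinuousLinearMap.id ℝ (Matrix k l ℝ →L[ℝ] ℝ)).flip hN hN0
    (memLp_one_iff_integrable.1 (form.mono_exponent le_top))
    (eventually_mean_norm_le_of_memLp_top htT form)

theorem dotProduct_mulVec
    {x : ℝ → k → ℝ} {K : ℝ → Matrix k l ℝ} {y : ℝ → l → ℝ} (hK : IsRightLebesguePoint t T K)
    (htT : t < T) (hx : ContinuousOn x (Icc t T)) (hy : ContinuousOn y (Icc t T)) :
    IsRightLebesguePoint t T fun s => x s ⬝ᵥ (K s *ᵥ y s) :=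
  (hK.bilin htT (matrixMulVecCLM k l).flip hy).bilin htT (dotProductCLM k) hx

end IsRightLebesguePoint

/-! ### The equilibrium Riccati equation -/

namespace LQProblem

variable {n m : ℕ} {D : LQProblem n m}

section Riccati

variable {F Ψ Y P : ℝ → Matrix (Fin n) (Fin n) ℝ} {Φ : ℝ → ℝ → Matrix (Fin n) (Fin n) ℝ}

theorem IsTransition.eq_mul (hF : IntegrableOn F (Icc 0 D.T)) (hf : IsFundamental 0 D.T F Ψ Y)
    (hΦ : D.IsTransition F Φ) {t s : ℝ} (ht : t ∈ Icc 0 D.T) (hs : s ∈ Icc 0 D.T) :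
    Φ t s = Ψ t * Y s := by
  obtain ⟨hcont, hint⟩ := hΦ s hs
  have hFΦ : IntegrableOn (fun r => F r * Φ r s) (Icc 0 D.T) :=
    integrableOn_bilin_continuousOn (matrixMulCLM _ _ _) hF hcont
  have prim : HasIntegralDerivOn 0 D.T (fun r => Φ r s) fun r => F r * Φ r s :=
    .of_base (c := 1) hFΦ hs fun r hr => (hint r hr).trans (congrArg _
      (matIntegral_eq_intervalIntegral (intervalIntegrable_of_integrableOn_Icc hFΦ hs hr)))
  have initial : Φ s s = 1 := by
    rw [hint s hs, matIntegral_eq_intervalIntegral .refl, intervalIntegral.integral_same, add_zero]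
  rw [hf.matrix_eq prim hs ht, initial, Matrix.mul_one]

theorem isTransition_of_isFundamental (hf : IsFundamental 0 D.T F Ψ Y) :
    D.IsTransition F fun t s => Ψ t * Y s := by
  intro s hs
  have prim : HasIntegralDerivOn 0 D.T (fun t => Ψ t * Y s) fun t => F t * (Ψ t * Y s) :=
    (hf.prim.matrix_mul (.const (Y s))).congr_on (fun _ _ => rfl)
      fun t _ => by simp [Matrix.mul_assoc]
  refine ⟨prim.continuousOn, fun t ht => ?_⟩
  rw [matIntegral_eq_intervalIntegral (intervalIntegrable_of_integrableOn_Icc prim.1 hs ht),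
    ← prim.sub_eq hs ht, hf.mul_inv s hs, add_sub_cancel]

theorem value_congr_ae {Υ Υ' : ℝ → Matrix (Fin m) (Fin n) ℝ} (t : ℝ) {s : ℝ}
    (hs : s ∈ Icc 0 D.T) (hΥ : Υ =ᵐ[volume.restrict (Icc 0 D.T)] Υ') :
    D.value Υ Ψ Y t s = D.value Υ' Ψ Y t s := by
  have integral_eq := intervalIntegral_congr_ae_restrict_Icc
    (f := fun τ => (Ψ τ)ᵀ * D.weight Υ t τ * Ψ τ) (g := fun τ => (Ψ τ)ᵀ * D.weight Υ' t τ * Ψ τ)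
    (hΥ.mono fun τ hτ => by simp only [runWeight, hτ]) hs (right_mem_Icc.2 (hs.1.trans hs.2))
  simp only [value, pulledValue, integral_eq]

variable (hD : D.WeakAssumptions)
include hD

theorem Qbar_eq_nonlocalWeight (hΥ : MemLp (D.Upsilon P) 2 (volume.restrict (Icc 0 D.T)))
    (hΨ : ContinuousOn Ψ (Icc 0 D.T)) {t : ℝ} (ht : t ∈ Icc 0 D.T)
    (hΦ : ∀ s ∈ Icc 0 D.T, Φ s t = Ψ s * Y t) :
    D.Qbar P Φ t = D.nonlocalWeight (D.Upsilon P) Ψ Y t := by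
  have hT := hD.T_mem
  have matIntegral_conj {W : ℝ → Matrix (Fin n) (Fin n) ℝ}
      (hW : IntegrableOn (fun s => (Ψ s)ᵀ * W s * Ψ s) (Icc 0 D.T)) :
      matIntegral (fun s => (Φ s t)ᵀ * W s * Φ s t) t D.T =
        (Y t)ᵀ * (∫ s in t..D.T, (Ψ s)ᵀ * W s * Ψ s) * Y t := by
    have conj_eq : EqOn (fun s => (Y t)ᵀ * ((Ψ s)ᵀ * W s * Ψ s) * Y t)
        (fun s => (Φ s t)ᵀ * W s * Φ s t) (Icc 0 D.T) := fun s hs => by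
      simp only [hΦ s hs, Matrix.transpose_mul, Matrix.mul_assoc]
    have conj_int := (continuousOn_bilin_integrableOn (matrixMulCLM _ _ _)
      (continuousOn_const (c := (Y t)ᵀ)) hW)
    have conj_int' : IntegrableOn (fun s => (Φ s t)ᵀ * W s * Φ s t) (Icc 0 D.T) :=
      (integrableOn_bilin_continuousOn (matrixMulCLM _ _ _) conj_int
        (continuousOn_const (c := Y t))).congr_fun conj_eq measurableSet_Icc
    rw [matIntegral_eq_intervalIntegral (intervalIntegrable_of_integrableOn_Icc conj_int' ht hT),
      ← intervalIntegral_congr_Icc conj_eq ht hT,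
      intervalIntegral_mul_mul (intervalIntegrable_of_integrableOn_Icc hW ht hT)]
  have hQ := (hD.isKernel_Q hΨ).slice_deriv t ht
  have hM := (hD.isKernel_feedback hΥ hΨ).slice_deriv t ht
  rw [Qbar, matIntegral_conj hQ, matIntegral_conj hM, nonlocalWeight, pulledValueDeriv]
  simp only [runWeight, Matrix.mul_add, Matrix.add_mul]
  rw [intervalIntegral.integral_add (intervalIntegrable_of_integrableOn_Icc hQ ht hT)
    (intervalIntegrable_of_integrableOn_Icc hM ht hT)]
  simp only [Matrix.mul_add, Matrix.add_mul, hΦ _ hT, Matrix.transpose_mul, Matrix.mul_assoc]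
  abel

theorem M_mul_Upsilon (P : ℝ → Matrix (Fin n) (Fin n) ℝ) {s : ℝ} (hs : s ∈ Icc 0 D.T) :
    D.M s s * D.Upsilon P s = (D.B s)ᵀ * P s + D.S s s := by
  rw [Upsilon, ← Matrix.mul_assoc, hD.M_mul_Minv hs, Matrix.one_mul]

/-- The equilibrium Riccati equation is the Lyapunov equation of its own feedback. -/
theorem riccati_eq_lyapunov (P : ℝ → Matrix (Fin n) (Fin n) ℝ) (W : Matrix (Fin n) (Fin n) ℝ)
    {s : ℝ} (hs : s ∈ Icc 0 D.T) :
    (D.A s)ᵀ * P s + P s * D.A s + W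
        - (P s * D.B s + (D.S s s)ᵀ) * D.Minv s * ((D.B s)ᵀ * P s + D.S s s) =
      (D.A s - D.B s * D.Upsilon P s)ᵀ * P s + P s * (D.A s - D.B s * D.Upsilon P s)
        + (D.weight (D.Upsilon P) s s - D.Q s s + W) := by
  have hΥ : D.Minv s * ((D.B s)ᵀ * P s + D.S s s) = D.Upsilon P s := rfl
  rw [Matrix.mul_assoc _ (D.Minv s), hΥ]
  simp only [weight, runWeight, Matrix.mul_assoc _ (D.M s s), M_mul_Upsilon hD P hs,
    Matrix.transpose_sub, Matrix.transpose_mul, Matrix.mul_add, Matrix.add_mul,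
    Matrix.mul_sub, Matrix.sub_mul, Matrix.mul_assoc]
  abel

theorem memLp_Upsilon (hP : ContinuousOn P (Icc 0 D.T)) :
    MemLp (D.Upsilon P) ⊤ (volume.restrict (Icc 0 D.T)) := by
  have hBP : MemLp (fun s => (D.B s)ᵀ * P s) ⊤ (volume.restrict (Icc 0 D.T)) :=
    memLp_matrix_mul (memLp_matrix_transpose hD.B_memLp) (memLp_top_of_continuousOn_Icc hP)
  exact memLp_matrix_mul (memLp_top_of_continuousOn_Icc hD.continuousOn_Minv)
    (hBP.add (memLp_top_of_continuousOn_Icc hD.S_C1.continuousOn_diag))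

theorem integrableOn_riccati {W : ℝ → Matrix (Fin n) (Fin n) ℝ}
    (hP : ContinuousOn P (Icc 0 D.T)) (hW : IntegrableOn W (Icc 0 D.T)) :
    IntegrableOn (fun s => (D.A s)ᵀ * P s + P s * D.A s + W s
      - (P s * D.B s + (D.S s s)ᵀ) * D.Minv s * ((D.B s)ᵀ * P s + D.S s s)) (Icc 0 D.T) := by
  have hP_top := memLp_top_of_continuousOn_Icc hP
  have hS := memLp_top_of_continuousOn_Icc hD.S_C1.continuousOn_diag
  have AP : IntegrableOn (fun s => (D.A s)ᵀ * P s) (Icc 0 D.T) :=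
    integrableOn_bilin_continuousOn (matrixMulCLM _ _ _)
      ((matrixTransposeCLM _ _).integrable_comp hD.A_integrableOn) hP
  have PA : IntegrableOn (fun s => P s * D.A s) (Icc 0 D.T) :=
    continuousOn_bilin_integrableOn (matrixMulCLM _ _ _) hP hD.A_integrableOn
  have PB : MemLp (fun s => P s * D.B s + (D.S s s)ᵀ) ⊤ (volume.restrict (Icc 0 D.T)) :=
    (memLp_matrix_mul hP_top hD.B_memLp).add (memLp_matrix_transpose hS)
  have product : MemLp (fun s => (P s * D.B s + (D.S s s)ᵀ) * D.Upsilon P s) ⊤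
      (volume.restrict (Icc 0 D.T)) := memLp_matrix_mul PB (memLp_Upsilon hD hP)
  refine (((AP.add PA).add hW).sub (memLp_one_iff_integrable.1
    (product.mono_exponent le_top))).congr (.of_forall fun s => ?_)
  simp only [Upsilon, Matrix.mul_assoc, Pi.add_apply, Pi.sub_apply]

theorem isRiccatiSolution_of_value_eq (hP : ContinuousOn P (Icc 0 D.T))
    (hf : IsFundamental 0 D.T (fun s => D.A s - D.B s * D.Upsilon P s) Ψ Y)
    (h : ∀ s ∈ Icc 0 D.T, D.value (D.Upsilon P) Ψ Y s s = P s) : D.IsRiccatiSolution P := by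
  have hΥ := (memLp_Upsilon hD hP).mono_exponent (p := 2) le_top
  have hΨ := hf.prim.continuousOn
  have riccati_deriv : HasIntegralDerivOn 0 D.T P fun s => -((D.A s)ᵀ * P s + P s * D.A s
      + D.Qbar P (fun r s => Ψ r * Y s) s
      - (P s * D.B s + (D.S s s)ᵀ) * D.Minv s * ((D.B s)ᵀ * P s + D.S s s)) :=
    (hD.value_diag_hasIntegralDerivOn hΥ hf).congr_on (fun s hs => (h s hs).symm) fun s hs => by
      beta_reduce
      rw [riccati_eq_lyapunov hD P _ hs, Qbar_eq_nonlocalWeight hD hΥ hΨ hs fun _ _ => rfl, h s hs]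
  have integrand_int := riccati_deriv.1.neg
  rw [Pi.neg_def] at integrand_int
  simp only [neg_neg] at integrand_int
  refine ⟨hP, fun t ht => h t ht ▸ hD.value_symm hΥ hΨ ht ht, fun r s => Ψ r * Y s,
    isTransition_of_isFundamental hf, fun t ht => ?_⟩
  rw [matIntegral_eq_intervalIntegral (intervalIntegrable_of_integrableOn_Icc integrand_int ht
    hD.T_mem), riccati_deriv.eq_terminal ht, ← h D.T hD.T_mem, hD.value_terminal hf]

variable (hP : D.IsRiccatiSolution P)
  (hf : IsFundamental 0 D.T (fun s => D.A s - D.B s * D.Upsilon P s) Ψ Y)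
include hP hf

theorem IsRiccatiSolution.hasIntegralDerivOn :
    HasIntegralDerivOn 0 D.T P fun s => -((D.A s - D.B s * D.Upsilon P s)ᵀ * P s
      + P s * (D.A s - D.B s * D.Upsilon P s) + (D.weight (D.Upsilon P) s s - D.Q s s
        + D.nonlocalWeight (D.Upsilon P) Ψ Y s)) := by
  obtain ⟨hPc, -, Φ, hΦ, riccati⟩ := hP
  have hΥ := (memLp_Upsilon hD hPc).mono_exponent (p := 2) le_top
  have Qbar_eq : EqOn (D.nonlocalWeight (D.Upsilon P) Ψ Y) (D.Qbar P Φ) (Icc 0 D.T) :=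
    fun t ht => (Qbar_eq_nonlocalWeight hD hΥ hf.prim.continuousOn ht fun s hs =>
      hΦ.eq_mul (hD.integrableOn_closedLoop hΥ) hf hs ht).symm
  have riccati_int := integrableOn_riccati hD hPc ((hD.nonlocalWeight_integrableOn hΥ
    hf.prim.continuousOn hf.prim_inv.continuousOn).congr_fun Qbar_eq measurableSet_Icc)
  have prim := HasIntegralDerivOn.of_terminal riccati_int fun t ht => (riccati t ht).trans
    (congrArg _ (matIntegral_eq_intervalIntegral
      (intervalIntegrable_of_integrableOn_Icc riccati_int ht hD.T_mem)))
  refine prim.congr_on (fun _ _ => rfl) fun s hs => ?_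
  rw [← riccati_eq_lyapunov hD P _ hs, Qbar_eq hs]

theorem IsRiccatiSolution.value_eq {s : ℝ} (hs : s ∈ Icc 0 D.T) :
    D.value (D.Upsilon P) Ψ Y s s = P s := by
  have hΥ := (memLp_Upsilon hD hP.1).mono_exponent (p := 2) le_top
  refine hf.lyapunov_unique (hD.value_diag_hasIntegralDerivOn hΥ hf)
    (hP.hasIntegralDerivOn hD hf) ?_ hs
  obtain ⟨-, -, Φ, -, riccati⟩ := hP
  rw [hD.value_terminal hf, riccati D.T hD.T_mem, matIntegral_eq_intervalIntegral .refl,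
    intervalIntegral.integral_same, add_zero]

end Riccati

/-! ### Spike perturbations of a linear feedback -/

section Equilibrium

variable {Υ : ℝ → Matrix (Fin m) (Fin n) ℝ} {Ψ Y P : ℝ → Matrix (Fin n) (Fin n) ℝ}
  {ub : ℝ → (Fin n → ℝ) → Fin m → ℝ} {t : ℝ}

theorem eventually_J_perturb_quotient_eq (hD : D.WeakAssumptions)
    (hΥ : MemLp Υ 2 (volume.restrict (Icc 0 D.T)))
    (hf : IsFundamental 0 D.T (fun s => D.A s - D.B s * Υ s) Ψ Y)
    (hub : ∀ s ∈ Icc 0 D.T, ∀ y, ub s y = -(Υ s *ᵥ y)) (ht : t ∈ Ico 0 D.T) {v : Fin m → ℝ}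
    {X : ℝ → Fin n → ℝ} (hX : HasIntegralDerivOn t D.T X fun s => D.A s *ᵥ X s + D.B s *ᵥ v) :
    ∀ᶠ ε in 𝓝[>] 0, (D.J t (X t) (perturb ub t ε v) - D.J t (X t) ub) / ε =
      ε⁻¹ * ∫ s in t..t + ε, D.excess Υ (D.value Υ Ψ Y t s) t s (X s) v := by
  filter_upwards [eventually_add_mem_Icc ht.2] with ε hε
  rw [J_perturb_sub hD (Ico_subset_Icc_self ht) hΥ hf hub hε.1.le hε.2.2 hX, div_eq_inv_mul]

theorem excess_riccati_split (hD : D.WeakAssumptions) {s : ℝ} (hs : s ∈ Icc 0 D.T)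
    (W : Matrix (Fin n) (Fin n) ℝ) (x : Fin n → ℝ) (v : Fin m → ℝ) :
    D.excess (D.Upsilon P) W t s x v =
      (D.M s s *ᵥ (v + D.Upsilon P s *ᵥ x)) ⬝ᵥ (v + D.Upsilon P s *ᵥ x)
      + (((D.M t s - D.M s s) *ᵥ (v - D.Upsilon P s *ᵥ x)) ⬝ᵥ (v + D.Upsilon P s *ᵥ x)
        + (2 : ℝ) • (((D.S t s - D.S s s) *ᵥ x) ⬝ᵥ (v + D.Upsilon P s *ᵥ x)
          + ((W - P s) *ᵥ x) ⬝ᵥ (D.B s *ᵥ (v + D.Upsilon P s *ᵥ x)))) := by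
  have bracket : D.S t s + (D.B s)ᵀ * W - D.M t s * D.Upsilon P s =
      (D.S t s - D.S s s) + (D.B s)ᵀ * (W - P s) - (D.M t s - D.M s s) * D.Upsilon P s := by
    rw [Matrix.sub_mul, M_mul_Upsilon hD P hs, Matrix.mul_sub]
    abel
  rw [excess, bracket]
  simp only [Matrix.sub_mulVec, Matrix.add_mulVec, Matrix.mulVec_sub, Matrix.mulVec_add,
    ← Matrix.mulVec_mulVec, sub_dotProduct, add_dotProduct, transpose_mulVec_dotProduct,
    dotProduct_add, smul_eq_mul]
  ring

/-- The part of the excess that is not a square vanishes at `s = t` because the value matrix is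
`P t` there, and it is a product of a continuous and bounded factors. -/
theorem IsRiccatiSolution.isRightLebesguePoint_remainder (hD : D.WeakAssumptions)
    (hP : D.IsRiccatiSolution P)
    (hf : IsFundamental 0 D.T (fun s => D.A s - D.B s * D.Upsilon P s) Ψ Y)
    (ht : t ∈ Ico 0 D.T) {X : ℝ → Fin n → ℝ} (hX : ContinuousOn X (Icc t D.T)) (v : Fin m → ℝ) :
    IsRightLebesguePoint t D.T fun s =>
      ((D.M t s - D.M s s) *ᵥ (v - D.Upsilon P s *ᵥ X s)) ⬝ᵥ (v + D.Upsilon P s *ᵥ X s)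
        + (2 : ℝ) • (((D.S t s - D.S s s) *ᵥ X s) ⬝ᵥ (v + D.Upsilon P s *ᵥ X s)
          + ((D.value (D.Upsilon P) Ψ Y t s - P s) *ᵥ X s) ⬝ᵥ
            (D.B s *ᵥ (v + D.Upsilon P s *ᵥ X s))) := by
  have ht' := Ico_subset_Icc_self ht
  have hsub : Icc t D.T ⊆ Icc 0 D.T := Icc_subset_Icc_left ht.1
  have hΥ := memLp_Upsilon hD hP.1
  have hX_top := memLp_top_of_continuousOn_Icc hX
  have hv : MemLp (fun _ => v) ⊤ (volume.restrict (Icc t D.T)) :=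
    memLp_top_of_continuousOn_Icc continuousOn_const
  have hΥX : MemLp (fun s => D.Upsilon P s *ᵥ X s) ⊤ (volume.restrict (Icc t D.T)) :=
    memLp_matrix_mulVec (memLp_Icc_mono hΥ ht.1 le_rfl) hX_top
  have hBw : MemLp (fun s => D.B s *ᵥ (v + D.Upsilon P s *ᵥ X s)) ⊤
      (volume.restrict (Icc t D.T)) :=
    memLp_matrix_mulVec (memLp_Icc_mono hD.B_memLp ht.1 le_rfl) (hv.add hΥX)
  have hM : ContinuousOn (fun s => D.M t s - D.M s s) (Icc t D.T) :=
    ((hD.M_C1.continuousOn_slice ht').sub hD.M_C1.continuousOn_diag).mono hsub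
  have hS : ContinuousOn (fun s => D.S t s - D.S s s) (Icc t D.T) :=
    ((hD.S_C1.continuousOn_slice ht').sub hD.S_C1.continuousOn_diag).mono hsub
  have hV : ContinuousOn (fun s => D.value (D.Upsilon P) Ψ Y t s - P s) (Icc t D.T) :=
    ((hD.value_hasIntegralDerivOn (hΥ.mono_exponent le_top) hf ht').continuousOn.sub hP.1).mono
      hsub
  refine (IsRightLebesguePoint.mulVec_dotProduct_of_zero ht.2 hM (sub_self _)
    (hv.sub hΥX) (hv.add hΥX)).add (.const_smul (.add ?_ ?_ ht.2) ht.2 2) ht.2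
  · exact .mulVec_dotProduct_of_zero ht.2 hS (sub_self _) hX_top (hv.add hΥX)
  · exact .mulVec_dotProduct_of_zero ht.2 hV
      (sub_eq_zero.2 (hP.value_eq hD hf ht')) hX_top hBw

theorem IsRiccatiSolution.liminf_nonneg (hD : D.WeakAssumptions) (hP : D.IsRiccatiSolution P)
    (ht : t ∈ Ico 0 D.T) (x : Fin n → ℝ) (v : Fin m → ℝ) :
    0 ≤ liminf (fun ε : ℝ => (((D.J t x (perturb (D.riccatiFeedback P) t ε v)
      - D.J t x (D.riccatiFeedback P)) / ε : ℝ) : EReal)) (𝓝[>] 0) := by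
  have ht' := Ico_subset_Icc_self ht
  have hΥ := (memLp_Upsilon hD hP.1).mono_exponent (p := 2) le_top
  obtain ⟨Ψ, Y, hf, -⟩ := exists_isFundamental hD.T_pos.le (hD.integrableOn_closedLoop hΥ)
  obtain ⟨X, hX, rfl⟩ := exists_state_const hD ht' x v
  have remainder := hP.isRightLebesguePoint_remainder hD hf ht hX.continuousOn v
  have mean_limit := remainder.tendsto_mean ht.2
  simp only [sub_self, hP.value_eq hD hf ht', Matrix.zero_mulVec, zero_dotProduct, add_zero,
    smul_eq_mul, mul_zero] at mean_limit
  have hu : MemLp (fun _ => v) 2 (volume.restrict (Icc t D.T)) := memLp_const v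
  have excess_int := (integrableOn_excess_and_cost_eq hD ht' hΥ hf hu hX).1
  rw [← EReal.coe_zero, ← liminf_coe_ereal_of_tendsto mean_limit]
  refine liminf_le_liminf ?_
  filter_upwards [eventually_add_mem_Icc ht.2, eventually_J_perturb_quotient_eq hD hΥ hf
    (ub := D.riccatiFeedback P) (fun _ _ _ => rfl) ht hX] with ε hε quotient_eq
  rw [quotient_eq, EReal.coe_le_coe_iff]
  refine mean_le_mean remainder.integrableOn excess_int ?_ hε
  filter_upwards [ae_restrict_mem measurableSet_Icc] with s hs
  have hs' := Icc_subset_Icc_left ht.1 hs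
  have square_nonneg := (hD.M_posDef s hs').posSemidef.dotProduct_mulVec_nonneg
    (v + D.Upsilon P s *ᵥ X s)
  rw [star_trivial, dotProduct_comm] at square_nonneg
  rw [excess_riccati_split hD hs']
  exact le_add_of_nonneg_left square_nonneg

theorem riccatiFeedback_aemeasurable (hD : D.WeakAssumptions) (hP : ContinuousOn P (Icc 0 D.T)) :
    AEMeasurable (fun p : ℝ × (Fin n → ℝ) => D.riccatiFeedback P p.1 p.2)
      (volume.restrict (Icc 0 D.T ×ˢ univ)) := by
  rw [Measure.volume_eq_prod, ← Measure.prod_restrict, Measure.restrict_univ]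
  have gain (i : Fin m) (j : Fin n) : AEMeasurable
      (fun p : ℝ × (Fin n → ℝ) => D.Upsilon P p.1 i j)
      ((volume.restrict (Icc 0 D.T)).prod volume) :=
    ((memLp_matrix_iff.1 (memLp_Upsilon hD hP) i j).1.aemeasurable).comp_quasiMeasurePreserving
      Measure.quasiMeasurePreserving_fst
  refine aemeasurable_pi_lambda _ fun i => AEMeasurable.neg
    (f := fun p : ℝ × (Fin n → ℝ) => ∑ j, D.Upsilon P p.1 i j * p.2 j) ?_
  exact Finset.aemeasurable_fun_sum _ fun j _ => (gain i j).mul (by fun_prop)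

theorem IsRiccatiSolution.isLinearEquilibrium (hD : D.WeakAssumptions)
    (hP : D.IsRiccatiSolution P) : D.IsLinearEquilibrium (D.riccatiFeedback P) := by
  have hΥ := (memLp_Upsilon hD hP.1).mono_exponent (p := 2) le_top
  refine ⟨⟨riccatiFeedback_aemeasurable hD hP.1, fun X hX => ?_, fun t ht x => ?_,
    fun t ht => hP.liminf_nonneg hD ht⟩, fun t => -D.Upsilon P t, fun t _ x => ?_⟩
  · exact (memLp_matrix_mulVec (r := 2) hΥ (memLp_top_of_continuousOn_Icc hX)).neg
  · exact exists_isClosedLoop hD (Ico_subset_Icc_self ht)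
      (isAffineFeedback_linear (Ico_subset_Icc_self ht) hΥ fun _ _ _ => rfl) x
  · rw [Matrix.neg_mulVec, riccatiFeedback, Upsilon]

end Equilibrium

section FirstOrderCondition

variable {Υ : ℝ → Matrix (Fin m) (Fin n) ℝ} {Ψ Y P : ℝ → Matrix (Fin n) (Fin n) ℝ}
  {ub : ℝ → (Fin n → ℝ) → Fin m → ℝ} {t : ℝ}

theorem excess_expand {W : Matrix (Fin n) (Fin n) ℝ} {s : ℝ} (hM : (D.M t s).IsSymm)
    (x : Fin n → ℝ) (v : Fin m → ℝ) :
    D.excess Υ W t s x v =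
      ((D.M t s *ᵥ v) ⬝ᵥ v + (2 : ℝ) • ((D.S t s *ᵥ x) ⬝ᵥ v))
      + (2 : ℝ) • ((D.S t s *ᵥ x) ⬝ᵥ (Υ s *ᵥ x) + (W *ᵥ x) ⬝ᵥ (D.B s *ᵥ v)
        + (W *ᵥ x) ⬝ᵥ ((D.B s * Υ s) *ᵥ x))
      - x ⬝ᵥ (((Υ s)ᵀ * D.M t s * Υ s) *ᵥ x) := by
  simp only [excess, Matrix.add_mulVec, Matrix.sub_mulVec, Matrix.mulVec_add,
    ← Matrix.mulVec_mulVec, add_dotProduct, sub_dotProduct, dotProduct_add,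
    transpose_mulVec_dotProduct, smul_eq_mul]
  rw [mulVec_dotProduct_swap hM v (Υ s *ᵥ x), dotProduct_comm x, transpose_mulVec_dotProduct]
  ring

theorem isRightLebesguePoint_excess (hD : D.WeakAssumptions)
    (hΥ : MemLp Υ 2 (volume.restrict (Icc 0 D.T)))
    (hf : IsFundamental 0 D.T (fun s => D.A s - D.B s * Υ s) Ψ Y) (ht : t ∈ Ico 0 D.T)
    (gain : IsRightLebesguePoint t D.T Υ) (input : IsRightLebesguePoint t D.T D.B)
    (input_gain : IsRightLebesguePoint t D.T fun s => D.B s * Υ s)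
    (conj : IsRightLebesguePoint t D.T fun s =>
      (matrixMulCLM (Fin n) (Fin m) (Fin n)).flip (Υ s) ∘L matrixMulCLM _ _ _ (Υ s)ᵀ)
    {X : ℝ → Fin n → ℝ} (hX : ContinuousOn X (Icc t D.T)) (v : Fin m → ℝ) :
    IsRightLebesguePoint t D.T fun s => D.excess Υ (D.value Υ Ψ Y t s) t s (X s) v := by
  have ht' := Ico_subset_Icc_self ht
  have hsub : Icc t D.T ⊆ Icc 0 D.T := Icc_subset_Icc_left ht.1
  have hv : ContinuousOn (fun _ => v) (Icc t D.T) := continuousOn_const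
  have hM := (hD.M_C1.continuousOn_slice ht').mono hsub
  have hSX := continuousOn_matrix_mulVec ((hD.S_C1.continuousOn_slice ht').mono hsub) hX
  have hVX := continuousOn_matrix_mulVec
    ((hD.value_hasIntegralDerivOn hΥ hf ht').continuousOn.mono hsub) hX
  have dot {a b : ℝ → Fin m → ℝ} (ha : ContinuousOn a (Icc t D.T))
      (hb : ContinuousOn b (Icc t D.T)) : IsRightLebesguePoint t D.T fun s => a s ⬝ᵥ b s :=
    .bilin (.of_continuousOn ht.2 hb) ht.2 (dotProductCLM _) ha
  have conj_M := conj.bilin ht.2 (ContinuousLinearMap.id ℝ (Matrix (Fin m) (Fin m) ℝ →L[ℝ] _)).flip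
    hM
  have linear := ((gain.dotProduct_mulVec ht.2 hSX hX).add
    (input.dotProduct_mulVec ht.2 hVX hv) ht.2).add (input_gain.dotProduct_mulVec ht.2 hVX hX) ht.2
  exact ((((dot (continuousOn_matrix_mulVec hM hv) hv).add ((dot hSX hv).const_smul ht.2 2)
    ht.2).add (linear.const_smul ht.2 2) ht.2).sub (conj_M.dotProduct_mulVec ht.2 hX hX)
      ht.2).congr_on ht.2 fun s hs => (excess_expand (hD.M_symm t ht' s (hsub hs)) (X s) v).symm

theorem IsLinearEquilibrium.exists_gain (h : D.IsLinearEquilibrium ub) :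
    ∃ Υ : ℝ → Matrix (Fin m) (Fin n) ℝ, MemLp Υ 2 (volume.restrict (Icc 0 D.T)) ∧
      ∀ s ∈ Icc 0 D.T, ∀ y, ub s y = -(Υ s *ᵥ y) := by
  obtain ⟨equilibrium, ut, hut⟩ := h
  refine ⟨-ut, (memLp_matrix_iff.2 fun i j => ?_).neg, fun s hs y => ?_⟩
  · refine ((equilibrium.squareIntegrable (fun _ => Pi.single j 1) continuousOn_const).eval
      i).ae_eq (ae_restrict_Icc_of_eqOn fun s hs => ?_)
    simp only [hut s hs, Matrix.mulVec_single_one, Matrix.col_apply]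
  · rw [hut s hs, Pi.neg_apply, Matrix.neg_mulVec, neg_neg]

theorem IsEquilibrium.excess_nonneg (hD : D.WeakAssumptions) (he : D.IsEquilibrium ub)
    (hΥ : MemLp Υ 2 (volume.restrict (Icc 0 D.T)))
    (hub : ∀ s ∈ Icc 0 D.T, ∀ y, ub s y = -(Υ s *ᵥ y))
    (hf : IsFundamental 0 D.T (fun s => D.A s - D.B s * Υ s) Ψ Y) :
    ∀ᵐ t ∂volume.restrict (Icc 0 D.T), ∀ x v,
      0 ≤ D.excess Υ (D.value Υ Ψ Y t t) t t x v := by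
  have hBΥ : MemLp (fun s => D.B s * Υ s) 2 (volume.restrict (Icc 0 D.T)) :=
    memLp_matrix_mul hD.B_memLp hΥ
  refine (ae_restrict_iff' measurableSet_Icc).2 ?_
  filter_upwards [ae_isRightLebesguePoint (hΥ.integrable one_le_two),
    ae_isRightLebesguePoint (hD.B_memLp.integrable le_top),
    ae_isRightLebesguePoint (hBΥ.integrable one_le_two),
    ae_isRightLebesguePoint (memLp_one_iff_integrable.1 (memLp_matrix_conj hΥ hΥ)),
    Measure.ae_ne volume D.T] with t gain input input_gain conj ne_T ht' x v
  have ht : t ∈ Ico 0 D.T := ⟨ht'.1, ht'.2.lt_of_ne ne_T⟩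
  obtain ⟨X, hX, rfl⟩ := exists_state_const hD ht' x v
  have mean_limit := (isRightLebesguePoint_excess hD hΥ hf ht (gain ht) (input ht) (input_gain ht)
    (conj ht) hX.continuousOn v).tendsto_mean ht.2
  have quotient_eq := eventually_J_perturb_quotient_eq hD hΥ hf hub ht hX
  have liminf_nonneg := he.equilibrium t ht (X t) v
  rw [liminf_coe_ereal_of_tendsto (mean_limit.congr' (quotient_eq.mono fun _ => Eq.symm))]
    at liminf_nonneg
  exact_mod_cast liminf_nonneg

/-- First-order condition: the part of the excess that is linear in the deviation vanishes. -/
theorem IsEquilibrium.gain_ae_eq (hD : D.WeakAssumptions) (he : D.IsEquilibrium ub)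
    (hΥ : MemLp Υ 2 (volume.restrict (Icc 0 D.T)))
    (hub : ∀ s ∈ Icc 0 D.T, ∀ y, ub s y = -(Υ s *ᵥ y))
    (hf : IsFundamental 0 D.T (fun s => D.A s - D.B s * Υ s) Ψ Y) :
    Υ =ᵐ[volume.restrict (Icc 0 D.T)] D.Upsilon fun s => D.value Υ Ψ Y s s := by
  filter_upwards [he.excess_nonneg hD hΥ hub hf, ae_restrict_mem measurableSet_Icc]
    with t excess_nonneg ht
  have bracket_zero : D.S t t + (D.B t)ᵀ * D.value Υ Ψ Y t t - D.M t t * Υ t = 0 :=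
    eq_zero_of_forall_quadratic_nonneg (C := D.M t t) fun x w => by
      simpa [excess] using excess_nonneg x (w - Υ t *ᵥ x)
  rw [Upsilon, add_comm, sub_eq_zero.1 bracket_zero, ← Matrix.mul_assoc, hD.Minv_mul_M ht,
    Matrix.one_mul]

theorem IsLinearEquilibrium.exists_isRiccatiSolution (hD : D.WeakAssumptions)
    (h : D.IsLinearEquilibrium ub) : ∃ P, D.IsRiccatiSolution P := by
  obtain ⟨Υ, hΥ, hub⟩ := h.exists_gain
  obtain ⟨Ψ, Y, hf, -⟩ := exists_isFundamental hD.T_pos.le (hD.integrableOn_closedLoop hΥ)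
  have gain_eq := h.1.gain_ae_eq hD hΥ hub hf
  exact ⟨_, isRiccatiSolution_of_value_eq hD (hD.value_diag_hasIntegralDerivOn hΥ hf).continuousOn
    (hf.congr_ae (gain_eq.mono fun s hs => by simp only [hs]))
    fun s hs => (value_congr_ae s hs gain_eq).symm⟩

end FirstOrderCondition
end LQProblem

theorem hasIntegralDerivOn_pi {ι : Type*} [Fintype ι] {E : ι → Type*}
    [∀ i, NormedAddCommGroup (E i)] [∀ i, NormedSpace ℝ (E i)] [∀ i, CompleteSpace (E i)]
    {a b : ℝ} {f f' : ℝ → ∀ i, E i} :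
    HasIntegralDerivOn a b f f' ↔
      ∀ i, HasIntegralDerivOn a b (fun s => f s i) fun s => f' s i := by
  refine ⟨fun h i => h.clm_comp (ContinuousLinearMap.proj i), fun h => ?_⟩
  have integrable : IntegrableOn f' (Icc a b) := .of_eval fun i => (h i).1
  refine .of_initial (c := f a) integrable fun s hs => funext fun i => ?_
  have eval_integral := (ContinuousLinearMap.proj (R := ℝ) (φ := E) i).intervalIntegral_comp_comm
    (intervalIntegrable_of_integrableOn_Icc integrable (left_mem_Icc.2 (hs.1.trans hs.2)) hs)
  exact ((h i).2 s hs).trans (congrArg (f a i + ·) eval_integral)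

theorem memLp_matrix_fromBlocks {κ l κ' l' Ω : Type*} [Fintype κ] [Fintype l] [Fintype κ']
    [Fintype l'] [MeasurableSpace Ω] {μ : Measure Ω} {p : ℝ≥0∞} {C₁₁ : Ω → Matrix κ l ℝ}
    {C₁₂ : Ω → Matrix κ l' ℝ} {C₂₁ : Ω → Matrix κ' l ℝ} {C₂₂ : Ω → Matrix κ' l' ℝ}
    (h₁₁ : MemLp C₁₁ p μ) (h₁₂ : MemLp C₁₂ p μ) (h₂₁ : MemLp C₂₁ p μ) (h₂₂ : MemLp C₂₂ p μ) :
    MemLp (fun s => Matrix.fromBlocks (C₁₁ s) (C₁₂ s) (C₂₁ s) (C₂₂ s)) p μ := by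
  rw [memLp_matrix_iff] at *
  rintro (i | i) (j | j)
  exacts [h₁₁ i j, h₁₂ i j, h₂₁ i j, h₂₂ i j]

theorem IsFundamental.matrix_inv {ι : Type*} [Fintype ι] [DecidableEq ι] {a b : ℝ}
    {F Ψ Y X : ℝ → Matrix ι ι ℝ} (h : IsFundamental a b F Ψ Y)
    (hX : HasIntegralDerivOn a b X fun s => F s * X s) :
    HasIntegralDerivOn a b (fun s => (X s)⁻¹) fun s => -((X s)⁻¹ * F s) := by
  have inv_eq : EqOn (fun s => (X s)⁻¹) (fun s => (Y a * X a)⁻¹ * Y s) (Icc a b) := fun s hs => by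
    beta_reduce
    rw [h.matrix_eq hX (left_mem_Icc.2 (hs.1.trans hs.2)) hs, Matrix.mul_inv_rev,
      Matrix.inv_eq_right_inv (h.mul_inv s hs)]
  exact ((HasIntegralDerivOn.const _).matrix_mul h.prim_inv).congr_on inv_eq fun s hs => by
    simp [show (X s)⁻¹ = _ from inv_eq hs, Matrix.mul_assoc]

theorem isSymm_eq_of_forall_mulVec_dotProduct_self {κ : Type*} [Fintype κ] {C E : Matrix κ κ ℝ}
    (hC : C.IsSymm) (hE : E.IsSymm) (h : ∀ x, (C *ᵥ x) ⬝ᵥ x = (E *ᵥ x) ⬝ᵥ x) : C = E := by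
  refine Matrix.ext_iff_mulVec.2 fun x => dotProduct_eq _ _ fun y => ?_
  have polar := h (x + y)
  simp only [Matrix.mulVec_add, add_dotProduct, dotProduct_add, h x, h y,
    mulVec_dotProduct_swap hC y x, mulVec_dotProduct_swap hE y x] at polar
  linarith

theorem conj_mulVec_dotProduct {κ l : Type*} [Fintype κ] [Fintype l] (C : Matrix κ l ℝ)
    (W : Matrix κ κ ℝ) (x : l → ℝ) :
    ((Cᵀ * W * C) *ᵥ x) ⬝ᵥ x = (W *ᵥ (C *ᵥ x)) ⬝ᵥ (C *ᵥ x) := by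
  rw [Matrix.mul_assoc, ← Matrix.mulVec_mulVec, ← Matrix.mulVec_mulVec,
    transpose_mulVec_dotProduct]

theorem intervalIntegral_mulVec_dotProduct {κ l : Type*} [Fintype κ] [Fintype l] {c d : ℝ}
    {W : ℝ → Matrix κ l ℝ} (hW : IntervalIntegrable W volume c d) (x : l → ℝ) (y : κ → ℝ) :
    ((∫ τ in c..d, W τ) *ᵥ x) ⬝ᵥ y = ∫ τ in c..d, (W τ *ᵥ x) ⬝ᵥ y :=
  (((dotProductCLM κ).flip y ∘L (matrixMulVecCLM κ l).flip x).intervalIntegral_comp_comm hW).symm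

namespace LQProblem

variable {n m : ℕ} {D : LQProblem n m}

section RiccatiToBVP

variable {Υ : ℝ → Matrix (Fin m) (Fin n) ℝ} {Ψ Y P : ℝ → Matrix (Fin n) (Fin n) ℝ}
  {X φ : ℝ → Fin n → ℝ} {s : ℝ}

theorem nonlocalForm_eq_nonlocalWeight (hD : D.WeakAssumptions)
    (hΥ : MemLp Υ 2 (volume.restrict (Icc 0 D.T))) (hΨ : ContinuousOn Ψ (Icc 0 D.T))
    (hs : s ∈ Icc 0 D.T) (hX : ∀ τ ∈ Icc s D.T, X τ = Ψ τ *ᵥ (Y s *ᵥ X s))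
    (hgain : ∀ τ ∈ Icc s D.T, D.gain X φ τ = Υ τ *ᵥ X τ) :
    D.nonlocalForm X φ s = (D.nonlocalWeight Υ Ψ Y s *ᵥ X s) ⬝ᵥ X s := by
  have hsT : s ∈ Icc s D.T := left_mem_Icc.2 hs.2
  have hT : D.T ∈ Icc s D.T := right_mem_Icc.2 hs.2
  have integral_conj {W : ℝ → Matrix (Fin n) (Fin n) ℝ}
      (hW : IntegrableOn (fun τ => (Ψ τ)ᵀ * W τ * Ψ τ) (Icc 0 D.T)) :
      ((∫ τ in s..D.T, (Ψ τ)ᵀ * W τ * Ψ τ) *ᵥ (Y s *ᵥ X s)) ⬝ᵥ (Y s *ᵥ X s) =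
        ∫ τ in s..D.T, (W τ *ᵥ X τ) ⬝ᵥ X τ := by
    rw [intervalIntegral_mulVec_dotProduct
      (intervalIntegrable_of_integrableOn_Icc hW hs hD.T_mem)]
    refine intervalIntegral_congr_Icc (fun τ hτ => ?_) hsT hT
    rw [conj_mulVec_dotProduct, ← hX τ hτ]
  have hQ := (hD.isKernel_Q hΨ).slice_deriv s hs
  have hM := (hD.isKernel_feedback hΥ hΨ).slice_deriv s hs
  have gain_form : ∀ τ ∈ Icc s D.T,
      (((Υ τ)ᵀ * D.d1 D.M s τ * Υ τ - (Υ τ)ᵀ * D.d1 D.S s τ - (D.d1 D.S s τ)ᵀ * Υ τ) *ᵥ X τ)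
        ⬝ᵥ X τ = (D.d1 D.M s τ *ᵥ D.gain X φ τ - (2 : ℝ) • (D.d1 D.S s τ *ᵥ X τ))
        ⬝ᵥ D.gain X φ τ := fun τ hτ => by
    rw [hgain τ hτ]
    simp only [Matrix.sub_mulVec, ← Matrix.mulVec_mulVec, sub_dotProduct,
      transpose_mulVec_dotProduct, smul_dotProduct, smul_eq_mul]
    rw [dotProduct_comm (Υ τ *ᵥ X τ) (D.d1 D.S s τ *ᵥ X τ)]
    ring
  rw [nonlocalWeight, pulledValueDeriv, Matrix.sub_mulVec, sub_dotProduct, conj_mulVec_dotProduct,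
    Matrix.add_mulVec, add_dotProduct, conj_mulVec_dotProduct, ← hX D.T hT]
  simp only [runWeight, Matrix.mul_add, Matrix.add_mul]
  rw [intervalIntegral.integral_add (intervalIntegrable_of_integrableOn_Icc hQ hs hD.T_mem)
    (intervalIntegrable_of_integrableOn_Icc hM hs hD.T_mem), Matrix.add_mulVec, add_dotProduct,
    integral_conj hQ, integral_conj hM, intervalIntegral_congr_Icc gain_form hsT hT, nonlocalForm]
  ring

theorem gain_eq_Upsilon_mulVec (h : φ s = P s *ᵥ X s) :
    D.gain X φ s = D.Upsilon P s *ᵥ X s := by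
  simp only [gain, Upsilon, h, Matrix.mulVec_mulVec, ← Matrix.add_mulVec]

theorem closedLoop_eq_drift_sub (P : ℝ → Matrix (Fin n) (Fin n) ℝ) (s : ℝ) :
    D.A s - D.B s * D.Upsilon P s = D.drift s - D.B s * D.Minv s * (D.B s)ᵀ * P s := by
  simp only [Upsilon, drift, Matrix.mul_add, Matrix.mul_assoc]
  abel

theorem closedLoop_transpose_mul_add (hD : D.WeakAssumptions)
    (P : ℝ → Matrix (Fin n) (Fin n) ℝ) (W : Matrix (Fin n) (Fin n) ℝ) (hs : s ∈ Icc 0 D.T) :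
    (D.A s - D.B s * D.Upsilon P s)ᵀ * P s + (D.weight (D.Upsilon P) s s - D.Q s s + W) =
      (D.drift s)ᵀ * P s + (W - (D.S s s)ᵀ * D.Minv s * D.S s s) := by
  calc (D.A s - D.B s * D.Upsilon P s)ᵀ * P s + (D.weight (D.Upsilon P) s s - D.Q s s + W)
      = (D.A s)ᵀ * P s + P s * D.A s + W
          - (P s * D.B s + (D.S s s)ᵀ) * D.Minv s * ((D.B s)ᵀ * P s + D.S s s)
          - P s * (D.A s - D.B s * D.Upsilon P s) := by
        rw [riccati_eq_lyapunov hD P W hs]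
        abel
    _ = (D.drift s)ᵀ * P s + (W - (D.S s s)ᵀ * D.Minv s * D.S s s) := by
        simp only [Upsilon, drift, Matrix.transpose_sub, Matrix.transpose_mul,
          (hD.Minv_symm hs).eq, Matrix.mul_add, Matrix.add_mul, Matrix.mul_sub, Matrix.sub_mul,
          Matrix.mul_assoc]
        abel

variable {t : ℝ} {Qh : ℝ → Matrix (Fin n) (Fin n) ℝ}

theorem isBVPSolution_of_hasIntegralDerivOn
    (hX : HasIntegralDerivOn t D.T X fun s =>
      D.drift s *ᵥ X s - (D.B s * D.Minv s * (D.B s)ᵀ) *ᵥ φ s)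
    (hφ : HasIntegralDerivOn t D.T φ fun s =>
      -((D.drift s)ᵀ *ᵥ φ s + (Qh s - (D.S s s)ᵀ * D.Minv s * D.S s s) *ᵥ X s))
    (hφT : φ D.T = D.G D.T *ᵥ X D.T)
    (hQh : ∀ s ∈ Icc t D.T, (Qh s *ᵥ X s) ⬝ᵥ X s = D.nonlocalForm X φ s) :
    D.IsBVPSolution Qh t (X t) X φ where
  continuousOn_X := hX.continuousOn
  continuousOn_φ := hφ.continuousOn
  eq_X := hX.2
  eq_φ _ hs := hφT ▸ hφ.eq_terminal hs
  eq_Qh := hQh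

theorem costate_hasIntegralDerivOn (hD : D.WeakAssumptions) (ht : 0 ≤ t)
    (hP : HasIntegralDerivOn t D.T P fun s => -((D.A s - D.B s * D.Upsilon P s)ᵀ * P s
      + P s * (D.A s - D.B s * D.Upsilon P s) + (D.weight (D.Upsilon P) s s - D.Q s s + Qh s)))
    (hX : HasIntegralDerivOn t D.T X fun s => (D.A s - D.B s * D.Upsilon P s) *ᵥ X s) :
    HasIntegralDerivOn t D.T (fun s => P s *ᵥ X s) fun s => -((D.drift s)ᵀ *ᵥ (P s *ᵥ X s)
      + (Qh s - (D.S s s)ᵀ * D.Minv s * D.S s s) *ᵥ X s) := by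
  refine (hP.matrix_mulVec hX).congr_on (fun _ _ => rfl) fun s hs => ?_
  beta_reduce
  rw [Matrix.mulVec_mulVec, ← Matrix.add_mulVec,
    ← closedLoop_transpose_mul_add hD P _ (Icc_subset_Icc_left ht hs), Matrix.mulVec_mulVec,
    ← Matrix.neg_mulVec, ← Matrix.add_mulVec]
  congr 1
  abel

theorem IsRiccatiSolution.bvpSolvable (hD : D.WeakAssumptions) (hP : D.IsRiccatiSolution P) :
    D.BVPSolvable := by
  have hΥ := (memLp_Upsilon hD hP.1).mono_exponent (p := 2) le_top
  obtain ⟨Ψ, Y, hf, -⟩ := exists_isFundamental hD.T_pos.le (hD.integrableOn_closedLoop hΥ)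
  have hΨ := hf.prim.continuousOn
  have weight_int := hD.nonlocalWeight_integrableOn hΥ hΨ hf.prim_inv.continuousOn
  refine ⟨D.nonlocalWeight (D.Upsilon P) Ψ Y, fun s hs => hD.nonlocalWeight_symm hΥ hΨ hs,
    fun i j => (weight_int.eval i).eval j, fun t ht x => ?_⟩
  have hsub : Icc t D.T ⊆ Icc 0 D.T := Icc_subset_Icc_left ht.1
  obtain ⟨X, hX, rfl⟩ : ∃ X : ℝ → Fin n → ℝ, HasIntegralDerivOn t D.T X
      (fun s => (D.A s - D.B s * D.Upsilon P s) *ᵥ X s) ∧ X t = x := by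
    simpa using (hf.mono ht.1 le_rfl).exists_vec ht.2.le integrableOn_zero x
  refine ⟨X, fun s => P s *ᵥ X s, isBVPSolution_of_hasIntegralDerivOn
    (hX.congr_on (fun _ _ => rfl) fun s _ => ?_)
    (costate_hasIntegralDerivOn hD ht.1 ((hP.hasIntegralDerivOn hD hf).mono ht.1 le_rfl) hX)
    ?_ fun s hs => ?_⟩
  · simp only [closedLoop_eq_drift_sub, Matrix.sub_mulVec, Matrix.mulVec_mulVec]
  · rw [← hP.value_eq hD hf hD.T_mem, hD.value_terminal hf]
  · exact (nonlocalForm_eq_nonlocalWeight hD hΥ hΨ (hsub hs) (fun τ hτ => (hf.mono ht.1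
      le_rfl).vec_eq hX hs ⟨hs.1.trans hτ.1, hτ.2⟩) fun τ _ => gain_eq_Upsilon_mulVec rfl).symm

end RiccatiToBVP

section BVPToRiccati

variable {Qh Ξ Λ P Ψ Y : ℝ → Matrix (Fin n) (Fin n) ℝ} {X φ : ℝ → Fin n → ℝ} {x : Fin n → ℝ}
  {s t : ℝ}

variable (D Qh) in
/-- The coefficient matrix of the linear system for `(X, φ)` in the boundary value problem. -/
def hamiltonian (s : ℝ) : Matrix (Fin n ⊕ Fin n) (Fin n ⊕ Fin n) ℝ :=
  Matrix.fromBlocks (D.drift s) (-(D.B s * D.Minv s * (D.B s)ᵀ))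
    (-(Qh s - (D.S s s)ᵀ * D.Minv s * D.S s s)) (-(D.drift s)ᵀ)

variable (D Qh Ξ Λ) in
/-- `(Ξ, Λ)` is the matrix solution on `[0,T]` of the linear system for `(X, φ)` in the boundary
value problem with terminal value `(1, G(T))`. -/
structure IsHamiltonianFlow : Prop where
  state : HasIntegralDerivOn 0 D.T Ξ
    fun s => D.drift s * Ξ s - D.B s * D.Minv s * (D.B s)ᵀ * Λ s
  costate : HasIntegralDerivOn 0 D.T Λ
    fun s => -((D.drift s)ᵀ * Λ s + (Qh s - (D.S s s)ᵀ * D.Minv s * D.S s s) * Ξ s)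
  state_terminal : Ξ D.T = 1
  costate_terminal : Λ D.T = D.G D.T

theorem hasIntegralDerivOn_hamiltonian_iff {a b : ℝ} :
    HasIntegralDerivOn a b (fun s => Sum.elim (X s) (φ s))
        (fun s => D.hamiltonian Qh s *ᵥ Sum.elim (X s) (φ s)) ↔
      HasIntegralDerivOn a b X
        (fun s => D.drift s *ᵥ X s - (D.B s * D.Minv s * (D.B s)ᵀ) *ᵥ φ s) ∧
      HasIntegralDerivOn a b φ
        fun s => -((D.drift s)ᵀ *ᵥ φ s + (Qh s - (D.S s s)ᵀ * D.Minv s * D.S s s) *ᵥ X s) := by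
  simp only [hasIntegralDerivOn_pi, Sum.forall, hamiltonian, Matrix.fromBlocks_mulVec,
    Sum.elim_comp_inl, Sum.elim_comp_inr, Sum.elim_inl, Sum.elim_inr, Matrix.neg_mulVec,
    ← sub_eq_add_neg, neg_add_rev]

section Integrability

variable (hD : D.WeakAssumptions)
include hD

theorem memLp_inputWeight :
    MemLp (fun s => D.B s * D.Minv s * (D.B s)ᵀ) ⊤ (volume.restrict (Icc 0 D.T)) :=
  memLp_matrix_mul (p := ⊤) (memLp_matrix_mul (p := ⊤) hD.B_memLp
    (memLp_top_of_continuousOn_Icc hD.continuousOn_Minv)) (memLp_matrix_transpose hD.B_memLp)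

theorem integrableOn_drift : IntegrableOn D.drift (Icc 0 D.T) := by
  have control : MemLp (fun s => D.B s * D.Minv s * D.S s s) ⊤ (volume.restrict (Icc 0 D.T)) :=
    memLp_matrix_mul (p := ⊤) (memLp_matrix_mul (p := ⊤) hD.B_memLp
      (memLp_top_of_continuousOn_Icc hD.continuousOn_Minv))
      (memLp_top_of_continuousOn_Icc hD.S_C1.continuousOn_diag)
  exact hD.A_integrableOn.sub (memLp_one_iff_integrable.1 (control.mono_exponent le_top))

theorem integrableOn_stateWeight (hQh : IntegrableOn Qh (Icc 0 D.T)) :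
    IntegrableOn (fun s => Qh s - (D.S s s)ᵀ * D.Minv s * D.S s s) (Icc 0 D.T) :=
  hQh.sub (continuousOn_matrix_mul (continuousOn_matrix_mul
    (continuousOn_matrix_transpose hD.S_C1.continuousOn_diag) hD.continuousOn_Minv)
    hD.S_C1.continuousOn_diag).integrableOn_Icc

theorem integrableOn_hamiltonian (hQh : IntegrableOn Qh (Icc 0 D.T)) :
    IntegrableOn (D.hamiltonian Qh) (Icc 0 D.T) := by
  have drift := memLp_one_iff_integrable.2 (integrableOn_drift hD)
  exact memLp_one_iff_integrable.1 (memLp_matrix_fromBlocks drift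
    ((memLp_inputWeight hD).mono_exponent le_top).neg
    (memLp_one_iff_integrable.2 (integrableOn_stateWeight hD hQh)).neg
    (memLp_matrix_transpose drift).neg)

theorem IsBVPSolution.hasIntegralDerivOn (hQh : IntegrableOn Qh (Icc 0 D.T)) (ht : 0 ≤ t)
    (h : D.IsBVPSolution Qh t x X φ) :
    HasIntegralDerivOn t D.T (fun s => Sum.elim (X s) (φ s))
      fun s => D.hamiltonian Qh s *ᵥ Sum.elim (X s) (φ s) := by
  have hsub : Icc t D.T ⊆ Icc 0 D.T := Icc_subset_Icc_left ht
  have drift := (integrableOn_drift hD).mono_set hsub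
  have input := memLp_one_iff_integrable.1
    ((memLp_Icc_mono (memLp_inputWeight hD) ht le_rfl).mono_exponent le_top)
  have drift_transpose := (matrixTransposeCLM _ _).integrable_comp drift
  have state := (integrableOn_stateWeight hD hQh).mono_set hsub
  exact hasIntegralDerivOn_hamiltonian_iff.2
    ⟨.of_initial ((integrableOn_matrix_mulVec drift h.continuousOn_X).sub
      (integrableOn_matrix_mulVec input h.continuousOn_φ)) h.eq_X,
    .of_terminal ((integrableOn_matrix_mulVec drift_transpose h.continuousOn_φ).add
      (integrableOn_matrix_mulVec state h.continuousOn_X)) h.eq_φ⟩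

theorem exists_isHamiltonianFlow (hQh : IntegrableOn Qh (Icc 0 D.T)) :
    ∃ Ξ Λ, D.IsHamiltonianFlow Qh Ξ Λ := by
  obtain ⟨Ψ, Y, hf, -⟩ := exists_isFundamental hD.T_pos.le (integrableOn_hamiltonian hD hQh)
  let R : Matrix (Fin n ⊕ Fin n) (Fin n) ℝ := Matrix.fromRows 1 (D.G D.T)
  let Z : ℝ → Matrix (Fin n ⊕ Fin n) (Fin n) ℝ := fun s => Ψ s * (Y D.T * R)
  have hZ : HasIntegralDerivOn 0 D.T Z fun s =>
      D.hamiltonian Qh s * Matrix.fromRows (Z s).toRows₁ (Z s).toRows₂ :=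
    (hf.prim.matrix_mul (.const (Y D.T * R))).congr_on (fun _ _ => rfl) fun s _ => by
      simp only [Z, Matrix.fromRows_toRows, Matrix.mul_assoc, Matrix.mul_zero, add_zero]
  have hZT : Z D.T = R := by
    simp only [Z, ← Matrix.mul_assoc, hf.mul_inv _ hD.T_mem, Matrix.one_mul]
  have rows := hasIntegralDerivOn_pi.1 hZ
  simp only [hamiltonian, Matrix.fromBlocks_mul_fromRows, Sum.forall] at rows
  refine ⟨fun s => (Z s).toRows₁, fun s => (Z s).toRows₂,
    (hasIntegralDerivOn_pi.2 rows.1).congr_on (fun _ _ => rfl) fun s _ => ?_,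
    (hasIntegralDerivOn_pi.2 rows.2).congr_on (fun _ _ => rfl) fun s _ => ?_, ?_, ?_⟩
  · ext i j
    simp only [Matrix.fromRows_apply_inl, Matrix.neg_mul, ← sub_eq_add_neg]
  · ext i j
    simp only [Matrix.fromRows_apply_inr, Matrix.neg_mul, ← neg_add_rev]
  · simp only [hZT, R, Matrix.toRows₁_fromRows]
  · simp only [hZT, R, Matrix.toRows₂_fromRows]

end Integrability

theorem IsBVPSolution.initial (h : D.IsBVPSolution Qh t x X φ) (ht : t ≤ D.T) : X t = x := by
  simpa using h.eq_X t (left_mem_Icc.2 ht)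

theorem IsBVPSolution.terminal (h : D.IsBVPSolution Qh t x X φ) (ht : t ≤ D.T) :
    φ D.T = D.G D.T *ᵥ X D.T := by
  simpa using h.eq_φ D.T (right_mem_Icc.2 ht)

theorem IsHamiltonianFlow.mulVec_hasIntegralDerivOn (hflow : D.IsHamiltonianFlow Qh Ξ Λ)
    (y : Fin n → ℝ) :
    HasIntegralDerivOn 0 D.T (fun s => Sum.elim (Ξ s *ᵥ y) (Λ s *ᵥ y))
      fun s => D.hamiltonian Qh s *ᵥ Sum.elim (Ξ s *ᵥ y) (Λ s *ᵥ y) := by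
  have apply_y {W W' : ℝ → Matrix (Fin n) (Fin n) ℝ} (h : HasIntegralDerivOn 0 D.T W W') :
      HasIntegralDerivOn 0 D.T (fun s => W s *ᵥ y) fun s => W' s *ᵥ y :=
    h.clm_comp ((matrixMulVecCLM (Fin n) (Fin n)).flip y)
  refine hasIntegralDerivOn_hamiltonian_iff.2 ⟨?_, ?_⟩
  · simpa only [Matrix.sub_mulVec, Matrix.mulVec_mulVec] using apply_y hflow.state
  · simpa only [Matrix.neg_mulVec, Matrix.add_mulVec, Matrix.mulVec_mulVec]
      using apply_y hflow.costate

theorem IsBVPSolution.eq_flow (hD : D.WeakAssumptions) (hQh : IntegrableOn Qh (Icc 0 D.T))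
    (hflow : D.IsHamiltonianFlow Qh Ξ Λ) (ht : 0 ≤ t) (h : D.IsBVPSolution Qh t x X φ)
    (hs : s ∈ Icc t D.T) : X s = Ξ s *ᵥ X D.T ∧ φ s = Λ s *ᵥ X D.T := by
  obtain ⟨Ψ, Y, hf, -⟩ := exists_isFundamental hD.T_pos.le (integrableOn_hamiltonian hD hQh)
  have hT : D.T ∈ Icc t D.T := right_mem_Icc.2 (hs.1.trans hs.2)
  have solution := (hf.mono ht le_rfl).vec_eq (h.hasIntegralDerivOn hD hQh ht) hT hs
  have flow := hf.vec_eq (hflow.mulVec_hasIntegralDerivOn (X D.T)) hD.T_mem ⟨ht.trans hs.1, hs.2⟩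
  rw [hflow.state_terminal, hflow.costate_terminal, Matrix.one_mulVec,
    ← h.terminal (hs.1.trans hs.2), ← solution] at flow
  exact Sum.elim_eq_iff.1 flow.symm

theorem IsHamiltonianFlow.isUnit_det (hD : D.WeakAssumptions)
    (hQh : IntegrableOn Qh (Icc 0 D.T)) (hflow : D.IsHamiltonianFlow Qh Ξ Λ)
    (hsol : ∀ t ∈ Ico 0 D.T, ∀ x, ∃ X φ, D.IsBVPSolution Qh t x X φ) (hs : s ∈ Icc 0 D.T) :
    IsUnit (Ξ s).det := by
  rcases hs.2.eq_or_lt with rfl | hlt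
  · simp [hflow.state_terminal]
  rw [← Matrix.isUnit_iff_isUnit_det, ← Matrix.mulVec_surjective_iff_isUnit]
  intro x
  obtain ⟨X, φ, h⟩ := hsol s ⟨hs.1, hlt⟩ x
  exact ⟨X D.T, by rw [← (h.eq_flow hD hQh hflow hs.1 (left_mem_Icc.2 hs.2)).1, h.initial hs.2]⟩

section Quotient

variable (hflow : D.IsHamiltonianFlow Qh Ξ Λ) (hP : ∀ s ∈ Icc 0 D.T, P s * Ξ s = Λ s)
include hflow hP

theorem IsHamiltonianFlow.closedLoop_hasIntegralDerivOn :
    HasIntegralDerivOn 0 D.T Ξ fun s => (D.A s - D.B s * D.Upsilon P s) * Ξ s :=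
  hflow.state.congr_on (fun _ _ => rfl) fun s hs => by
    simp only [closedLoop_eq_drift_sub, Matrix.sub_mul, Matrix.mul_assoc, hP s hs]

theorem IsHamiltonianFlow.quotient_hasIntegralDerivOn (hD : D.WeakAssumptions)
    (hdet : ∀ s ∈ Icc 0 D.T, IsUnit (Ξ s).det)
    (hf : IsFundamental 0 D.T (fun s => D.A s - D.B s * D.Upsilon P s) Ψ Y) :
    HasIntegralDerivOn 0 D.T P fun s => -((D.A s - D.B s * D.Upsilon P s)ᵀ * P s
      + P s * (D.A s - D.B s * D.Upsilon P s)
      + (D.weight (D.Upsilon P) s s - D.Q s s + Qh s)) := by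
  have P_eq : ∀ s ∈ Icc 0 D.T, P s = Λ s * (Ξ s)⁻¹ := fun s hs => by
    rw [← hP s hs, Matrix.mul_nonsing_inv_cancel_right _ _ (hdet s hs)]
  have inv_deriv := hf.matrix_inv (hflow.closedLoop_hasIntegralDerivOn hP)
  refine (hflow.costate.matrix_mul inv_deriv).congr_on P_eq fun s hs => ?_
  beta_reduce
  rw [add_right_comm, closedLoop_transpose_mul_add hD P _ hs, ← hP s hs, ← Matrix.mul_assoc,
    ← Matrix.add_mul, Matrix.neg_mul, Matrix.mul_nonsing_inv_cancel_right _ _ (hdet s hs),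
    Matrix.mul_neg, ← Matrix.mul_assoc, Matrix.mul_nonsing_inv_cancel_right _ _ (hdet s hs),
    neg_add]

theorem IsHamiltonianFlow.weight_eq_nonlocalWeight (hD : D.WeakAssumptions)
    (hQh : IntegrableOn Qh (Icc 0 D.T)) (hΥ : MemLp (D.Upsilon P) 2 (volume.restrict (Icc 0 D.T)))
    (hf : IsFundamental 0 D.T (fun s => D.A s - D.B s * D.Upsilon P s) Ψ Y)
    (hs : s ∈ Ico 0 D.T) (hsymm : (Qh s).IsSymm)
    (hsol : ∀ x, ∃ X φ, D.IsBVPSolution Qh s x X φ) :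
    Qh s = D.nonlocalWeight (D.Upsilon P) Ψ Y s := by
  have hs' : s ∈ Icc 0 D.T := Ico_subset_Icc_self hs
  have hss : s ∈ Icc s D.T := left_mem_Icc.2 hs'.2
  refine isSymm_eq_of_forall_mulVec_dotProduct_self hsymm
    (hD.nonlocalWeight_symm hΥ hf.prim.continuousOn hs') fun x => ?_
  obtain ⟨X, φ, h⟩ := hsol x
  have flow := fun {τ} => h.eq_flow hD hQh hflow hs.1 (s := τ)
  rw [← h.initial hs'.2, h.eq_Qh s hss]
  refine nonlocalForm_eq_nonlocalWeight hD hΥ hf.prim.continuousOn hs' (fun τ hτ => ?_)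
    fun τ hτ => gain_eq_Upsilon_mulVec ?_
  · rw [(flow hτ).1, (flow hss).1, hf.matrix_eq (hflow.closedLoop_hasIntegralDerivOn hP) hs'
      ⟨hs.1.trans hτ.1, hτ.2⟩]
    simp only [Matrix.mulVec_mulVec]
  · rw [(flow hτ).2, (flow hτ).1, Matrix.mulVec_mulVec, hP τ ⟨hs.1.trans hτ.1, hτ.2⟩]

end Quotient

theorem BVPSolvable.exists_isRiccatiSolution (hD : D.WeakAssumptions) (h : D.BVPSolvable) :
    ∃ P, D.IsRiccatiSolution P := by
  obtain ⟨Qh, hsymm, hInt, hsol⟩ := h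
  have hQh : IntegrableOn Qh (Icc 0 D.T) := .of_eval fun i => .of_eval fun j => hInt i j
  obtain ⟨Ξ, Λ, hflow⟩ := exists_isHamiltonianFlow hD hQh
  have hdet : ∀ s ∈ Icc 0 D.T, IsUnit (Ξ s).det := fun s => hflow.isUnit_det hD hQh hsol
  let P : ℝ → Matrix (Fin n) (Fin n) ℝ := fun s => Λ s * (Ξ s)⁻¹
  have hP : ∀ s ∈ Icc 0 D.T, P s * Ξ s = Λ s := fun s hs =>
    Matrix.nonsing_inv_mul_cancel_right _ _ (hdet s hs)
  have hPc : ContinuousOn P (Icc 0 D.T) := continuousOn_matrix_mul hflow.costate.continuousOn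
    (continuousOn_matrix_inv hflow.state.continuousOn hdet)
  have hΥ := (memLp_Upsilon hD hPc).mono_exponent (p := 2) le_top
  obtain ⟨Ψ, Y, hf, -⟩ := exists_isFundamental hD.T_pos.le (hD.integrableOn_closedLoop hΥ)
  refine ⟨P, isRiccatiSolution_of_value_eq hD hPc hf fun s hs =>
    hf.lyapunov_unique (hD.value_diag_hasIntegralDerivOn hΥ hf)
      ((hflow.quotient_hasIntegralDerivOn hP hD hdet hf).congr (fun _ _ => rfl) ?_) ?_ hs⟩
  · filter_upwards [ae_restrict_of_ae (Measure.ae_ne volume D.T),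
      ae_restrict_mem measurableSet_Icc] with s hne hs
    rw [hflow.weight_eq_nonlocalWeight hP hD hQh hΥ hf ⟨hs.1, hs.2.lt_of_ne hne⟩ (hsymm s hs)
      (hsol s ⟨hs.1, hs.2.lt_of_ne hne⟩)]
  · simp only [P, hD.value_terminal hf, hflow.state_terminal, hflow.costate_terminal, inv_one,
      Matrix.mul_one]

end BVPToRiccati
end LQProblem

end

theorem mainTheorem1_general {n m : ℕ} (D : LQProblem n m) (hD : D.WeakAssumptions) :
    List.TFAE [
      ∃ ub : ℝ → (Fin n → ℝ) → Fin m → ℝ, D.IsLinearEquilibrium ub,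
      D.BVPSolvable,
      ∃ P : ℝ → Matrix (Fin n) (Fin n) ℝ, D.IsRiccatiSolution P] ∧
    ∀ P : ℝ → Matrix (Fin n) (Fin n) ℝ, D.IsRiccatiSolution P →
      D.IsLinearEquilibrium (D.riccatiFeedback P) := by
  refine ⟨?_, fun P hP => hP.isLinearEquilibrium hD⟩
  tfae_have 1 → 3 := fun ⟨_, h⟩ => h.exists_isRiccatiSolution hD
  tfae_have 3 → 1 := fun ⟨_, hP⟩ => ⟨_, hP.isLinearEquilibrium hD⟩
  tfae_have 3 → 2 := fun ⟨_, hP⟩ => hP.bvpSolvable hD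
  tfae_have 2 → 3 := fun h => h.exists_isRiccatiSolution hD
  tfae_finish

theorem mainTheorem1 {n m : ℕ} (D : LQProblem n m) (hD : D.Assumptions) :
    List.TFAE [
      ∃ ub : ℝ → (Fin n → ℝ) → Fin m → ℝ, D.IsLinearEquilibrium ub,
      D.BVPSolvable,
      ∃ P : ℝ → Matrix (Fin n) (Fin n) ℝ, D.IsRiccatiSolution P] ∧
    ∀ P : ℝ → Matrix (Fin n) (Fin n) ℝ, D.IsRiccatiSolution P →
      D.IsLinearEquilibrium (D.riccatiFeedback P) :=
  mainTheorem1_general D hD.weak
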